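/- Conventions. A \emph{model category} is bicomplete and has functorial factorizations. For a set of maps $I$, a relative $I$-cell complex is a transfinite composition of pushouts of coproducts of maps of $I$; a presentation of it is a choice of such a sequence together with the cells, attaching maps and pushout squares at each step; a subcomplex of a presentation is given by a subset of the cells, together with a sequence built from the same initial object by attaching exactly these cells, mapping compatibly to the given sequence; its size is its number of cells. An object $W$ is \emph{compact relative to $I$} if there is a cardinal $\kappa$ such that for every presented relative $I$-cell complex $Y\to Z$ every map $W\to Z$ factors through a subcomplex of size at most $\kappa$. A map $X\to Y$ is an \emph{effective monomorphism} if it is the equalizer of the two maps $Y\rightrightarrows Y\amalg_X Y$. A model category is \emph{cellular} if it is cofibrantly generated by some set $I$ of generating cofibrations and some set $J$ of generating trivial cofibrations such that (1) the domains and codomains of $I$ are compact relative to $I$; (2) the domains of $J$ are small relative to the cofibrations; (3) cofibrations are effective monomorphisms. It is \emph{left proper} if pushouts of weak equivalences along cofibrations are weak equivalences. Let $\mathcal C$ be a left proper cellular model category. (a) Let $G:\mathcal C\to\mathcal C$ be a left Quillen endofunctor. Let $Sp^{\mathbb N}(\mathcal C,G)$ be the category of sequences $(X_n)_{n\ge 0}$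 of objects of $\mathcal C$ with structure maps $GX_n\to X_{n+1}$, and maps of sequences commuting with the structure maps. (b) Let $\mathcal D$ be a (closed) symmetric monoidal model category such that $\mathcal C$ is a $\mathcal D$-model category (tensored, cotensored and enriched over $\mathcal D$, compatibly with the model structures), and let $K$ be a cofibrant object of $\mathcal D$. Let $Sp^{\Sigma}(\mathcal C,K)$ be the category of symmetric spectra: sequences of objects $X_n$ of $\mathcal C$ with an action of $\Sigma_n$ and $\Sigma_n$-equivariant maps $X_n\otimes K\to X_{n+1}$ such that all iterated maps $X_n\otimes K^{\otimes p}\to X_{n+p}$ are $\Sigma_n\times\Sigma_p$-equivariant; maps are sequences of $\Sigma_n$-equivariant maps commuting with the structure maps. In both categories call a map a level equivalence (level fibration, level trivial fibration) if each of its components is a weak equivalence (fibration, trivial fibration) in $\mathcal C$, and a projective cofibration if it has the left lifting property with respect to all level trivial fibrations. Theorem. In each of $Sp^{\mathbb N}(\mathcal C,G)$ and $Sp^{\Sigma}(\mathcal C,K)$ the level equivalences, level fibrations and projective cofibrations form a model structure (the projective model structure), and with it the category is a left proper cellular model category. More precisely, each evaluation functor $X\mapsto X_n$ has a left adjoint $F_n$,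 and whenever sets $I$ and $J$ exhibit $\mathcal C$ as a cellular model category, the sets $\bigcup_n F_nI$ and $\bigcup_n F_nJ$ exhibit the projective model structure as cellular. In particular, for every domain or codomain $A$ of a map of $I$ and every $n\ge 0$, the object $F_nA$ is compact relative to $\bigcup_n F_nI$, and projective cofibrations are effective monomorphisms. -/

import Mathlib

open CategoryTheory Limits HomotopicalAlgebra MonoidalCategory Opposite
open scoped MonoidalRightAction

universe v u u'

namespace StableModel

/-! ## Model categories -/

section ModelCategories

/-- The three given classes of maps are a model structure on the bicomplete category `C`, with
functorial factorizations. -/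
class IsModelCategory (C : Type u) [Category.{v} C] [hF : CategoryWithFibrations C]
    [hC : CategoryWithCofibrations C] [hW : CategoryWithWeakEquivalences C] : Prop where
  hasLimits : HasLimits C
  hasColimits : HasColimits C
  exists_modelCategory : ∃ M : ModelCategory C, M.categoryWithFibrations = hF ∧
    M.categoryWithCofibrations = hC ∧ M.categoryWithWeakEquivalences = hW
  functorial₁ : MorphismProperty.HasFunctorialFactorization (trivialCofibrations C) (fibrations C)
  functorial₂ : MorphismProperty.HasFunctorialFactorization (cofibrations C) (trivialFibrations C)

attribute [instance] IsModelCategory.hasLimits IsModelCategory.hasColimits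

/-- Pushouts of weak equivalences along cofibrations are weak equivalences. -/
def IsLeftProper (C : Type u) [Category.{v} C] [CategoryWithCofibrations C]
    [CategoryWithWeakEquivalences C] : Prop :=
  ∀ ⦃A B X P : C⦄ (w : A ⟶ X) (i : A ⟶ B) (i' : X ⟶ P) (w' : B ⟶ P),
    IsPushout w i i' w' → weakEquivalences C w → cofibrations C i → weakEquivalences C w'

/-- A left Quillen functor: a left adjoint which preserves cofibrations and trivial
cofibrations. -/
structure IsLeftQuillen {C : Type u} [Category.{v} C] [CategoryWithCofibrations C]
    [CategoryWithWeakEquivalences C] {C' : Type u'} [Category.{v} C']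
    [CategoryWithCofibrations C'] [CategoryWithWeakEquivalences C'] (G : C ⥤ C') : Prop where
  isLeftAdjoint : G.IsLeftAdjoint
  map_cofibration : ∀ ⦃X Y : C⦄ (f : X ⟶ Y), cofibrations C f → cofibrations C' (G.map f)
  map_trivialCofibration : ∀ ⦃X Y : C⦄ (f : X ⟶ Y),
    trivialCofibrations C f → trivialCofibrations C' (G.map f)

end ModelCategories

/-! ## Smallness, cell complexes, compactness -/

section Cellular

variable {C : Type u} [Category.{v} C]

/-- `A` is small relative to the class `W`: for some cardinal `κ`, the functor `Hom(A, -)`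
commutes with the colimits of all `λ`-sequences of maps of `W`, for all `κ`-filtered ordinals
`λ` (limit ordinals in which every subset of cardinality at most `κ` is bounded). -/
def IsSmallRelativeTo (W : MorphismProperty C) (A : C) : Prop :=
  ∃ κ : Cardinal.{v}, ∀ (J : Type v) [LinearOrder J] [OrderBot J] [SuccOrder J]
    [WellFoundedLT J], NoMaxOrder J → (∀ S : Set J, Cardinal.mk S ≤ κ → BddAbove S) →
    ∀ F : J ⥤ C, F.IsWellOrderContinuous →
      (∀ j : J, W (F.map (homOfLE (Order.le_succ j)))) →
        PreservesColimit F (coyoneda.obj (op A))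

/-- The relative `I`-cell complexes. -/
def relativeCellComplexes (I : MorphismProperty C) : MorphismProperty C :=
  MorphismProperty.transfiniteCompositions.{v} (MorphismProperty.coproducts.{v} I).pushouts

/-- The class `I` is a set, the class `J` is a set, and these are generating cofibrations and
generating trivial cofibrations. -/
structure IsCofibrantlyGeneratedBy [CategoryWithFibrations C] [CategoryWithWeakEquivalences C]
    (I J : MorphismProperty C) : Prop where
  isSmall_I : MorphismProperty.IsSmall.{v} I
  isSmall_J : MorphismProperty.IsSmall.{v} J
  small_I : ∀ ⦃A B : C⦄ (i : A ⟶ B), I i → IsSmallRelativeTo (relativeCellComplexes I) A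
  small_J : ∀ ⦃A B : C⦄ (j : A ⟶ B), J j → IsSmallRelativeTo (relativeCellComplexes J) A
  fibrations_eq : fibrations C = J.rlp
  trivialFibrations_eq : trivialFibrations C = I.rlp

/-- `f` is an effective monomorphism: it is the equalizer of the two maps `Y ⇉ Y ⨿_X Y`. -/
def IsEffectiveMono {X Y : C} (f : X ⟶ Y) : Prop :=
  ∃ (P : C) (inl inr : Y ⟶ P) (h : IsPushout f f inl inr), Nonempty (IsLimit (Fork.ofι f h.w))

/-- The commutative squares formed by `g i : A i ⟶ B i`, `h i`, `d i` and `f` exhibit `f` as the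
pushout of the coproduct of the maps `g i` along the map `∐ A i ⟶ X₁` with components `h i`. -/
def IsCellAttachment {ι : Type v} {A B : ι → C} (g : ∀ i, A i ⟶ B i) {X₁ X₂ : C} (f : X₁ ⟶ X₂)
    (h : ∀ i, A i ⟶ X₁) (d : ∀ i, B i ⟶ X₂) : Prop :=
  ∃ (a : Cofan A) (b : Cofan B) (ha : IsColimit a) (hb : IsColimit b),
    IsPushout (Cofan.IsColimit.desc ha h) (Cofan.IsColimit.desc ha fun i ↦ g i ≫ b.inj i)
      f (Cofan.IsColimit.desc hb d)

variable {I : MorphismProperty C} {J : Type v} [LinearOrder J] [OrderBot J] [SuccOrder J]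
  [WellFoundedLT J]

/-- A presentation of `f` as a relative `I`-cell complex, indexed by a nonempty ordinal given as a
well-ordered type `J`: a `J`-sequence with colimit `f`, with a choice, at each step, of a family
of maps of `I` (the cells), of attaching maps, and of a pushout square. -/
abbrev CellPresentation (I : MorphismProperty C) (J : Type v) [LinearOrder J] [OrderBot J]
    [SuccOrder J] [WellFoundedLT J] {X Y : C} (f : X ⟶ Y) :=
  RelativeCellComplex.{v} (fun _ : J ↦ I.homFamily) f

/-- The attaching map `C_i ⟶ X_β` of a cell. -/
def cellAttachingMap {X Y : C} {f : X ⟶ Y} (c : CellPresentation I J f) (γ : c.Cells) :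
    γ.i.1.left ⟶ c.F.obj γ.j :=
  (c.attachCells γ.j γ.hj).cofan₁.inj γ.k ≫ (c.attachCells γ.j γ.hj).g₁

/-- The characteristic map `D_i ⟶ X_{β+1}` of a cell. -/
def cellMap {X Y : C} {f : X ⟶ Y} (c : CellPresentation I J f) (γ : c.Cells) :
    γ.i.1.right ⟶ c.F.obj (Order.succ γ.j) :=
  (c.attachCells γ.j γ.hj).cell γ.k

/-- A subcomplex of a presented relative `I`-cell complex: a set of cells, a sequence `F` with the
same initial term and with a map to the given sequence, and factorizations of the attaching maps of
the chosen cells such that each term of `F` is obtained from the previous one by attaching the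
chosen cells, compatibly with the map to the given sequence. -/
structure Subcomplex {X Y : C} {f : X ⟶ Y} (c : CellPresentation I J f) where
  cells : Set c.Cells
  F : J ⥤ C
  isWellOrderContinuous : F.IsWellOrderContinuous
  φ : F ⟶ c.F
  isIso_bot : IsIso (φ.app ⊥)
  attachingMap (γ : c.Cells) (hγ : γ ∈ cells) : γ.i.1.left ⟶ F.obj γ.j
  attachingMap_φ (γ : c.Cells) (hγ : γ ∈ cells) :
    attachingMap γ hγ ≫ φ.app γ.j = cellAttachingMap c γ
  map (γ : c.Cells) (hγ : γ ∈ cells) : γ.i.1.right ⟶ F.obj (Order.succ γ.j)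
  map_φ (γ : c.Cells) (hγ : γ ∈ cells) : map γ hγ ≫ φ.app (Order.succ γ.j) = cellMap c γ
  isCellAttachment (j : J) (hj : ¬ IsMax j) :
    IsCellAttachment (ι := {k : (c.attachCells j hj).ι //
        (⟨j, hj, k⟩ : c.Cells) ∈ cells})
      (fun k ↦ I.homFamily ((c.attachCells j hj).π k.1)) (F.map (homOfLE (Order.le_succ j)))
      (fun k ↦ attachingMap ⟨j, hj, k.1⟩ k.2) (fun k ↦ map ⟨j, hj, k.1⟩ k.2)

/-- The map `p : W ⟶ Y` to the target of a presented relative cell complex factors through the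
subcomplex `S`, that is, through the map from the colimit of the sequence of `S` to `Y`. -/
def Subcomplex.FactorsThrough {X Y : C} {f : X ⟶ Y} {c : CellPresentation I J f}
    (S : Subcomplex c) {W : C} (p : W ⟶ Y) : Prop :=
  ∃ (t : Cocone S.F) (ht : IsColimit t) (s : W ⟶ t.pt), s ≫ ht.desc ⟨Y, S.φ ≫ c.incl⟩ = p

/-- `W` is `κ`-compact relative to `I`: for every presented relative `I`-cell complex, every map
from `W` to its target factors through a subcomplex with at most `κ` cells. -/
def IsCompactRelativeToOfSize (κ : Cardinal.{v}) (I : MorphismProperty C) (W : C) : Prop :=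
  ∀ (J : Type v) [LinearOrder J] [OrderBot J] [SuccOrder J] [WellFoundedLT J]
    ⦃X Y : C⦄ (f : X ⟶ Y) (c : CellPresentation I J f) (p : W ⟶ Y),
    ∃ S : Subcomplex c, Cardinal.mk S.cells ≤ κ ∧ S.FactorsThrough p

/-- `W` is compact relative to `I`. -/
def IsCompactRelativeTo (I : MorphismProperty C) (W : C) : Prop :=
  ∃ κ : Cardinal.{v}, IsCompactRelativeToOfSize κ I W

/-- The sets of maps `I` and `J` exhibit a model category as a cellular model category. -/
structure IsCellularBy [CategoryWithFibrations C] [CategoryWithCofibrations C]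
    [CategoryWithWeakEquivalences C] (I J : MorphismProperty C) : Prop
    extends IsCofibrantlyGeneratedBy I J where
  compact_domain : ∀ ⦃A B : C⦄ (i : A ⟶ B), I i → IsCompactRelativeTo I A
  compact_codomain : ∀ ⦃A B : C⦄ (i : A ⟶ B), I i → IsCompactRelativeTo I B
  small_cofibrations : ∀ ⦃A B : C⦄ (j : A ⟶ B), J j → IsSmallRelativeTo (cofibrations C) A
  effectiveMono : ∀ ⦃A B : C⦄ (f : A ⟶ B), cofibrations C f → IsEffectiveMono f

/-- The model category `C` is cellular. -/
def IsCellular (C : Type u) [Category.{v} C] [CategoryWithFibrations C]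
    [CategoryWithCofibrations C] [CategoryWithWeakEquivalences C] : Prop :=
  ∃ I J : MorphismProperty C, IsCellularBy I J

end Cellular

/-- For functors `F n : C ⥤ S`, the class of all maps `F n (i)` with `n ≥ 0` and `i` in `I`. -/
def freeMaps {C : Type u} [Category.{v} C] {S : Type u'} [Category.{v} S] (F : ℕ → C ⥤ S)
    (I : MorphismProperty C) : MorphismProperty S :=
  ⨆ n, I.strictMap (F n)

/-- For functors `ev n : S ⥤ C`, the class of all maps `f` such that each `ev n (f)` is in `W`. -/
def levelwise {C : Type u} [Category.{v} C] {S : Type u'} [Category.{v} S] (ev : ℕ → S ⥤ C)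
    (W : MorphismProperty C) : MorphismProperty S :=
  fun _ _ f ↦ ∀ n, W ((ev n).map f)

/-! ## Spectra -/

section Spectra

variable {C : Type u} [Category.{v} C]

/-- A spectrum for the endofunctor `G`: objects `X n` and structure maps `G (X n) ⟶ X (n + 1)`. -/
structure Spectrum (G : C ⥤ C) where
  X : ℕ → C
  σ (n : ℕ) : G.obj (X n) ⟶ X (n + 1)

namespace Spectrum

variable {G : C ⥤ C}

/-- Maps of spectra. -/
@[ext]
structure Hom (X Y : Spectrum G) where
  hom (n : ℕ) : X.X n ⟶ Y.X n
  comm (n : ℕ) : X.σ n ≫ hom (n + 1) = G.map (hom n) ≫ Y.σ n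

instance : Category (Spectrum G) where
  Hom := Hom
  id X := { hom := fun n ↦ 𝟙 (X.X n), comm := by simp }
  comp f g :=
    { hom := fun n ↦ f.hom n ≫ g.hom n
      comm := fun n ↦ by
        rw [← Category.assoc, f.comm, Category.assoc, g.comm, G.map_comp, Category.assoc] }
  id_comp f := Hom.ext (funext fun n ↦ Category.id_comp (f.hom n))
  comp_id f := Hom.ext (funext fun n ↦ Category.comp_id (f.hom n))
  assoc f g h := Hom.ext (funext fun n ↦ Category.assoc (f.hom n) (g.hom n) (h.hom n))

/-- Evaluation at `n`. -/
def ev (G : C ⥤ C) (n : ℕ) : Spectrum G ⥤ C where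
  obj X := X.X n
  map f := f.hom n

/-- Level fibrations. -/
instance [CategoryWithFibrations C] : CategoryWithFibrations (Spectrum G) :=
  ⟨levelwise (ev G) (fibrations C)⟩

/-- Level equivalences. -/
instance [CategoryWithWeakEquivalences C] : CategoryWithWeakEquivalences (Spectrum G) :=
  ⟨levelwise (ev G) (weakEquivalences C)⟩

/-- Projective cofibrations: the maps with the left lifting property with respect to all level
trivial fibrations. -/
instance [CategoryWithFibrations C] [CategoryWithWeakEquivalences C] :
    CategoryWithCofibrations (Spectrum G) :=
  ⟨(levelwise (ev G) (trivialFibrations C)).llp⟩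

end Spectrum

end Spectra

/-! ## Monoidal model categories and their modules -/

section Monoidal

/-- The pushout product axiom for a bifunctor. -/
def PushoutProductAxiom {C₁ C₂ C₃ : Type*} [Category* C₁] [Category* C₂] [Category* C₃]
    [CategoryWithCofibrations C₁] [CategoryWithWeakEquivalences C₁]
    [CategoryWithCofibrations C₂] [CategoryWithWeakEquivalences C₂]
    [CategoryWithCofibrations C₃] [CategoryWithWeakEquivalences C₃]
    (F : C₁ ⥤ C₂ ⥤ C₃) : Prop :=
  ∀ ⦃X₁ Y₁ : C₁⦄ (f₁ : X₁ ⟶ Y₁) ⦃X₂ Y₂ : C₂⦄ (f₂ : X₂ ⟶ Y₂) (sq : F.PushoutObjObj f₁ f₂),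
    cofibrations C₁ f₁ → cofibrations C₂ f₂ →
      cofibrations C₃ sq.ι ∧
        (weakEquivalences C₁ f₁ ∨ weakEquivalences C₂ f₂ → weakEquivalences C₃ sq.ι)

/-- Compatibility of a closed symmetric monoidal structure with a model structure: the pushout
product axiom, and `QS ⊗ X ⟶ S ⊗ X` is a weak equivalence for every cofibrant approximation
`QS ⟶ S` to the unit and every cofibrant `X`. -/
structure IsMonoidalModelCategory (D : Type u) [Category.{v} D] [MonoidalCategory D]
    [CategoryWithFibrations D] [CategoryWithCofibrations D] [CategoryWithWeakEquivalences D]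
    [IsModelCategory D] : Prop where
  pushoutProduct : PushoutProductAxiom (curriedTensor D)
  unit : ∀ ⦃Q : D⦄ (q : Q ⟶ 𝟙_ D), IsCofibrant Q → weakEquivalences D q →
    ∀ X : D, IsCofibrant X → weakEquivalences D (q ▷ X)

/-- `C`, with a right action `X ⊙ᵣ K` of the monoidal model category `D`, is a `D`-model category:
it is tensored (by the action), cotensored and enriched over `D`, i.e. the action has right adjoints
in each variable, and this is compatible with the model structures. -/
structure IsModuleModelCategory (D : Type u') [Category.{v} D] [MonoidalCategory D]
    [CategoryWithFibrations D] [CategoryWithCofibrations D] [CategoryWithWeakEquivalences D]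
    [IsModelCategory D]
    (C : Type u) [Category.{v} C] [CategoryWithFibrations C] [CategoryWithCofibrations C]
    [CategoryWithWeakEquivalences C] [IsModelCategory C] [MonoidalRightAction D C] : Prop where
  cotensored : ∀ K : D, (MonoidalRightAction.actionRight C K).IsLeftAdjoint
  enriched : ∀ X : C, (MonoidalRightAction.actionLeft D X).IsLeftAdjoint
  pushoutProduct : PushoutProductAxiom (MonoidalRightAction.curriedAction D C)
  unit : ∀ ⦃Q : D⦄ (q : Q ⟶ 𝟙_ D), IsCofibrant Q → weakEquivalences D q →
    ∀ X : C, IsCofibrant X → weakEquivalences C (X ⊴ᵣ q)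

end Monoidal

/-! ## Symmetric spectra -/

section SymmetricSpectra

/-- The inclusion `Σ_m × Σ_n ⟶ Σ_{m+n}`. -/
def blockPerm {m n : ℕ} (g : Equiv.Perm (Fin m)) (h : Equiv.Perm (Fin n)) :
    Equiv.Perm (Fin (m + n)) :=
  finSumFinEquiv.permCongr (Equiv.Perm.sumCongr g h)

section TensorPower

variable {D : Type u'} [Category.{v} D] [MonoidalCategory D]

/-- The tensor power `K ⊗ ⋯ ⊗ K`, bracketed to the left. -/
def tensorPower (K : D) : ℕ → D
  | 0 => 𝟙_ D
  | p + 1 => tensorPower K p ⊗ K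

/-- `TensorPerm K p g φ` says that `φ` is the action of the permutation `g` on `K^{⊗p}` by the
commutativity isomorphism. This is the graph of the action of `Σ_p`: adjacent transpositions
act by the braiding of two adjacent factors, and composites of permutations act by composites.
(By coherence each `g` acts by exactly one `φ`.) -/
inductive TensorPerm [BraidedCategory D] (K : D) :
    (p : ℕ) → Equiv.Perm (Fin p) → (tensorPower K p ⟶ tensorPower K p) → Prop
  | one (p : ℕ) : TensorPerm K p 1 (𝟙 _)
  | mul {p : ℕ} {g h : Equiv.Perm (Fin p)} {φ ψ : tensorPower K p ⟶ tensorPower K p} :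
      TensorPerm K p g φ → TensorPerm K p h ψ → TensorPerm K p (g * h) (ψ ≫ φ)
  | braid (p : ℕ) : TensorPerm K (p + 2) (blockPerm (1 : Equiv.Perm (Fin p)) (Equiv.swap 0 1))
      ((α_ (tensorPower K p) K K).hom ≫ tensorPower K p ◁ (β_ K K).hom ≫
        (α_ (tensorPower K p) K K).inv)
  | whisker {p : ℕ} {g : Equiv.Perm (Fin p)} {φ : tensorPower K p ⟶ tensorPower K p} :
      TensorPerm K p g φ → TensorPerm K (p + 1) (blockPerm g (1 : Equiv.Perm (Fin 1))) (φ ▷ K)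

variable {C : Type u} [Category.{v} C] [MonoidalRightAction D C]

/-- The iterated structure map `X_n ⊗ K^{⊗p} ⟶ X_{n+1} ⊗ K^{⊗(p-1)} ⟶ ⋯ ⟶ X_{n+p}`. -/
def iteratedStructureMap (K : D) (X : ℕ → C) (σ : ∀ n, X n ⊙ᵣ K ⟶ X (n + 1)) (n : ℕ) :
    (p : ℕ) → (X n ⊙ᵣ tensorPower K p ⟶ X (n + p))
  | 0 => (ρᵣ (X n)).hom
  | p + 1 => (αᵣ (X n) (tensorPower K p) K).hom ≫
      iteratedStructureMap K X σ n p ⊵ᵣ K ≫ σ (n + p)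

end TensorPower

/-- A symmetric spectrum: objects `X n` with a left action `ρ n` of the symmetric group `Σ_n`, and
`Σ_n`-equivariant structure maps `X n ⊗ K ⟶ X (n + 1)`, such that the iterated structure maps
`X n ⊗ K^{⊗p} ⟶ X (n + p)` are `Σ_n × Σ_p`-equivariant. -/
structure SymmetricSpectrum (C : Type u) [Category.{v} C] {D : Type u'} [Category.{v} D]
    [MonoidalCategory D] [SymmetricCategory D] [MonoidalRightAction D C] (K : D) where
  X : ℕ → C
  ρ (n : ℕ) : Equiv.Perm (Fin n) →* End (X n)
  σ (n : ℕ) : X n ⊙ᵣ K ⟶ X (n + 1)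
  σ_equivariant (n : ℕ) (g : Equiv.Perm (Fin n)) :
    (ρ n g : X n ⟶ X n) ⊵ᵣ K ≫ σ n = σ n ≫ ρ (n + 1) (blockPerm g (1 : Equiv.Perm (Fin 1)))
  iterated_equivariant (n p : ℕ) (g : Equiv.Perm (Fin n)) (h : Equiv.Perm (Fin p))
    (φ : tensorPower K p ⟶ tensorPower K p) (hφ : TensorPerm K p h φ) :
    ((ρ n g : X n ⟶ X n) ⊙ᵣₘ φ) ≫ iteratedStructureMap K X σ n p =
      iteratedStructureMap K X σ n p ≫ ρ (n + p) (blockPerm g h)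

namespace SymmetricSpectrum

variable {C : Type u} [Category.{v} C] {D : Type u'} [Category.{v} D]
  [MonoidalCategory D] [SymmetricCategory D] [MonoidalRightAction D C] {K : D}

/-- Maps of symmetric spectra. -/
@[ext]
structure Hom (X Y : SymmetricSpectrum C K) where
  hom (n : ℕ) : X.X n ⟶ Y.X n
  equivariant (n : ℕ) (g : Equiv.Perm (Fin n)) : X.ρ n g ≫ hom n = hom n ≫ Y.ρ n g
  comm (n : ℕ) : X.σ n ≫ hom (n + 1) = hom n ⊵ᵣ K ≫ Y.σ n

instance : Category (SymmetricSpectrum C K) where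
  Hom := Hom
  id X :=
    { hom := fun n ↦ 𝟙 (X.X n)
      equivariant := fun n g ↦ (Category.comp_id _).trans (Category.id_comp _).symm
      comm := by simp }
  comp f g :=
    { hom := fun n ↦ f.hom n ≫ g.hom n
      equivariant := fun n a ↦ by
        rw [← Category.assoc, f.equivariant, Category.assoc, g.equivariant, Category.assoc]
      comm := fun n ↦ by
        rw [← Category.assoc, f.comm, Category.assoc, g.comm,
          MonoidalRightAction.comp_actionHomLeft, Category.assoc] }
  id_comp f := Hom.ext (funext fun n ↦ Category.id_comp (f.hom n))
  comp_id f := Hom.ext (funext fun n ↦ Category.comp_id (f.hom n))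
  assoc f g h := Hom.ext (funext fun n ↦ Category.assoc (f.hom n) (g.hom n) (h.hom n))

/-- Evaluation at `n`. -/
def ev (C : Type u) [Category.{v} C] {D : Type u'} [Category.{v} D] [MonoidalCategory D]
    [SymmetricCategory D] [MonoidalRightAction D C] (K : D) (n : ℕ) :
    SymmetricSpectrum C K ⥤ C where
  obj X := X.X n
  map f := f.hom n

/-- Level fibrations. -/
instance [CategoryWithFibrations C] : CategoryWithFibrations (SymmetricSpectrum C K) :=
  ⟨levelwise (ev C K) (fibrations C)⟩

/-- Level equivalences. -/
instance [CategoryWithWeakEquivalences C] :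
    CategoryWithWeakEquivalences (SymmetricSpectrum C K) :=
  ⟨levelwise (ev C K) (weakEquivalences C)⟩

/-- Projective cofibrations: the maps with the left lifting property with respect to all level
trivial fibrations. -/
instance [CategoryWithFibrations C] [CategoryWithWeakEquivalences C] :
    CategoryWithCofibrations (SymmetricSpectrum C K) :=
  ⟨(levelwise (ev C K) (trivialFibrations C)).llp⟩

end SymmetricSpectrum

end SymmetricSpectra

end StableModel

namespace StableModel

/-! ### Smallness and the small object argument -/

section Smallness

variable {C : Type u} [Category.{v} C]

/-! Limits and colimits of spectra are computed levelwise, and each evaluation `ev n` has a left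
adjoint `F n`. The one genuine computation with spectra is that `ev m` after `F n` preserves
cofibrations and trivial cofibrations. Level `m` of `F n A` is in effect a coproduct of copies of
the power `T^(m-n) A`, one for each coset in `Γ m` of the permutations of the factors, and it is
initial if `m < n` (`llp_freeMap`). The free spectrum is presented by generators and relations, so
this needs the coherence statement that a permutation acts on a power of `T` in only one way. It
follows from the Yang-Baxter equation and a normal form for products of adjacent transpositions
(`isFaithful_of_yangBaxter`). Both kinds of spectra are instances of `ShapedSpectrum`: equivariance
of all iterated structure maps reduces to the single structure maps and one transposition on double
ones.

Everything else is formal from `IsProjective`. By adjunction, `F n I` and `F n J` detect level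
trivial fibrations and level fibrations. Evaluation takes the maps generated by them to cofibrations
and trivial cofibrations. The model structure then comes from the small object argument and the
retract argument; left properness and the effective monomorphism condition are checked levelwise.

The hard point is compactness of `F n A`. A map `F n A ⟶ Y` into a cell complex is a map `A ⟶ ev n
Y`, but `ev n Y` is built from cofibrations, not from cells of `I`, so compactness of `A` does not
apply directly. Instead `exists_supportedBy` replaces `ev n Y` by a genuine `I`-cell complex over it
which admits a section, with each cell labelled by a cell of `Y`. A subcomplex of at most `κ` cells
then yields at most `κ` cells of `Y` such that the map factors through every subobject containing
them and the source. The same argument applied to attaching maps closes this set of cells without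
exceeding `κ` (`exists_isClosedCells_singleton`). A closed set of cells is a subcomplex: its stages
are constructed transfinitely as subobjects of `Y`, and they include in the stages of `Y` by
cofibrations, hence by monomorphisms (`IsClosedCells.exists_subcomplex`). The support theorem also
shows that compact objects are small relative to all cofibrations, which the small object argument
for spectra requires. -/

lemma IsSmallRelativeTo.mono {W W' : MorphismProperty C} (h : W ≤ W') {A : C}
    (hA : IsSmallRelativeTo W' A) : IsSmallRelativeTo W A := by
  obtain ⟨κ, hκ⟩ := hA
  exact ⟨κ, fun J _ _ _ _ h₁ h₂ F h₃ h₄ ↦ hκ J h₁ h₂ F h₃ fun j ↦ h _ (h₄ j)⟩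

/-- A set of cardinals has a supremum, and the property is monotone in the cardinal. -/
lemma exists_cardinal_forall_of_isSmall (I : MorphismProperty C) [MorphismProperty.IsSmall.{v} I]
    (P : Cardinal.{v} → ∀ ⦃A B : C⦄, (A ⟶ B) → Prop)
    (hP : ∀ κ κ' : Cardinal.{v}, κ ≤ κ' → ∀ ⦃A B : C⦄ (i : A ⟶ B), P κ i → P κ' i)
    (h : ∀ ⦃A B : C⦄ (i : A ⟶ B), I i → ∃ κ, P κ i) :
    ∃ κ, ∀ ⦃A B : C⦄ (i : A ⟶ B), I i → P κ i := by
  obtain ⟨ι, A, B, f, rfl⟩ := (MorphismProperty.isSmall_iff_eq_ofHoms.{v} I).1 inferInstance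
  choose κ hκ using fun i ↦ h (f i) ⟨i⟩
  refine ⟨⨆ i, κ i, ?_⟩
  rintro _ _ _ ⟨i⟩
  exact hP _ _ (le_ciSup (Cardinal.bddAbove_of_small) i) _ (hκ i)

/-- An unbounded subset is cofinal, and by regularity a cofinal subset has at least `κ'` elements.
-/
lemma bddAbove_of_isRegular {κ κ' : Cardinal.{v}} (hκ' : κ'.IsRegular) (h : κ < κ')
    (S : Set κ'.ord.ToType) (hS : Cardinal.mk S ≤ κ) : BddAbove S := by
  by_contra hS'
  have : IsCofinal S := by
    intro a
    by_contra! ha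
    exact hS' ⟨a, fun s hs ↦ (ha s hs).le⟩
  have h₁ := Order.cof_le this
  rw [Ordinal.cof_toType, hκ'.cof_ord] at h₁
  exact absurd (h₁.trans hS) (not_le.2 h)

lemma hasSmallObjectArgument_of_isSmallRelativeTo [HasColimits C] (I : MorphismProperty C)
    [MorphismProperty.IsSmall.{v} I]
    (hI : ∀ ⦃A B : C⦄ (i : A ⟶ B), I i →
      IsSmallRelativeTo (MorphismProperty.coproducts.{v} I).pushouts A) :
    MorphismProperty.HasSmallObjectArgument.{v} I := by
  obtain ⟨κ₀, hκ₀⟩ := exists_cardinal_forall_of_isSmall I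
    (fun κ A _ _ ↦ ∀ (J : Type v) [LinearOrder J] [OrderBot J] [SuccOrder J]
      [WellFoundedLT J], NoMaxOrder J → (∀ S : Set J, Cardinal.mk S ≤ κ → BddAbove S) →
      ∀ F : J ⥤ C, F.IsWellOrderContinuous →
        (∀ j : J, (MorphismProperty.coproducts.{v} I).pushouts
          (F.map (homOfLE (Order.le_succ j)))) → PreservesColimit F (coyoneda.obj (op A)))
    (fun κ κ' h A _ _ H J _ _ _ _ h₁ h₂ F h₃ h₄ ↦
      H J h₁ (fun S hS ↦ h₂ S (hS.trans h)) F h₃ h₄) hI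
  -- The successor of an infinite cardinal is regular; being larger than `κ₀`, its ordinal is long
  -- enough for smallness to apply to every domain.
  let κ := Order.succ (max κ₀ Cardinal.aleph0)
  have hκ : κ.IsRegular := Cardinal.isRegular_succ (le_max_right _ _)
  have : Fact κ.IsRegular := ⟨hκ⟩
  have hlt : κ₀ < κ := Order.lt_succ_of_le (le_max_left _ _)
  have hmax : NoMaxOrder κ.ord.ToType := Cardinal.noMaxOrder hκ.aleph0_le
  have : Nonempty κ.ord.ToType := Ordinal.nonempty_toType_iff.2 hκ.ord_pos.ne'
  let := WellFoundedLT.toOrderBot κ.ord.ToType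
  refine ⟨⟨κ, inferInstance, inferInstance, ?_⟩⟩
  exact
    { preservesColimit := fun {A B X Y} i hi f hf ↦
        hκ₀ i hi _ hmax (fun S hS ↦ bddAbove_of_isRegular hκ hlt S hS) hf.F
          hf.isWellOrderContinuous fun j ↦ by
          simpa using (hf.attachCells j (not_isMax j)).pushouts_coproducts }

/-- After forgetting the map to `Z`, a map to the colimit factors through some term; this
factorization is automatically over `Z`, because the term maps to `Z` through the colimit. -/
lemma isSmallRelativeTo_over {Z : C} {W : MorphismProperty C} [HasColimits C] {A : Over Z}
    (hA : IsSmallRelativeTo W A.left) :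
    IsSmallRelativeTo (W.inverseImage (Over.forget Z)) A := by
  obtain ⟨κ, hκ⟩ := hA
  refine ⟨κ, fun J _ _ _ _ h₁ h₂ F h₃ h₄ ↦ ?_⟩
  have hF : (F ⋙ Over.forget Z).IsWellOrderContinuous :=
    ⟨fun m hm ↦ ⟨isColimitOfPreserves (Over.forget Z)
      (F.isColimitOfIsWellOrderContinuous m hm)⟩⟩
  have := hκ J h₁ h₂ (F ⋙ Over.forget Z) hF h₄
  have hc := isColimitOfPreserves (Over.forget Z) (colimit.isColimit F)
  have hc' := isColimitOfPreserves (coyoneda.obj (op A.left)) hc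
  refine preservesColimit_of_preserves_colimit_cocone (colimit.isColimit F)
    (Types.FilteredColimit.isColimitOf _ _ ?_ ?_)
  · intro x
    obtain ⟨j, y, hy⟩ := Types.jointly_surjective_of_isColimit hc' x.left
    let y' : A.left ⟶ (F.obj j).left := y
    have hy' : y' ≫ (colimit.ι F j).left = x.left := hy
    refine ⟨j, Over.homMk y' ?_, Over.OverMorphism.ext hy.symm⟩
    have h₁ : (colimit.ι F j).left ≫ (colimit F).hom = (F.obj j).hom := Over.w _
    have h₂ : x.left ≫ (colimit F).hom = A.hom := Over.w x
    rw [← h₁, ← h₂, ← hy', Category.assoc]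
  · intro i j xi xj h
    have h' : (xi ≫ (colimit.cocone F).ι.app i).left = (xj ≫ (colimit.cocone F).ι.app j).left :=
      congr_arg CommaMorphism.left h
    obtain ⟨k, f, g, hfg⟩ := (Types.FilteredColimit.isColimit_eq_iff _ hc'
      (xi := xi.left) (xj := xj.left)).1 h'
    exact ⟨k, f, g, Over.OverMorphism.ext hfg⟩

lemma isSmallRelativeTo_of_adjunction {S : Type u'} [Category.{v} S] {F : C ⥤ S} {R : S ⥤ C}
    (adj : F ⊣ R) [PreservesColimitsOfSize.{v, v} R] {W : MorphismProperty C} {A : C}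
    (hA : IsSmallRelativeTo W A) : IsSmallRelativeTo (W.inverseImage R) (F.obj A) := by
  obtain ⟨κ, hκ⟩ := hA
  refine ⟨κ, fun J _ _ _ _ h₁ h₂ G h₃ h₄ ↦ ?_⟩
  have hG : (G ⋙ R).IsWellOrderContinuous :=
    ⟨fun m hm ↦ ⟨isColimitOfPreserves R (G.isColimitOfIsWellOrderContinuous m hm)⟩⟩
  have := hκ J h₁ h₂ (G ⋙ R) hG h₄
  have : PreservesColimit G (R ⋙ coyoneda.obj (op A)) := comp_preservesColimit _ _
  exact preservesColimit_of_natIso G (adj.corepresentableBy A).toIso.symm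

end Smallness


/-! ### Cell attachments and transfinite lifting -/

section Cells

variable {C : Type u} [Category.{v} C] {S : Type u'} [Category.{v} S]

/-- The image of a cofan under a functor. -/
def mapCofan (F : C ⥤ S) {ι : Type*} {A : ι → C} (a : Cofan A) : Cofan fun i ↦ F.obj (A i) :=
  Cofan.mk (F.obj a.pt) fun i ↦ F.map (a.inj i)

noncomputable def isColimitMapCofan (F : C ⥤ S) {ι : Type v} {A : ι → C} {a : Cofan A}
    (ha : IsColimit a) [PreservesColimitsOfSize.{v, v} F] : IsColimit (mapCofan F a) :=
  have : PreservesColimitsOfShape (Discrete ι) F := inferInstance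
  isColimitCofanMkObjOfIsColimit F _ _
    (IsColimit.ofIsoColimit ha (Cofan.ext (Iso.refl _) (fun i ↦ by simp)))

/-- The image of cell attachments under a functor which preserves colimits. -/
noncomputable def mapAttachCells (F : C ⥤ S) [PreservesColimitsOfSize.{v, v} F] {α : Type*}
    {A B : α → C} {g : ∀ a, A a ⟶ B a} {X₁ X₂ : C} {f : X₁ ⟶ X₂} (c : AttachCells.{v} g f) :
    AttachCells.{v} (fun a ↦ F.map (g a)) (F.map f) where
  ι := c.ι
  π := c.π
  cofan₁ := mapCofan F c.cofan₁
  cofan₂ := mapCofan F c.cofan₂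
  isColimit₁ := isColimitMapCofan F c.isColimit₁
  isColimit₂ := isColimitMapCofan F c.isColimit₂
  m := F.map c.m
  hm i := by
    have := F.congr_map (c.hm i)
    rwa [F.map_comp, F.map_comp] at this
  g₁ := F.map c.g₁
  g₂ := F.map c.g₂
  isPushout := c.isPushout.map F

lemma pushouts_coproducts_le_inverseImage (F : C ⥤ S) [PreservesColimitsOfSize.{v, v} F]
    {P : MorphismProperty C} {Q : MorphismProperty S} (h : P ≤ Q.inverseImage F) :
    (MorphismProperty.coproducts.{v} P).pushouts ≤
      (MorphismProperty.coproducts.{v} Q).pushouts.inverseImage F := by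
  intro X Y f hf
  rw [← P.ofHoms_homFamily, ← nonempty_attachCells_iff] at hf
  obtain ⟨c⟩ := hf
  have := (mapAttachCells F c).pushouts_coproducts
  refine MorphismProperty.pushouts_monotone (MorphismProperty.coproducts_monotone ?_) _ this
  rintro _ _ _ ⟨i⟩
  exact h _ i.2

lemma AttachCells.isCellAttachment {α : Type*} {A B : α → C} {g : ∀ a, A a ⟶ B a} {X₁ X₂ : C}
    {f : X₁ ⟶ X₂} (c : AttachCells.{v} g f) :
    IsCellAttachment (fun i ↦ g (c.π i)) f (fun i ↦ c.cofan₁.inj i ≫ c.g₁) c.cell := by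
  refine ⟨c.cofan₁, c.cofan₂, c.isColimit₁, c.isColimit₂, ?_⟩
  have h₁ : Cofan.IsColimit.desc c.isColimit₁ (fun i ↦ c.cofan₁.inj i ≫ c.g₁) = c.g₁ :=
    Cofan.IsColimit.hom_ext c.isColimit₁ _ _ fun i ↦ by rw [Cofan.IsColimit.fac]
  have h₂ : Cofan.IsColimit.desc c.isColimit₁ (fun i ↦ g (c.π i) ≫ c.cofan₂.inj i) = c.m :=
    Cofan.IsColimit.hom_ext c.isColimit₁ _ _ fun i ↦ by rw [Cofan.IsColimit.fac, c.hm]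
  have h₃ : Cofan.IsColimit.desc c.isColimit₂ c.cell = c.g₂ :=
    Cofan.IsColimit.hom_ext c.isColimit₂ _ _ fun i ↦ by
      rw [Cofan.IsColimit.fac, AttachCells.cell_def]
  rw [h₁, h₂, h₃]
  exact c.isPushout

namespace IsCellAttachment

variable {ι : Type v} {A B : ι → C} {g : ∀ i, A i ⟶ B i} {X₁ X₂ : C} {f : X₁ ⟶ X₂}
  {h : ∀ i, A i ⟶ X₁} {d : ∀ i, B i ⟶ X₂} (H : IsCellAttachment g f h d)

include H

lemma w (i : ι) : h i ≫ f = g i ≫ d i := by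
  obtain ⟨a, b, ha, hb, sq⟩ := H
  have := a.inj i ≫= sq.w
  simpa only [Cofan.IsColimit.fac_assoc, Category.assoc, Cofan.IsColimit.fac] using this

lemma hom_ext {Z : C} {φ ψ : X₂ ⟶ Z} (h₀ : f ≫ φ = f ≫ ψ) (h₁ : ∀ i, d i ≫ φ = d i ≫ ψ) :
    φ = ψ := by
  obtain ⟨a, b, ha, hb, sq⟩ := H
  refine sq.hom_ext h₀ (Cofan.IsColimit.hom_ext hb _ _ fun i ↦ ?_)
  simpa only [Cofan.IsColimit.fac_assoc] using h₁ i

lemma exists_desc {Z : C} (k : X₁ ⟶ Z) (y : ∀ i, B i ⟶ Z) (hy : ∀ i, g i ≫ y i = h i ≫ k) :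
    ∃ l : X₂ ⟶ Z, f ≫ l = k ∧ ∀ i, d i ≫ l = y i := by
  obtain ⟨a, b, ha, hb, sq⟩ := H
  obtain ⟨l, hl₁, hl₂⟩ := sq.exists_desc k (Cofan.IsColimit.desc hb y)
    (Cofan.IsColimit.hom_ext ha _ _ fun i ↦ by
      simp only [Cofan.IsColimit.fac_assoc, Category.assoc, Cofan.IsColimit.fac, hy])
  refine ⟨l, hl₁, fun i ↦ ?_⟩
  have := b.inj i ≫= hl₂
  simpa only [Cofan.IsColimit.fac_assoc, Cofan.IsColimit.fac] using this

lemma exists_lift {E Z : C} (r : E ⟶ Z) (b : X₂ ⟶ Z) (f' : X₁ ⟶ E) (hf' : f' ≫ r = f ≫ b)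
    (hy : ∀ i, ∃ y : B i ⟶ E, g i ≫ y = h i ≫ f' ∧ y ≫ r = d i ≫ b) :
    ∃ l : X₂ ⟶ E, f ≫ l = f' ∧ l ≫ r = b := by
  choose y hy₁ hy₂ using hy
  obtain ⟨l, hl₁, hl₂⟩ := H.exists_desc f' y hy₁
  refine ⟨l, hl₁, H.hom_ext ?_ fun i ↦ ?_⟩
  · rw [reassoc_of% hl₁, hf']
  · rw [reassoc_of% (hl₂ i), hy₂]

lemma exists_lift_of_mono {M Z : C} (m : M ⟶ Z) [Mono m] (b : X₂ ⟶ Z) (f' : X₁ ⟶ M)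
    (hf' : f' ≫ m = f ≫ b) (hy : ∀ i, ∃ y : B i ⟶ M, y ≫ m = d i ≫ b) :
    ∃ l : X₂ ⟶ M, f ≫ l = f' ∧ l ≫ m = b :=
  H.exists_lift m b f' hf' fun i ↦ by
    obtain ⟨y, hy⟩ := hy i
    refine ⟨y, ?_, hy⟩
    rw [← cancel_mono m, Category.assoc, Category.assoc, hy, hf', ← reassoc_of% (H.w i)]

end IsCellAttachment

/-- No lifting property of `r` itself is assumed: each step only has to extend the partial lift
already chosen over the given `b`. Sections, factorizations through subobjects and lifts between
colimits are all obtained from this form. -/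
lemma exists_lift_of_steps {J : Type v} [LinearOrder J] [OrderBot J] [SuccOrder J]
    [WellFoundedLT J] {F : J ⥤ C} [F.IsWellOrderContinuous] {c : Cocone F} (hc : IsColimit c)
    {E Z : C} (r : E ⟶ Z) (b : c.pt ⟶ Z) (f : F.obj ⊥ ⟶ E) (hf : f ≫ r = c.ι.app ⊥ ≫ b)
    (h : ∀ j, ¬ IsMax j → ∀ f' : F.obj j ⟶ E, f' ≫ r = c.ι.app j ≫ b →
      ∃ l : F.obj (Order.succ j) ⟶ E, F.map (homOfLE (Order.le_succ j)) ≫ l = f' ∧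
        l ≫ r = c.ι.app (Order.succ j) ≫ b) :
    ∃ l : c.pt ⟶ E, c.ι.app ⊥ ≫ l = f ∧ l ≫ r = b := by
  have sq : CommSq f (c.ι.app ⊥) r b := ⟨hf⟩
  have : sq.HasLift := by
    refine HasLiftingProperty.transfiniteComposition.hasLift hc (fun j hj f' sq' ↦ ?_) sq
    obtain ⟨l, hl₁, hl₂⟩ := h j hj f' (by rw [sq'.w, Cocone.w_assoc])
    exact ⟨⟨{ l := l, fac_left := hl₁, fac_right := hl₂ }⟩⟩
  exact ⟨sq.lift, sq.fac_left, sq.fac_right⟩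

section

variable {I : MorphismProperty C} {J : Type v} [LinearOrder J] [OrderBot J] [SuccOrder J]
  [WellFoundedLT J] {X Y : C} {f : X ⟶ Y} {c : CellPresentation I J f}

/-- Because `m` is a monomorphism, factorizations of the individual cells are automatically
compatible with attaching maps and assemble by transfinite induction. -/
lemma Subcomplex.exists_lift_of_mono (s : Subcomplex c) {t : Cocone s.F} (ht : IsColimit t)
    {M Z : C} (m : M ⟶ Z) [Mono m] (b : Y ⟶ Z) (h₀ : ∃ y : X ⟶ M, y ≫ m = f ≫ b)
    (h₁ : ∀ γ ∈ s.cells, ∃ y : γ.i.1.right ⟶ M, y ≫ m = γ.ι ≫ b) :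
    ∃ y : t.pt ⟶ M, y ≫ m = ht.desc ⟨Y, s.φ ≫ c.incl⟩ ≫ b := by
  obtain ⟨y₀, h₀⟩ := h₀
  have := s.isWellOrderContinuous
  have hbot : c.isoBot.hom ≫ f = c.incl.app ⊥ := (Iso.inv_comp_eq _).1 c.fac |>.symm
  obtain ⟨l, _, hl⟩ := exists_lift_of_steps ht m (ht.desc ⟨Y, s.φ ≫ c.incl⟩ ≫ b)
    (s.φ.app ⊥ ≫ c.isoBot.hom ≫ y₀) (by
      simp only [Category.assoc, h₀, IsColimit.fac_assoc, NatTrans.comp_app,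
        reassoc_of% hbot]) (fun j hj f' hf' ↦ by
      refine (s.isCellAttachment j hj).exists_lift_of_mono m _ f' ?_ ?_
      · rw [hf', Cocone.w_assoc]
      · rintro ⟨k, hk⟩
        obtain ⟨y, hy⟩ := h₁ _ hk
        refine ⟨y, hy.trans (Eq.symm ?_)⟩
        have h₂ : t.ι.app (Order.succ j) ≫ ht.desc ⟨Y, s.φ ≫ c.incl⟩ =
          s.φ.app (Order.succ j) ≫ c.incl.app (Order.succ j) := ht.fac _ _
        have h₃ := s.map_φ ⟨j, hj, k⟩ hk =≫ (c.incl.app (Order.succ j) ≫ b)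
        rw [reassoc_of% h₂]
        exact (Category.assoc _ _ _).symm.trans (h₃.trans (Category.assoc _ _ _).symm))
  exact ⟨l, hl⟩

end

end Cells


/-! ### Supports of maps from compact objects -/

section Support

variable {C : Type u} [Category.{v} C]

/-- The map `p` factors through every subobject of `Z` which contains `x₀` and the maps `d k`
for `k ∈ T`. -/
def SupportedBy {Z X₀ : C} (x₀ : X₀ ⟶ Z) {K : Type v} {D : K → C} (d : ∀ k, D k ⟶ Z) (T : Set K)
    {A : C} (p : A ⟶ Z) : Prop :=
  ∀ ⦃M : C⦄ (m : M ⟶ Z) [Mono m], (∃ y : X₀ ⟶ M, y ≫ m = x₀) →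
    (∀ k ∈ T, ∃ y : D k ⟶ M, y ≫ m = d k) → ∃ y : A ⟶ M, y ≫ m = p

/-- The maps of `I` over `Z` whose target factors through one of the maps `d k`. -/
def labelledMaps (I : MorphismProperty C) {Z : C} {K : Type v} {D : K → C}
    (d : ∀ k, D k ⟶ Z) : MorphismProperty (Over Z) :=
  fun _ b i ↦ I i.left ∧ ∃ k, ∃ y : b.left ⟶ D k, y ≫ d k = b.hom

instance (I : MorphismProperty C) [MorphismProperty.IsSmall.{v} I] {Z : C} {K : Type v}
    {D : K → C} (d : ∀ k, D k ⟶ Z) : MorphismProperty.IsSmall.{v} (labelledMaps I d) := by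
  let f (x : Σ i : I.toSet, (i.1.right ⟶ Z)) : Over.mk (x.1.1.hom ≫ x.2) ⟶ Over.mk x.2 :=
    Over.homMk x.1.1.hom
  have : MorphismProperty.IsSmall.{v} (MorphismProperty.ofHoms f) := inferInstance
  refine ⟨small_subset (s := (MorphismProperty.ofHoms f).toSet) ?_⟩
  rintro ⟨a, b, i⟩ ⟨hi, _⟩
  obtain ⟨a, ⟨⟨⟩⟩, a'⟩ := a
  obtain ⟨b, ⟨⟨⟩⟩, b'⟩ := b
  change a ⟶ Z at a'
  change b ⟶ Z at b'
  obtain ⟨l, hl, rfl⟩ : ∃ (l : a ⟶ b) (hl : l ≫ b' = a'),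
      i = Over.homMk (U := Over.mk a') (V := Over.mk b') l hl := ⟨i.left, Over.w i, rfl⟩
  subst hl
  exact MorphismProperty.ofHoms.mk (f := f) ⟨⟨Arrow.mk l, hi⟩, b'⟩

/-- A lifting problem against the pullback is one against `r` whose bottom edge factors through `D`.
-/
lemma rlp_pullback_snd [HasLimits C] (I : MorphismProperty C) {E Z D : C} (r : E ⟶ Z) (d : D ⟶ Z)
    (h : ∀ ⦃A B : C⦄ (i : A ⟶ B), I i → ∀ (t : A ⟶ E) (b : B ⟶ D), t ≫ r = i ≫ b ≫ d →
      ∃ l : B ⟶ E, i ≫ l = t ∧ l ≫ r = b ≫ d) : I.rlp (pullback.snd r d) :=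
  fun A B i hi ↦ ⟨fun {t b} sq ↦ by
    obtain ⟨l, h₁, h₂⟩ := h i hi (t ≫ pullback.fst r d) b
      (by rw [Category.assoc, pullback.condition, reassoc_of% sq.w])
    exact ⟨⟨{
      l := pullback.lift l b h₂
      fac_left := by
        apply pullback.hom_ext
        · rw [Category.assoc, pullback.lift_fst, h₁]
        · rw [Category.assoc, pullback.lift_snd, sq.w]
      fac_right := pullback.lift_snd _ _ _ }⟩⟩⟩

lemma preservesWellOrderContinuousOfShape {S : Type u'} [Category.{v} S] (F : C ⥤ S)
    [PreservesColimitsOfSize.{v, v} F] (J : Type v) [LinearOrder J] :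
    PreservesWellOrderContinuousOfShape J F where

lemma hasSmallObjectArgument_labelledMaps [HasColimits C] (I : MorphismProperty C)
    [MorphismProperty.IsSmall.{v} I]
    (hI : ∀ ⦃A B : C⦄ (i : A ⟶ B), I i → IsSmallRelativeTo (relativeCellComplexes I) A)
    {Z : C} {K : Type v} {D : K → C} (d : ∀ k, D k ⟶ Z) :
    MorphismProperty.HasSmallObjectArgument.{v} (labelledMaps I d) :=
  hasSmallObjectArgument_of_isSmallRelativeTo _ fun _ _ _ hi ↦
    (isSmallRelativeTo_over ((hI _ hi.1).mono
      (MorphismProperty.le_transfiniteCompositions _))).mono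
        (pushouts_coproducts_le_inverseImage (Over.forget Z) fun _ _ _ h ↦ h.1)

/-- The underlying relative `I`-cell complex of a relative cell complex over `Z`. -/
noncomputable def forgetCellPresentation [HasColimits C] {I : MorphismProperty C} {Z : C}
    {K : Type v} {D : K → C} {d : ∀ k, D k ⟶ Z} {J : Type v} [LinearOrder J] [OrderBot J]
    [SuccOrder J] [WellFoundedLT J] {X Y : Over Z} {f : X ⟶ Y}
    (c : CellPresentation (labelledMaps I d) J f) : CellPresentation I J f.left where
  toTransfiniteCompositionOfShape :=
    have := preservesWellOrderContinuousOfShape (Over.forget Z) J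
    c.toTransfiniteCompositionOfShape.map (Over.forget Z)
  attachCells j hj := (mapAttachCells (Over.forget Z) (c.attachCells j hj)).reindexCellTypes
    I.homFamily (fun a ↦ ⟨Arrow.mk a.1.hom.left, a.2.1⟩) fun _ ↦ Iso.refl _

lemma exists_label [HasColimits C] {I : MorphismProperty C} {Z : C}
    {K : Type v} {D : K → C} {d : ∀ k, D k ⟶ Z} {J : Type v} [LinearOrder J] [OrderBot J]
    [SuccOrder J] [WellFoundedLT J] {X Y : Over Z} {f : X ⟶ Y}
    (c : CellPresentation (labelledMaps I d) J f) (γ : (forgetCellPresentation c).Cells) :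
    ∃ k, ∃ y : γ.i.1.right ⟶ D k, y ≫ d k = γ.ι ≫ Y.hom := by
  obtain ⟨j, hj, k⟩ := γ
  let k' : (c.attachCells j hj).ι := k
  obtain ⟨l, y, hy⟩ := ((c.attachCells j hj).π k').2.2
  refine ⟨l, y, hy.trans ?_⟩
  have h₁ := Over.w (((c.attachCells j hj).cell k') ≫ c.incl.app (Order.succ j))
  refine h₁.symm.trans ?_
  congr 1
  change (((c.attachCells j hj).cofan₂.inj k' ≫ (c.attachCells j hj).g₂) ≫
      c.incl.app (Order.succ j)).left =
    ((𝟙 _ ≫ ((c.attachCells j hj).cofan₂.inj k').left) ≫ (c.attachCells j hj).g₂.left) ≫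
      (c.incl.app (Order.succ j)).left ≫ 𝟙 _
  rw [Category.id_comp, Category.comp_id]
  rfl

/-- The hypothesis `H` expresses that `Z` is built from `X₀` and the pieces `D k` by cofibrations,
without requiring that it is a cell complex. Compactness is applied to a cell complex over `Z`
produced by the small object argument, and the result is pushed down to `Z`. -/
theorem exists_supportedBy [HasColimits C] [HasLimits C] (I : MorphismProperty C)
    [MorphismProperty.IsSmall.{v} I]
    (hI : ∀ ⦃A B : C⦄ (i : A ⟶ B), I i → IsSmallRelativeTo (relativeCellComplexes I) A)
    {κ : Cardinal.{v}} {A : C} (hA : IsCompactRelativeToOfSize κ I A)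
    {Z X₀ : C} (x₀ : X₀ ⟶ Z) {K : Type v} {D : K → C} (d : ∀ k, D k ⟶ Z)
    (H : ∀ ⦃E : C⦄ (r : E ⟶ Z), (∀ k, I.rlp (pullback.snd r (d k))) →
      ∀ y : X₀ ⟶ E, y ≫ r = x₀ → ∃ s : Z ⟶ E, s ≫ r = 𝟙 Z) (p : A ⟶ Z) :
    ∃ T : Set K, Cardinal.mk T ≤ κ ∧ SupportedBy x₀ d T p := by
  have := hasSmallObjectArgument_labelledMaps I hI d
  let P := labelledMaps I d
  let κ' := P.smallObjectκ
  have : Fact κ'.IsRegular := MorphismProperty.HasSmallObjectArgument.exists_cardinal.choose_spec.choose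
  let f : Over.mk x₀ ⟶ Over.mk (𝟙 Z) := Over.homMk x₀
  -- Factoring `X₀ ⟶ Z` in the category over `Z` gives an `I`-cell complex `X₀ ⟶ Y` with a map to
  -- `Z` under which every cell lands in some `D k`.
  let c := SmallObject.relativeCellComplexιObj P κ' f
  let Y := SmallObject.obj P κ' f
  have hr : (SmallObject.πObj P κ' f).left = Y.hom := by
    simpa using Over.w (SmallObject.πObj P κ' f)
  have hY : (SmallObject.ιObj P κ' f).left ≫ Y.hom = x₀ := Over.w (SmallObject.ιObj P κ' f)
  -- Lifting against the labelled maps is exactly what gives the pullback of `Y` to each `D k` the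
  -- right lifting property, so `Y ⟶ Z` has a section.
  obtain ⟨s, hs⟩ := H Y.hom (fun k ↦ rlp_pullback_snd I _ _ fun A B i hi t b w ↦ by
    let i' : Over.mk (i ≫ b ≫ d k) ⟶ Over.mk (b ≫ d k) := Over.homMk i
    have := SmallObject.rlp_πObj P κ' f i' ⟨hi, k, b, rfl⟩
    let t' : Over.mk (i ≫ b ≫ d k) ⟶ Y := Over.homMk t w
    have sq' : CommSq t' i' (SmallObject.πObj P κ' f) (Over.homMk (b ≫ d k)) :=
      ⟨Over.OverMorphism.ext (by
        change t ≫ (SmallObject.πObj P κ' f).left = i ≫ b ≫ d k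
        rw [hr, w])⟩
    exact ⟨sq'.lift.left, congr_arg CommaMorphism.left sq'.fac_left, Over.w sq'.lift⟩) _ hY
  obtain ⟨S, hS, t, ht, q, hq⟩ := hA _ _ (forgetCellPresentation c) (p ≫ s)
  choose l hl using exists_label c
  -- The support consists of the labels of the subcomplex through which `p ≫ s` factors. A subobject
  -- containing these pieces contains the image of the subcomplex, hence the image of `p ≫ s`, which
  -- lies over `p`.
  refine ⟨l '' S.cells, Cardinal.mk_image_le.trans hS, fun M m _ h₀ h₁ ↦ ?_⟩
  obtain ⟨y₀, h₀⟩ := h₀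
  obtain ⟨y, hy⟩ := S.exists_lift_of_mono ht m Y.hom ⟨y₀, h₀.trans hY.symm⟩ (fun γ hγ ↦ by
    obtain ⟨y₁, hy₁⟩ := h₁ _ (Set.mem_image_of_mem l hγ)
    obtain ⟨y₂, hy₂⟩ := hl γ
    exact ⟨y₂ ≫ y₁, by rw [Category.assoc, hy₁, hy₂]⟩)
  exact ⟨q ≫ y, by rw [Category.assoc, hy, reassoc_of% hq, hs, Category.comp_id]⟩

end Support


/-! ### Closed sets of cells and their successor stages -/

section ClosedCells

variable {C : Type u} [Category.{v} C] {I : MorphismProperty C} {J : Type v} [LinearOrder J]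
  [OrderBot J] [SuccOrder J] [WellFoundedLT J] {X Y : C} {f : X ⟶ Y}

lemma subobject_mk_factors_iff {Z A M : C} (m : M ⟶ Z) [Mono m] (g : A ⟶ Z) :
    (Subobject.mk m).Factors g ↔ ∃ y : A ⟶ M, y ≫ m = g :=
  Subobject.mk_factors_iff m g

lemma subobject_factors_iff {Z A : C} (Q : Subobject Z) (g : A ⟶ Z) :
    Q.Factors g ↔ ∃ y : A ⟶ (Q : C), y ≫ Q.arrow = g := by
  rw [← subobject_mk_factors_iff, Subobject.mk_arrow]

lemma relativeCellComplex_incl_mem (c : CellPresentation I J f) (j : J) :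
    I.rlp.llp (c.incl.app j) :=
  ((c.transfiniteCompositionOfShape I.homFamily).ofLE (W' := I.rlp.llp) (by
    rw [MorphismProperty.ofHoms_homFamily, MorphismProperty.le_llp_iff_le_rlp,
      MorphismProperty.rlp_pushouts, MorphismProperty.rlp_coproducts])).mem_incl_app j

/-- The cells in `T` of level less than `j`, and the source of the relative cell complex, are
contained in `M`. -/
def ContainsCells (c : CellPresentation I J f) (T : Set c.Cells) (j : J) (M : Subobject Y) :
    Prop :=
  M.Factors f ∧ ∀ γ ∈ T, γ.j < j → M.Factors γ.ι

/-- The attaching map of each cell in `T` factors through every subobject which contains the source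
and the cells in `T` of lower levels. -/
def IsClosedCells (c : CellPresentation I J f) (T : Set c.Cells) : Prop :=
  ∀ γ ∈ T, ∀ M : Subobject Y, ContainsCells c T γ.j M →
    M.Factors (cellAttachingMap c γ ≫ c.incl.app γ.j)

lemma ContainsCells.of_le {c : CellPresentation I J f} {T : Set c.Cells} {i j : J} (h : i ≤ j)
    {M : Subobject Y} (hM : ContainsCells c T j M) : ContainsCells c T i M :=
  ⟨hM.1, fun γ hγ hi ↦ hM.2 γ hγ (hi.trans_le h)⟩

/-- The subobject `Q` is generated by the cells of `T` of level less than `j`, and its inclusion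
in the `j`th stage is a cofibration. -/
structure IsStage (c : CellPresentation I J f) (T : Set c.Cells) (j : J) (Q : Subobject Y) :
    Prop where
  isLeast : IsLeast {M | ContainsCells c T j M} Q
  exists_incl : ∃ φ : (Q : C) ⟶ c.F.obj j, φ ≫ c.incl.app j = Q.arrow ∧ I.rlp.llp φ

variable {c : CellPresentation I J f} {T : Set c.Cells}

lemma IsStage.unique {j : J} {Q Q' : Subobject Y} (h : IsStage c T j Q) (h' : IsStage c T j Q') :
    Q = Q' :=
  h.isLeast.unique h'.isLeast

lemma IsStage.le {i j : J} (hij : i ≤ j) {Q Q' : Subobject Y} (h : IsStage c T i Q)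
    (h' : IsStage c T j Q') : Q ≤ Q' :=
  h.isLeast.2 (h'.isLeast.1.of_le hij)

lemma isoBot_hom_comp (c : CellPresentation I J f) : c.isoBot.hom ≫ f = c.incl.app ⊥ :=
  ((Iso.inv_comp_eq _).1 c.fac).symm

lemma isStage_bot (hmono : ∀ ⦃A B : C⦄ (i : A ⟶ B), I.rlp.llp i → Mono i) :
    ∃ Q, IsStage c T ⊥ Q := by
  have := hmono _ (relativeCellComplex_incl_mem c ⊥)
  refine ⟨Subobject.mk (c.incl.app ⊥), ⟨⟨?_, fun γ _ h ↦ (not_lt_bot h).elim⟩, fun M hM ↦ ?_⟩,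
    (Subobject.underlyingIso _).hom, Subobject.underlyingIso_hom_comp_eq_mk _, ?_⟩
  · rw [subobject_mk_factors_iff]
    exact ⟨c.isoBot.inv, c.fac⟩
  · obtain ⟨y, hy⟩ := (subobject_factors_iff _ _).1 hM.1
    exact Subobject.mk_le_of_comm (c.isoBot.hom ≫ y) (by
      rw [Category.assoc, hy, isoBot_hom_comp])
  · exact MorphismProperty.llp_of_isIso _ _

variable (c T) in
/-- The cells of `T` of level `j`. -/
abbrev CellsAt (j : J) (hj : ¬ IsMax j) : Type v :=
  {k : (c.attachCells j hj).ι // (⟨j, hj, k⟩ : c.Cells) ∈ T}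

/-- `Q'` is obtained from `Q` by attaching the cells of `T` of level `j`, and the inclusion in the
given sequence satisfies a relative lifting property. -/
structure IsNextStage (c : CellPresentation I J f) (T : Set c.Cells) (j : J) (hj : ¬ IsMax j)
    (Q Q' : Subobject Y) : Prop where
  le : Q ≤ Q'
  exists_attachment : ∃ (a : ∀ k : CellsAt c T j hj,
      ((c.attachCells j hj).π k.1).1.left ⟶ (Q : C))
    (d : ∀ k : CellsAt c T j hj, ((c.attachCells j hj).π k.1).1.right ⟶ (Q' : C)),
    (∀ k, a k ≫ Q.arrow = cellAttachingMap c ⟨j, hj, k.1⟩ ≫ c.incl.app j) ∧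
    (∀ k, d k ≫ Q'.arrow = (⟨j, hj, k.1⟩ : c.Cells).ι) ∧
    IsCellAttachment (fun k : CellsAt c T j hj ↦ I.homFamily ((c.attachCells j hj).π k.1))
      (Subobject.ofLE Q Q' le) a d
  -- In effect, the corner map from the pushout of `c.F.obj j` and `Q'` over `Q` to the next term is
  -- a cofibration. Knowing only that each inclusion of stages is a cofibration would not pass to
  -- limits.
  exists_lift : ∀ ⦃E B : C⦄ (p : E ⟶ B), I.rlp p → ∀ (t : (Q' : C) ⟶ E)
    (b : c.F.obj (Order.succ j) ⟶ B) (l₀ : c.F.obj j ⟶ E)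
    (φ : (Q : C) ⟶ c.F.obj j) (φ' : (Q' : C) ⟶ c.F.obj (Order.succ j)),
    φ ≫ c.incl.app j = Q.arrow → φ' ≫ c.incl.app _ = Q'.arrow →
    φ ≫ l₀ = Subobject.ofLE Q Q' le ≫ t →
    l₀ ≫ p = c.F.map (homOfLE (Order.le_succ j)) ≫ b → t ≫ p = φ' ≫ b →
    ∃ l : c.F.obj (Order.succ j) ⟶ E, c.F.map (homOfLE (Order.le_succ j)) ≫ l = l₀ ∧
      φ' ≫ l = t ∧ l ≫ p = b

/-- The pushout version of `IsNextStage.exists_lift`. -/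
lemma exists_lift_attach_rest {j : J} (hj : ¬ IsMax j) {Q P : C}
    {a : ∀ k : CellsAt c T j hj, ((c.attachCells j hj).π k.1).1.left ⟶ Q} {q : Q ⟶ P}
    {d : ∀ k : CellsAt c T j hj, ((c.attachCells j hj).π k.1).1.right ⟶ P}
    (H : IsCellAttachment (fun k : CellsAt c T j hj ↦ I.homFamily ((c.attachCells j hj).π k.1))
      q a d)
    (φ : Q ⟶ c.F.obj j) (φ' : P ⟶ c.F.obj (Order.succ j))
    (hφ : ∀ k, a k ≫ φ = cellAttachingMap c ⟨j, hj, k.1⟩)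
    (hφ' : ∀ k, d k ≫ φ' = cellMap c ⟨j, hj, k.1⟩)
    ⦃E B : C⦄ (p : E ⟶ B) (hp : I.rlp p) (t : P ⟶ E)
    (b : c.F.obj (Order.succ j) ⟶ B) (l₀ : c.F.obj j ⟶ E) (h₁ : φ ≫ l₀ = q ≫ t)
    (h₂ : l₀ ≫ p = c.F.map (homOfLE (Order.le_succ j)) ≫ b) (h₃ : t ≫ p = φ' ≫ b)
    (h₄ : q ≫ φ' = φ ≫ c.F.map (homOfLE (Order.le_succ j))) :
    ∃ l : c.F.obj (Order.succ j) ⟶ E, c.F.map (homOfLE (Order.le_succ j)) ≫ l = l₀ ∧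
      φ' ≫ l = t ∧ l ≫ p = b := by
  have A := AttachCells.isCellAttachment (c.attachCells j hj)
  have hy : ∀ k : (c.attachCells j hj).ι, ∃ y : ((c.attachCells j hj).π k).1.right ⟶ E,
      I.homFamily ((c.attachCells j hj).π k) ≫ y = cellAttachingMap c ⟨j, hj, k⟩ ≫ l₀ ∧
      y ≫ p = (c.attachCells j hj).cell k ≫ b ∧
      ∀ hk : (⟨j, hj, k⟩ : c.Cells) ∈ T, y = d ⟨k, hk⟩ ≫ t := by
    intro k
    -- On cells in `T` the lift is dictated by `t`; the other cells are free and are filled by the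
    -- lifting property of `p`.
    by_cases hk : (⟨j, hj, k⟩ : c.Cells) ∈ T
    · refine ⟨d ⟨k, hk⟩ ≫ t, ?_, ?_, fun _ ↦ rfl⟩
      · have := H.w ⟨k, hk⟩
        dsimp only at this
        rw [← reassoc_of% this, ← h₁, reassoc_of% (hφ ⟨k, hk⟩)]
        rfl
      · rw [Category.assoc, h₃, reassoc_of% (hφ' ⟨k, hk⟩)]
        rfl
    · have : HasLiftingProperty (I.homFamily ((c.attachCells j hj).π k)) p :=
        hp _ ((c.attachCells j hj).π k).2
      have sq : CommSq (cellAttachingMap c ⟨j, hj, k⟩ ≫ l₀)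
          (I.homFamily ((c.attachCells j hj).π k)) p ((c.attachCells j hj).cell k ≫ b) := ⟨by
        rw [Category.assoc, h₂]
        exact (Category.assoc _ _ _).symm.trans
          (((A.w k) =≫ b).trans (Category.assoc _ _ _))⟩
      have : sq.HasLift := this.sq_hasLift sq
      exact ⟨sq.lift, sq.fac_left, sq.fac_right, fun h ↦ (hk h).elim⟩
  choose y hy₁ hy₂ hy₃ using hy
  obtain ⟨l, hl₁, hl₂⟩ := A.exists_desc l₀ y hy₁
  refine ⟨l, hl₁, H.hom_ext ?_ fun k ↦ ?_, A.hom_ext ?_ fun k ↦ ?_⟩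
  · rw [reassoc_of% h₄, hl₁, h₁]
  · rw [reassoc_of% (hφ' k), ← hy₃ k.1 k.2]
    exact hl₂ k.1
  · rw [reassoc_of% hl₁, h₂]
  · rw [reassoc_of% (hl₂ k), hy₂]

/-- Since `Q` contains all lower cells of `T`, closedness makes the attaching maps of the cells at
level `j` factor through `Q`, so these cells can be attached to it. The result maps to the next term
of the sequence by a cofibration, hence is again a subobject of `Y`. -/
lemma IsClosedCells.exists_isNextStage [HasColimits C]
    (hmono : ∀ ⦃A B : C⦄ (i : A ⟶ B), I.rlp.llp i → Mono i) (hT : IsClosedCells c T)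
    {j : J} (hj : ¬ IsMax j) {Q : Subobject Y} (hQ : IsStage c T j Q) :
    ∃ Q', IsStage c T (Order.succ j) Q' ∧ IsNextStage c T j hj Q Q' := by
  obtain ⟨φ, hφ, hφ'⟩ := hQ.exists_incl
  have := hmono _ (relativeCellComplex_incl_mem c j)
  have := hmono _ (relativeCellComplex_incl_mem c (Order.succ j))
  have A := AttachCells.isCellAttachment (c.attachCells j hj)
  have ha (k : CellsAt c T j hj) : ∃ a : ((c.attachCells j hj).π k.1).1.left ⟶ (Q : C),
      a ≫ Q.arrow = cellAttachingMap c ⟨j, hj, k.1⟩ ≫ c.incl.app j :=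
    (subobject_factors_iff _ _).1 (hT _ k.2 Q hQ.isLeast.1)
  choose a ha using ha
  have haφ (k) : a k ≫ φ = cellAttachingMap c ⟨j, hj, k.1⟩ :=
    (cancel_mono (c.incl.app j)).1
      ((Category.assoc _ _ _).trans ((a k ≫= hφ).trans (ha k)))
  let Acof := colimit.cocone (Discrete.functor fun k : CellsAt c T j hj ↦
    ((c.attachCells j hj).π k.1).1.left)
  let Bcof := colimit.cocone (Discrete.functor fun k : CellsAt c T j hj ↦
    ((c.attachCells j hj).π k.1).1.right)
  let u := Cofan.IsColimit.desc (c := Acof) (colimit.isColimit _) a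
  let w := Cofan.IsColimit.desc (c := Acof) (colimit.isColimit _) fun k ↦
    I.homFamily ((c.attachCells j hj).π k.1) ≫ Cofan.inj Bcof k
  let d (k : CellsAt c T j hj) : ((c.attachCells j hj).π k.1).1.right ⟶ pushout u w :=
    Cofan.inj Bcof k ≫ pushout.inr u w
  have H : IsCellAttachment (fun k : CellsAt c T j hj ↦ I.homFamily ((c.attachCells j hj).π k.1))
      (pushout.inl u w) a d := by
    refine ⟨Acof, Bcof, colimit.isColimit _, colimit.isColimit _, ?_⟩
    have : Cofan.IsColimit.desc (c := Bcof) (colimit.isColimit _) d = pushout.inr u w :=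
      Cofan.IsColimit.hom_ext (c := Bcof) (colimit.isColimit _) _ _ fun k ↦ by
        rw [Cofan.IsColimit.fac]
    rw [this]
    exact IsPushout.of_hasPushout u w
  obtain ⟨φ', h₁, h₂⟩ := H.exists_desc (φ ≫ c.F.map (homOfLE (Order.le_succ j)))
    (fun k ↦ cellMap c ⟨j, hj, k.1⟩) fun k ↦ by
      rw [reassoc_of% (haφ k)]
      exact (A.w k.1).symm
  have hlift := exists_lift_attach_rest hj H φ φ' haφ h₂
  -- First extend along the cofibration `φ` to all of `c.F.obj j`, then over the cells outside `T`.
  have hφ'' : I.rlp.llp φ' := fun E B p hp ↦ ⟨fun {t b} sq ↦ by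
    have := hφ' p hp
    have sq' : CommSq (pushout.inl u w ≫ t) φ p (c.F.map (homOfLE (Order.le_succ j)) ≫ b) :=
      ⟨by rw [Category.assoc, sq.w, reassoc_of% h₁]⟩
    obtain ⟨l, _, hl₂, hl₃⟩ := hlift p hp t b sq'.lift sq'.fac_left sq'.fac_right sq.w h₁
    exact ⟨⟨{ l := l, fac_left := hl₂, fac_right := hl₃ }⟩⟩⟩
  have := hmono _ hφ''
  let q := φ' ≫ c.incl.app (Order.succ j)
  let e := Subobject.underlyingIso q
  have he : e.hom ≫ q = (Subobject.mk q).arrow := Subobject.underlyingIso_hom_comp_eq_mk _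
  have he' : e.inv ≫ (Subobject.mk q).arrow = q := by rw [← he, Iso.inv_hom_id_assoc]
  have hq : pushout.inl u w ≫ q = Q.arrow := by
    dsimp only [q]
    have hn : c.F.map (homOfLE (Order.le_succ j)) ≫ c.incl.app (Order.succ j) = c.incl.app j :=
      (c.incl.naturality _).trans (Category.comp_id _)
    rw [reassoc_of% h₁]
    exact (φ ≫= hn).trans hφ
  have hd (k) : d k ≫ q = (⟨j, hj, k.1⟩ : c.Cells).ι := by
    dsimp only [q]
    rw [reassoc_of% (h₂ k)]
    rfl
  have hle : Q ≤ Subobject.mk q := Subobject.le_mk_of_comm (pushout.inl u w) hq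
  have hofLE : Subobject.ofLE Q _ hle = pushout.inl u w ≫ e.inv := by
    rw [← cancel_mono (Subobject.mk q).arrow, Subobject.ofLE_arrow, Category.assoc, he', hq]
  refine ⟨Subobject.mk q, ⟨⟨⟨?_, fun γ hγ hlt ↦ ?_⟩, fun M hM ↦ ?_⟩, e.hom ≫ φ', ?_, ?_⟩,
    ⟨hle, ⟨a, fun k ↦ d k ≫ e.inv, ha, fun k ↦ ?_, ?_⟩, ?_⟩⟩
  · exact Subobject.factors_of_le _ hle hQ.isLeast.1.1
  · obtain h | h := (Order.lt_succ_iff_of_not_isMax hj).1 hlt |>.lt_or_eq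
    · exact Subobject.factors_of_le _ hle (hQ.isLeast.1.2 γ hγ h)
    · obtain ⟨j', hj', k⟩ := γ
      subst h
      exact (subobject_mk_factors_iff _ _).2 ⟨d ⟨k, hγ⟩, hd ⟨k, hγ⟩⟩
  · have hQM : Q ≤ M := hQ.isLeast.2 (hM.of_le (Order.le_succ j))
    obtain ⟨l, _, hl⟩ := H.exists_lift_of_mono M.arrow q (Subobject.ofLE _ _ hQM)
      (by rw [Subobject.ofLE_arrow, hq]) fun k ↦ by
        obtain ⟨y, hy⟩ := (subobject_factors_iff _ _).1
          (hM.2 _ k.2 (Order.lt_succ_of_not_isMax hj))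
        exact ⟨y, hy.trans (hd k).symm⟩
    exact Subobject.mk_le_of_comm l hl
  · rw [Category.assoc]
    exact he
  · exact MorphismProperty.comp_mem _ _ _ (MorphismProperty.llp_of_isIso _ _) hφ''
  · rw [Category.assoc, he', hd]
  · rw [hofLE]
    obtain ⟨a', b', ha', hb', sq⟩ := H
    refine ⟨a', b', ha', hb', ?_⟩
    refine sq.of_iso (Iso.refl _) (Iso.refl _) (Iso.refl _) e.symm (by simp) (by simp) (by simp) ?_
    refine Cofan.IsColimit.hom_ext hb' _ _ fun k ↦ ?_
    simp only [Cofan.IsColimit.fac_assoc, Iso.refl_hom, Category.id_comp, Cofan.IsColimit.fac,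
      Iso.symm_hom]
  · intro E B p hp t b l₀ ψ ψ' hψ hψ' k₁ k₂ k₃
    obtain rfl : ψ = φ := by rw [← cancel_mono (c.incl.app j), hψ, hφ]
    obtain rfl : ψ' = e.hom ≫ φ' := by
      rw [← cancel_mono (c.incl.app (Order.succ j)), hψ', Category.assoc]
      exact he.symm
    obtain ⟨l, hl₁, hl₂, hl₃⟩ := hlift p hp (e.inv ≫ t) b l₀
      (by rw [k₁, hofLE, Category.assoc]) k₂ (by
        rw [Category.assoc, k₃, Category.assoc, Iso.inv_hom_id_assoc]) h₁
    exact ⟨l, hl₁, by rw [Category.assoc, hl₂, Iso.hom_inv_id_assoc], hl₃⟩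

end ClosedCells


/-! ### Colimits in the arrow category -/

section ArrowColimits

variable {C : Type u} [Category.{v} C] {K : Type*} [Category* K]

/-- The functor to the arrow category given by a natural transformation. -/
def arrowFunctor {M F : K ⥤ C} (φ : M ⟶ F) : K ⥤ Arrow C where
  obj k := Arrow.mk (φ.app k)
  map g := Arrow.homMk (M.map g) (F.map g) (by simp)

/-- The cocone of arrows given by a map of cocones. -/
def arrowCocone {M F : K ⥤ C} (φ : M ⟶ F) (s : Cocone M) (t : Cocone F) (q : s.pt ⟶ t.pt)
    (hq : ∀ k, s.ι.app k ≫ q = φ.app k ≫ t.ι.app k) : Cocone (arrowFunctor φ) where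
  pt := Arrow.mk q
  ι :=
    { app := fun k ↦ Arrow.homMk (s.ι.app k) (t.ι.app k) (hq k)
      naturality := fun _ _ g ↦ Arrow.hom_ext _ _ (s.ι.naturality g) (t.ι.naturality g) }

/-- The cocone of sources. -/
def arrowCoconeLeft {M F : K ⥤ C} {φ : M ⟶ F} (r : Cocone (arrowFunctor φ)) : Cocone M where
  pt := r.pt.left
  ι :=
    { app := fun k ↦ (r.ι.app k).left
      naturality := fun _ _ g ↦ congrArg Arrow.Hom.left (r.ι.naturality g) }

/-- The cocone of targets. -/
def arrowCoconeRight {M F : K ⥤ C} {φ : M ⟶ F} (r : Cocone (arrowFunctor φ)) : Cocone F where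
  pt := r.pt.right
  ι :=
    { app := fun k ↦ (r.ι.app k).right
      naturality := fun _ _ g ↦ congrArg Arrow.Hom.right (r.ι.naturality g) }

/-- Colimits of arrows are computed componentwise. -/
def isColimitArrowCocone {M F : K ⥤ C} (φ : M ⟶ F) {s : Cocone M} {t : Cocone F}
    (hs : IsColimit s) (ht : IsColimit t) (q : s.pt ⟶ t.pt)
    (hq : ∀ k, s.ι.app k ≫ q = φ.app k ≫ t.ι.app k) : IsColimit (arrowCocone φ s t q hq) where
  desc r := Arrow.homMk (hs.desc (arrowCoconeLeft r)) (ht.desc (arrowCoconeRight r))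
    (hs.hom_ext fun k ↦ by
      refine (hs.fac_assoc (arrowCoconeLeft r) k r.pt.hom).trans ?_
      refine (Arrow.w (r.ι.app k)).trans (Eq.trans ?_ (Category.assoc _ _ _))
      refine Eq.trans ?_ ((hq k).symm =≫ ht.desc (arrowCoconeRight r))
      exact (φ.app k ≫= (ht.fac (arrowCoconeRight r) k).symm).trans (Category.assoc _ _ _).symm)
  fac r k := Arrow.hom_ext _ _ (hs.fac _ _) (ht.fac _ _)
  uniq r m hm := Arrow.hom_ext _ _
    (hs.hom_ext fun k ↦ (congrArg Arrow.Hom.left (hm k)).trans (hs.fac (arrowCoconeLeft r) k).symm)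
    (ht.hom_ext fun k ↦
      (congrArg Arrow.Hom.right (hm k)).trans (ht.fac (arrowCoconeRight r) k).symm)

end ArrowColimits

/-! ### The sequence of stages and its colimits -/

section Stages

variable {C : Type u} [Category.{v} C]

/-- A diagonal in a square from `q` to `p` is a lift of the square, as a map of arrows, along `(𝟙,
p) : 𝟙 E ⟶ p`. Transfinite lifting in the arrow category therefore applies, and its successor step
is a corner lifting problem. -/
lemma hasLiftingProperty_of_steps {K : Type v} [LinearOrder K] [OrderBot K] [SuccOrder K]
    [WellFoundedLT K] {M F : K ⥤ C} [M.IsWellOrderContinuous] [F.IsWellOrderContinuous]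
    (φ : M ⟶ F) {s : Cocone M} {t : Cocone F} (hs : IsColimit s) (ht : IsColimit t)
    (q : s.pt ⟶ t.pt) (hq : ∀ k, s.ι.app k ≫ q = φ.app k ≫ t.ι.app k) {E B : C} (p : E ⟶ B)
    (h₀ : HasLiftingProperty (φ.app ⊥) p)
    (h : ∀ k, ¬ IsMax k → ∀ (t : M.obj (Order.succ k) ⟶ E) (b : F.obj (Order.succ k) ⟶ B)
      (l₀ : F.obj k ⟶ E), φ.app k ≫ l₀ = M.map (homOfLE (Order.le_succ k)) ≫ t →
      l₀ ≫ p = F.map (homOfLE (Order.le_succ k)) ≫ b → t ≫ p = φ.app _ ≫ b →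
      ∃ l : F.obj (Order.succ k) ⟶ E, F.map (homOfLE (Order.le_succ k)) ≫ l = l₀ ∧
        φ.app _ ≫ l = t ∧ l ≫ p = b) : HasLiftingProperty q p := by
  have : (arrowFunctor φ).IsWellOrderContinuous :=
    ⟨fun m hm ↦ ⟨isColimitArrowCocone
      (Functor.whiskerLeft (Set.principalSegIio m).monotone.functor φ)
      (M.isColimitOfIsWellOrderContinuous m hm)
      (F.isColimitOfIsWellOrderContinuous m hm) (φ.app m) fun _ ↦ φ.naturality _⟩⟩
  refine ⟨fun {x b} sq ↦ ?_⟩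
  let r : Arrow.mk (𝟙 E) ⟶ Arrow.mk p := Arrow.homMk (𝟙 E) p (by simp)
  let β : Arrow.mk q ⟶ Arrow.mk p := Arrow.homMk x b sq.w
  have sq₀ : CommSq (s.ι.app ⊥ ≫ x) (φ.app ⊥) p (t.ι.app ⊥ ≫ b) :=
    ⟨by rw [Category.assoc, sq.w, reassoc_of% (hq ⊥)]⟩
  let f₀ : Arrow.mk (φ.app ⊥) ⟶ Arrow.mk (𝟙 E) := Arrow.homMk (s.ι.app ⊥ ≫ x) sq₀.lift (by simp)
  obtain ⟨l, _, hl⟩ := exists_lift_of_steps (isColimitArrowCocone φ hs ht q hq) r β f₀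
    (Arrow.hom_ext _ _ (Category.comp_id _) sq₀.fac_right) fun k hk f' hf' ↦ by
      have h₁ : f'.left = s.ι.app k ≫ x :=
        (Category.comp_id _).symm.trans (congrArg Arrow.Hom.left hf')
      have h₂ : f'.right ≫ p = t.ι.app k ≫ b := congrArg Arrow.Hom.right hf'
      have h₃ : φ.app k ≫ f'.right = f'.left := (Arrow.w f').symm.trans (Category.comp_id _)
      obtain ⟨l, hl₁, hl₂, hl₃⟩ := h k hk (s.ι.app _ ≫ x) (t.ι.app _ ≫ b) f'.right
        (by rw [h₃, h₁, Cocone.w_assoc]) (h₂.trans (t.w_assoc _ _).symm)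
        (by rw [Category.assoc, sq.w, reassoc_of% (hq (Order.succ k))])
      refine ⟨Arrow.homMk (s.ι.app _ ≫ x) l ((Category.comp_id _).trans hl₂.symm), ?_, ?_⟩
      · exact Arrow.hom_ext _ _ ((s.w_assoc _ _).trans h₁.symm) hl₁
      · exact Arrow.hom_ext _ _ (Category.comp_id _) hl₃
  have h₁ : l.left = x := (Category.comp_id _).symm.trans (congrArg Arrow.Hom.left hl)
  exact ⟨⟨{
    l := l.right
    fac_left := ((Arrow.w l).symm.trans (Category.comp_id _)).trans h₁
    fac_right := congrArg Arrow.Hom.right hl }⟩⟩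

variable {I : MorphismProperty C} {J : Type v} [LinearOrder J]
  [OrderBot J] [SuccOrder J] [WellFoundedLT J] {X Y : C} {f : X ⟶ Y}

/-- The condition that all stages up to `j` exist. -/
def HasStages (c : CellPresentation I J f) (T : Set c.Cells) (j : J) : Prop :=
  ∀ i ≤ j, ∃ Q, IsStage c T i Q

open scoped Classical in
/-- The `j`th stage, or everything if some earlier stage does not exist. -/
noncomputable def stage (c : CellPresentation I J f) (T : Set c.Cells) (j : J) : Subobject Y :=
  -- Asking for all stages up to `j`, with default `⊤`, makes the assignment monotone
  -- unconditionally; the functor can be formed before the stages are known to exist.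
  if h : HasStages c T j then (h j le_rfl).choose else ⊤

variable {c : CellPresentation I J f} {T : Set c.Cells}

lemma HasStages.isStage {j : J} (h : HasStages c T j) : IsStage c T j (stage c T j) := by
  rw [stage, dif_pos h]
  exact (h j le_rfl).choose_spec

lemma HasStages.of_le {i j : J} (h : HasStages c T j) (hij : i ≤ j) : HasStages c T i :=
  fun _ hk ↦ h _ (hk.trans hij)

variable (c T) in
lemma monotone_stage : Monotone (stage c T) := by
  intro i j hij
  by_cases h : HasStages c T j
  · exact (h.of_le hij).isStage.le hij h.isStage
  · rw [stage, stage, dif_neg h]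
    exact le_top

variable (c T) in
/-- The sequence of stages. -/
noncomputable def stageFunctor : J ⥤ C := (monotone_stage c T).functor ⋙ Subobject.underlying

lemma stageFunctor_map_arrow {i j : J} (g : i ⟶ j) :
    (stageFunctor c T).map g ≫ (stage c T j).arrow = (stage c T i).arrow :=
  Subobject.underlying_arrow _

lemma stageFunctor_map_eq {i j : J} (g : i ⟶ j) (h : stage c T i ≤ stage c T j) :
    (stageFunctor c T).map g = Subobject.ofLE _ _ h :=
  (cancel_mono (stage c T j).arrow).1
    ((stageFunctor_map_arrow g).trans (Subobject.ofLE_arrow h).symm)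

lemma IsClosedCells.isNextStage [HasColimits C]
    (hmono : ∀ ⦃A B : C⦄ (i : A ⟶ B), I.rlp.llp i → Mono i) (hT : IsClosedCells c T)
    {j : J} (hj : ¬ IsMax j) (h : HasStages c T (Order.succ j)) :
    IsNextStage c T j hj (stage c T j) (stage c T (Order.succ j)) := by
  obtain ⟨Q, hQ, hQ'⟩ := hT.exists_isNextStage hmono hj (h.of_le (Order.le_succ j)).isStage
  rwa [hQ.unique h.isStage] at hQ'

/-- A colimit of a sequence of stages includes in the colimit of the given sequence by a
cofibration. -/
lemma llp_colimit_stages [HasColimits C]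
    (hmono : ∀ ⦃A B : C⦄ (i : A ⟶ B), I.rlp.llp i → Mono i) (hT : IsClosedCells c T)
    {K : Type v} [LinearOrder K] [OrderBot K] [SuccOrder K] [WellFoundedLT K] (e : K ⥤ J)
    (he : ∀ k, ¬ IsMax k → ¬ IsMax (e.obj k))
    (he' : ∀ k, ¬ IsMax k → e.obj (Order.succ k) = Order.succ (e.obj k))
    (h : ∀ k, HasStages c T (e.obj k))
    [(e ⋙ stageFunctor c T).IsWellOrderContinuous] [(e ⋙ c.F).IsWellOrderContinuous]
    {s : Cocone (e ⋙ stageFunctor c T)} {t : Cocone (e ⋙ c.F)}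
    (hs : IsColimit s) (ht : IsColimit t) (q : s.pt ⟶ t.pt) (x : t.pt ⟶ Y) [Mono x]
    (hx : ∀ k, t.ι.app k ≫ x = c.incl.app (e.obj k))
    (hq : ∀ k, s.ι.app k ≫ q ≫ x = (stage c T (e.obj k)).arrow) :
    I.rlp.llp q := by
  choose φ hφ hφ' using fun k ↦ (h k).isStage.exists_incl
  have hmono' (j : J) : Mono (c.incl.app j) := hmono _ (relativeCellComplex_incl_mem c j)
  have hnat (j : J) (k : J) (g : j ⟶ k) : c.F.map g ≫ c.incl.app k = c.incl.app j :=
    (c.incl.naturality g).trans (Category.comp_id _)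
  let Φ : e ⋙ stageFunctor c T ⟶ e ⋙ c.F :=
    { app := φ
      naturality := fun k l g ↦ (cancel_mono (c.incl.app (e.obj l))).1 (by
        refine ((Category.assoc _ _ _).trans (_ ≫= hφ l)).trans
          ((stageFunctor_map_arrow (e.map g)).trans ?_)
        exact ((hφ k).symm.trans (φ k ≫= (hnat _ _ (e.map g)).symm)).trans
          (Category.assoc _ _ _).symm) }
  intro E B p hp
  refine hasLiftingProperty_of_steps Φ hs ht q (fun k ↦ ?_) p (hφ' ⊥ p hp)
    fun k hk t' b l₀ h₁ h₂ h₃ ↦ ?_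
  · refine (cancel_mono x).1 (((Category.assoc _ _ _).trans (hq k)).trans ?_)
    exact ((hφ k).symm.trans (φ k ≫= (hx k).symm)).trans (Category.assoc _ _ _).symm
  · have hs : HasStages c T (Order.succ (e.obj k)) := he' k hk ▸ h (Order.succ k)
    have H := hT.isNextStage hmono (he k hk) hs
    -- `e` preserves successors only up to a propositional equality, so the index is generalized
    -- before substitution.
    have aux : ∀ (l : J) (hl : l = Order.succ (e.obj k)) (g : e.obj k ⟶ l)
        (t' : (stageFunctor c T).obj l ⟶ E) (b : c.F.obj l ⟶ B)
        (φ' : (stageFunctor c T).obj l ⟶ c.F.obj l) (_ : φ' ≫ c.incl.app l = (stage c T l).arrow)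
        (_ : φ k ≫ l₀ = (stageFunctor c T).map g ≫ t') (_ : l₀ ≫ p = c.F.map g ≫ b)
        (_ : t' ≫ p = φ' ≫ b),
        ∃ y : c.F.obj l ⟶ E, c.F.map g ≫ y = l₀ ∧ φ' ≫ y = t' ∧ y ≫ p = b := by
      rintro l rfl g t' b φ' h₀ h₁ h₂ h₃
      rw [stageFunctor_map_eq g H.le] at h₁
      exact H.exists_lift p hp t' b l₀ (φ k) φ' (hφ k) h₀ h₁ h₂ h₃
    exact aux _ (he' k hk) (e.map (homOfLE (Order.le_succ k))) t' b (φ _) (hφ _) h₁ h₂ h₃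

end Stages


/-! ### Existence of all stages -/

section Stages

variable {C : Type u} [Category.{v} C] {I : MorphismProperty C} {J : Type v} [LinearOrder J]
  [OrderBot J] [SuccOrder J] [WellFoundedLT J] {X Y : C} {f : X ⟶ Y}
  {c : CellPresentation I J f} {T : Set c.Cells}

/-- The least element and the successors of an initial segment given by a limit element. -/
abbrev orderBotIio {m : J} (hm : Order.IsSuccLimit m) : OrderBot (Set.Iio m) where
  bot := ⟨⊥, hm.bot_lt⟩
  bot_le _ := bot_le

abbrev succOrderIio {m : J} (hm : Order.IsSuccLimit m) : SuccOrder (Set.Iio m) where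
  succ i := ⟨Order.succ i.1, hm.succ_lt i.2⟩
  le_succ i := Order.le_succ i.1
  max_of_succ_le {i} h := ((Order.max_of_succ_le (a := i.1) h).not_lt (by
    exact (hm.succ_lt i.2).trans_le' (Order.le_succ i.1))).elim
  succ_le_of_lt h := Order.succ_le_of_lt h

omit [OrderBot J] [SuccOrder J] [WellFoundedLT J] in
lemma isWellOrderContinuous_restrict {F : J ⥤ C} {m : J}
    (h : ∀ i < m, Order.IsSuccLimit i → Nonempty (IsColimit ((Set.principalSegIio i).cocone F))) :
    ((Set.principalSegIio m).monotone.functor ⋙ F).IsWellOrderContinuous where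
  nonempty_isColimit i hi := by
    let e : Set.Iio m ≤i J := (Set.principalSegIio m : Set.Iio m ≤i J)
    let e' := (Set.principalSegIio i).transInitial e
    have hi' : Order.IsSuccLimit i.1 := by
      have := (e.isSuccLimit_apply_iff (a := i)).2 hi
      exact this
    exact ⟨(h i.1 i.2 hi').some.whiskerEquivalence e'.orderIsoIio.equivalence⟩

lemma factors_stage_of_lt {i j : J} (hij : i < j) (hs : ∀ k < j, HasStages c T k)
    (hj : Order.IsSuccLimit j) {γ : c.Cells} (hγ : γ ∈ T) (h : γ.j = i) :
    (stage c T (Order.succ i)).Factors γ.ι :=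
  (hs _ (hj.succ_lt hij)).isStage.isLeast.1.2 γ hγ (by
    rw [h]; exact Order.lt_succ_of_not_isMax (not_isMax_of_lt hij))

/-- The colimit of the earlier stages maps to `c.F.obj m` by a cofibration, by `llp_colimit_stages`,
so it is a subobject of `Y`. It is the least one required, because maps out of it are determined on
earlier stages. -/
lemma IsClosedCells.hasStages_of_isSuccLimit [HasColimits C]
    (hmono : ∀ ⦃A B : C⦄ (i : A ⟶ B), I.rlp.llp i → Mono i) (hT : IsClosedCells c T)
    {m : J} (hm : Order.IsSuccLimit m) (hs : ∀ k < m, HasStages c T k)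
    (hc : ∀ k < m, Order.IsSuccLimit k →
      Nonempty (IsColimit ((Set.principalSegIio k).cocone (stageFunctor c T)))) :
    HasStages c T m ∧ Nonempty (IsColimit ((Set.principalSegIio m).cocone (stageFunctor c T))) := by
  let _ := orderBotIio hm
  let _ := succOrderIio hm
  have := isWellOrderContinuous_restrict hc
  have : ((Set.principalSegIio m).monotone.functor ⋙ c.F).IsWellOrderContinuous :=
    isWellOrderContinuous_restrict fun i _ hi ↦ ⟨c.F.isColimitOfIsWellOrderContinuous i hi⟩
  have : @Mono _ _ (c.F.obj m) Y (c.incl.app m) := hmono _ (relativeCellComplex_incl_mem c m)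
  let t := (Set.principalSegIio m).cocone c.F
  have : @Mono _ _ t.pt Y (c.incl.app m) := this
  have : Mono (c.incl.app m) := this
  have ht : IsColimit t := c.F.isColimitOfIsWellOrderContinuous m hm
  let s := colimit.cocone ((Set.principalSegIio m).monotone.functor ⋙ stageFunctor c T)
  have hs' : IsColimit s := colimit.isColimit _
  choose φ hφ hφ' using fun k : Set.Iio m ↦ (hs k.1 k.2).isStage.exists_incl
  have hφm (k : Set.Iio m) : (φ k ≫ c.F.map (homOfLE k.2.le)) ≫ c.incl.app m =
      (stage c T k.1).arrow := by
    refine (Category.assoc _ _ _).trans (Eq.trans ?_ (hφ k))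
    exact φ k ≫= (c.incl.naturality _).trans (Category.comp_id _)
  let q : s.pt ⟶ t.pt := hs'.desc ⟨c.F.obj m,
    { app := fun k ↦ φ k ≫ c.F.map (homOfLE k.2.le)
      naturality := fun k l g ↦ (cancel_mono (c.incl.app m)).1 (by
        refine (Category.assoc _ _ _).trans ((_ ≫= hφm l).trans ?_)
        refine Eq.trans ?_ ((hφm k).symm.trans ((Category.comp_id _).symm =≫ _))
        exact stageFunctor_map_arrow ((Set.principalSegIio m).monotone.functor.map g)) }⟩
  have hq (k : Set.Iio m) : s.ι.app k ≫ q = φ k ≫ c.F.map (homOfLE k.2.le) := hs'.fac _ k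
  have hq' (k : Set.Iio m) : s.ι.app k ≫ q ≫ c.incl.app m = (stage c T k.1).arrow :=
    (Category.assoc _ _ _).symm.trans ((hq k =≫ _).trans (hφm k))
  have hqllp : I.rlp.llp q := llp_colimit_stages hmono hT (Set.principalSegIio m).monotone.functor
    (fun k _ ↦ not_isMax_of_lt k.2) (fun _ _ ↦ rfl) (fun k ↦ hs _ k.2) hs' ht q
    (c.incl.app m) (fun k ↦ (c.incl.naturality _).trans (Category.comp_id _)) hq'
  have := hmono _ hqllp
  let x : s.pt ⟶ Y := q ≫ c.incl.app m
  have : Mono x := mono_comp _ _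
  let e := Subobject.underlyingIso x
  have he : e.hom ≫ x = (Subobject.mk x).arrow := Subobject.underlyingIso_hom_comp_eq_mk _
  have hle (k : Set.Iio m) : stage c T k.1 ≤ Subobject.mk x :=
    Subobject.le_mk_of_comm (s.ι.app k) (hq' k)
  have H : IsStage c T m (Subobject.mk x) := by
    refine ⟨⟨⟨?_, fun γ hγ hlt ↦ ?_⟩, fun M hM ↦ ?_⟩, e.hom ≫ q, ?_, ?_⟩
    · exact Subobject.factors_of_le _ (hle ⊥) (hs _ hm.bot_lt).isStage.isLeast.1.1
    · exact Subobject.factors_of_le _ (hle ⟨_, hm.succ_lt hlt⟩)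
        (factors_stage_of_lt hlt hs hm hγ rfl)
    · have hM' (k : Set.Iio m) : stage c T k.1 ≤ M :=
        (hs k.1 k.2).isStage.isLeast.2 (hM.of_le k.2.le)
      let l : s.pt ⟶ (M : C) := hs'.desc ⟨(M : C),
        { app := fun k ↦ Subobject.ofLE _ _ (hM' k)
          naturality := fun k l g ↦ (cancel_mono M.arrow).1 (by
            refine (Category.assoc _ _ _).trans ((_ ≫= Subobject.ofLE_arrow _).trans ?_)
            refine Eq.trans ?_ ((Subobject.ofLE_arrow (hM' k)).symm.trans
              ((Category.comp_id _).symm =≫ _))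
            exact stageFunctor_map_arrow ((Set.principalSegIio m).monotone.functor.map g)) }⟩
      refine Subobject.mk_le_of_comm l (hs'.hom_ext fun k ↦ ?_)
      refine (hs'.fac_assoc _ k _).trans ((Subobject.ofLE_arrow _).trans (hq' k).symm)
    · exact (Category.assoc _ _ _).trans he
    · exact MorphismProperty.comp_mem _ _ _ (MorphismProperty.llp_of_isIso _ _) hqllp
  have Hm : HasStages c T m := fun i hi ↦ by
    obtain h | rfl := hi.lt_or_eq
    · exact hs i h i le_rfl
    · exact ⟨_, H⟩
  -- The chosen stage agrees with the constructed one by leastness, and so inherits the colimit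
  -- property.
  obtain ⟨e', he'⟩ : ∃ e' : s.pt ≅ (stage c T m : C), e'.hom ≫ (stage c T m).arrow = x := by
    rw [← H.unique Hm.isStage]
    exact ⟨e.symm, (Iso.inv_comp_eq _).2 he.symm⟩
  refine ⟨Hm, ⟨hs'.ofIsoColimit (Cocone.ext e' fun k ↦ ?_)⟩⟩
  refine (cancel_mono (stage c T m).arrow).1 (Eq.trans ?_ (stageFunctor_map_arrow _).symm)
  exact (Category.assoc _ _ _).trans ((s.ι.app k ≫= he').trans (hq' k))

/-- Existence and continuity are proved together: the limit case needs the sequence below to be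
continuous already. -/
theorem IsClosedCells.hasStages [HasColimits C]
    (hmono : ∀ ⦃A B : C⦄ (i : A ⟶ B), I.rlp.llp i → Mono i) (hT : IsClosedCells c T) (j : J) :
    HasStages c T j ∧ (Order.IsSuccLimit j →
      Nonempty (IsColimit ((Set.principalSegIio j).cocone (stageFunctor c T)))) := by
  induction j using SuccOrder.limitRecOn with
  | isMin j hj =>
    refine ⟨fun i hi ↦ ?_, fun h ↦ (h.not_isMin hj).elim⟩
    obtain rfl : i = ⊥ := (hj.eq_bot ▸ hi : i ≤ ⊥).antisymm bot_le
    exact isStage_bot hmono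
  | succ j hj h =>
    refine ⟨fun i hi ↦ ?_, fun h ↦ (hj h.isMax).elim⟩
    obtain hi | rfl := hi.lt_or_eq
    · exact h.1 i ((Order.lt_succ_iff_of_not_isMax hj).1 hi)
    · obtain ⟨Q, hQ, _⟩ := hT.exists_isNextStage hmono hj h.1.isStage
      exact ⟨Q, hQ⟩
  | isSuccLimit j hj h =>
    have := hT.hasStages_of_isSuccLimit hmono hj (fun k hk ↦ (h k hk).1) fun k hk ↦ (h k hk).2
    exact ⟨this.1, fun _ ↦ this.2⟩

end Stages


/-! ### Closed sets of cells are subcomplexes -/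

section ClosedSubcomplex

variable {C : Type u} [Category.{v} C] {I : MorphismProperty C} {J : Type v} [LinearOrder J]
  [OrderBot J] [SuccOrder J] [WellFoundedLT J] {X Y : C} {f : X ⟶ Y}
  {c : CellPresentation I J f} {T : Set c.Cells}

/-- A closed set of cells is the set of cells of a subcomplex, through which every map factors that
factors through each subobject containing the source and the given cells. -/
theorem IsClosedCells.exists_subcomplex [HasColimits C]
    (hmono : ∀ ⦃A B : C⦄ (i : A ⟶ B), I.rlp.llp i → Mono i) (hT : IsClosedCells c T) :
    ∃ S : Subcomplex c, S.cells = T ∧ ∀ ⦃W : C⦄ (p : W ⟶ Y),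
      SupportedBy f (fun γ : c.Cells ↦ γ.ι) T p → S.FactorsThrough p := by
  have hs (j : J) : HasStages c T j := (hT.hasStages hmono j).1
  have hwc : (stageFunctor c T).IsWellOrderContinuous := ⟨fun j hj ↦ (hT.hasStages hmono j).2 hj⟩
  choose φ hφ hφ' using fun j : J ↦ (hs j).isStage.exists_incl
  have hcm (j : J) : @Mono _ _ (c.F.obj j) Y (c.incl.app j) :=
    hmono _ (relativeCellComplex_incl_mem c j)
  have hcm' (j : J) : Mono (c.incl.app j) := hcm j
  have hnat (j : J) (k : J) (g : j ⟶ k) : c.F.map g ≫ c.incl.app k = c.incl.app j :=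
    (c.incl.naturality g).trans (Category.comp_id _)
  let Φ : stageFunctor c T ⟶ c.F :=
    { app := φ
      naturality := fun k l g ↦ (cancel_mono (c.incl.app l)).1 (by
        refine ((Category.assoc _ _ _).trans (_ ≫= hφ l)).trans
          ((stageFunctor_map_arrow g).trans ?_)
        exact ((hφ k).symm.trans (φ k ≫= (hnat _ _ g).symm)).trans (Category.assoc _ _ _).symm) }
  have hN (j : J) (hj : ¬ IsMax j) := hT.isNextStage hmono hj (hs (Order.succ j))
  choose a d ha hd H using fun j hj ↦ (hN j hj).exists_attachment
  let S : Subcomplex c :=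
    { cells := T
      F := stageFunctor c T
      isWellOrderContinuous := hwc
      φ := Φ
      isIso_bot := by
        obtain ⟨y, hy⟩ := (subobject_factors_iff _ _).1 (hs ⊥).isStage.isLeast.1.1
        have h₁ : c.isoBot.hom ≫ y ≫ (stage c T ⊥).arrow = c.incl.app ⊥ := by
          rw [hy, isoBot_hom_comp]
        refine ⟨c.isoBot.hom ≫ y, (cancel_mono (stage c T ⊥).arrow).1 ?_,
          (cancel_mono (c.incl.app ⊥)).1 ?_⟩
        · refine (Category.assoc _ _ _).trans ((_ ≫= (Category.assoc _ _ _).trans h₁).trans ?_)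
          exact (hφ ⊥).trans (Category.id_comp _).symm
        · refine (Category.assoc _ _ _).trans ((_ ≫= hφ ⊥).trans ?_)
          exact ((Category.assoc _ _ _).trans h₁).trans (Category.id_comp _).symm
      attachingMap := fun γ hγ ↦ a γ.j γ.hj ⟨γ.k, hγ⟩
      attachingMap_φ := fun γ hγ ↦ (cancel_mono (c.incl.app γ.j)).1
        ((Category.assoc _ _ _).trans ((_ ≫= hφ γ.j).trans (ha γ.j γ.hj ⟨γ.k, hγ⟩)))
      map := fun γ hγ ↦ d γ.j γ.hj ⟨γ.k, hγ⟩
      map_φ := fun γ hγ ↦ (cancel_mono (c.incl.app (Order.succ γ.j))).1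
        ((Category.assoc _ _ _).trans ((_ ≫= hφ _).trans (hd γ.j γ.hj ⟨γ.k, hγ⟩)))
      isCellAttachment := fun j hj ↦ by
        rw [stageFunctor_map_eq _ (hN j hj).le]
        exact H j hj }
  refine ⟨S, rfl, fun W p hp ↦ ?_⟩
  let t := colimit.cocone (stageFunctor c T)
  have ht : IsColimit t := colimit.isColimit _
  let q : t.pt ⟶ Y := ht.desc ⟨Y, S.φ ≫ c.incl⟩
  have hq (j : J) : t.ι.app j ≫ q = (stage c T j).arrow := (ht.fac _ j).trans (hφ j)
  have : (𝟭 J ⋙ stageFunctor c T).IsWellOrderContinuous := hwc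
  have hwc' : c.F.IsWellOrderContinuous := inferInstance
  have : (𝟭 J ⋙ c.F).IsWellOrderContinuous := hwc'
  -- The colimit of all stages is thus itself a subobject of `Y`, and it is to this subobject that
  -- the support of `p` is applied.
  have hqllp : I.rlp.llp q := llp_colimit_stages hmono hT (𝟭 J) (fun _ h ↦ h) (fun _ _ ↦ rfl) hs
    (s := t) (t := ⟨Y, c.incl⟩) ht c.isColimit q (𝟙 Y) (fun k ↦ Category.comp_id _)
    (fun k ↦ (_ ≫= Category.comp_id q).trans (hq k))
  have := hmono _ hqllp
  obtain ⟨y, hy⟩ := hp q (by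
    obtain ⟨y, hy⟩ := (subobject_factors_iff _ _).1 (hs ⊥).isStage.isLeast.1.1
    exact ⟨y ≫ t.ι.app ⊥, (Category.assoc _ _ _).trans ((y ≫= hq ⊥).trans hy)⟩) (fun γ hγ ↦
    ⟨d γ.j γ.hj ⟨γ.k, hγ⟩ ≫ t.ι.app (Order.succ γ.j), (Category.assoc _ _ _).trans
      ((_ ≫= hq _).trans (hd γ.j γ.hj ⟨γ.k, hγ⟩))⟩)
  exact ⟨t, ht, y, hy⟩

end ClosedSubcomplex


/-! ### Compact objects are small relative to cofibrations -/

section CompactSmall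

variable {C : Type u} [Category.{v} C]

/-- A section over one term extends to the next by lifting the cofibration between them against the
pullback of `r` to the next term. -/
lemma exists_section_of_steps [HasLimits C] {I : MorphismProperty C} {J : Type v} [LinearOrder J]
    [OrderBot J] [SuccOrder J] [WellFoundedLT J] {F : J ⥤ C} [F.IsWellOrderContinuous]
    (hF : ∀ j, ¬ IsMax j → I.rlp.llp (F.map (homOfLE (Order.le_succ j)))) {t : Cocone F}
    (ht : IsColimit t) {E : C} (r : E ⟶ t.pt)
    (hr : ∀ j, I.rlp (pullback.snd r (t.ι.app (Order.succ j)))) (y : F.obj ⊥ ⟶ E)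
    (hy : y ≫ r = t.ι.app ⊥) : ∃ s : t.pt ⟶ E, s ≫ r = 𝟙 _ := by
  obtain ⟨l, _, hl⟩ := exists_lift_of_steps ht r (𝟙 _) y (hy.trans (Category.comp_id _).symm)
    fun j hj f' hf' ↦ by
      have := hF j hj _ (hr j)
      have w : f' ≫ r = F.map (homOfLE (Order.le_succ j)) ≫ t.ι.app (Order.succ j) := by
        rw [t.w, hf']
        exact Category.comp_id _
      have sq : CommSq (pullback.lift f' _ w) (F.map (homOfLE (Order.le_succ j)))
          (pullback.snd r (t.ι.app (Order.succ j))) (𝟙 _) :=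
        ⟨by rw [pullback.lift_snd, Category.comp_id]⟩
      refine ⟨sq.lift ≫ pullback.fst _ _, ?_, ?_⟩
      · rw [← Category.assoc, sq.fac_left, pullback.lift_fst]
      · rw [Category.assoc, pullback.condition, ← Category.assoc, sq.fac_right, Category.id_comp]
        exact (Category.comp_id _).symm
  exact ⟨l, hl⟩

/-- Take the terms of the sequence as pieces of its colimit. A map from `A` is supported by at most
`κ` of them, these are bounded, and the term above them is a subobject, so the map factors through
it. Uniqueness holds because the terms are subobjects. -/
theorem IsCompactRelativeTo.isSmallRelativeTo [HasColimits C] [HasLimits C]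
    {I : MorphismProperty C} [MorphismProperty.IsSmall.{v} I]
    (hI : ∀ ⦃A B : C⦄ (i : A ⟶ B), I i → IsSmallRelativeTo (relativeCellComplexes I) A)
    (hmono : ∀ ⦃A B : C⦄ (i : A ⟶ B), I.rlp.llp i → Mono i) {A : C}
    (hA : IsCompactRelativeTo I A) : IsSmallRelativeTo I.rlp.llp A := by
  obtain ⟨κ, hκ⟩ := hA
  refine ⟨κ, fun J _ _ _ _ _ hJ F _ hF ↦ ?_⟩
  let t := colimit.cocone F
  have ht : IsColimit t := colimit.isColimit F
  let h : I.rlp.llp.TransfiniteCompositionOfShape J (t.ι.app ⊥) :=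
    { F := F
      isoBot := Iso.refl _
      incl := t.ι
      isColimit := ht
      fac := Category.id_comp _
      map_mem := fun j _ ↦ hF j }
  have htm (j : J) : Mono (t.ι.app j) := hmono _ (h.mem_incl_app j)
  have htm' (j : J) : @Mono _ _ (F.obj j) t.pt (t.ι.app j) := htm j
  refine preservesColimit_of_preserves_colimit_cocone ht
    (Types.FilteredColimit.isColimitOf _ _ ?_ ?_)
  · intro (p : A ⟶ t.pt)
    obtain ⟨T, hT, hp⟩ := exists_supportedBy I hI hκ (t.ι.app ⊥)
      (fun j : J ↦ (t.ι.app (Order.succ j) : F.obj (Order.succ j) ⟶ t.pt))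
      (fun E r hr y hy ↦ exists_section_of_steps (fun j _ ↦ hF j) ht r hr y hy) p
    obtain ⟨j, hj⟩ := hJ T hT
    -- The piece of index `k` is the term at `succ k`, so a bound `j` for the indices gives the term
    -- at `succ j`.
    obtain ⟨y, hy⟩ := hp (t.ι.app (Order.succ j))
      ⟨F.map (homOfLE bot_le), t.w _⟩ fun k hk ↦
        ⟨F.map (homOfLE (Order.succ_le_succ (hj hk))), t.w _⟩
    exact ⟨_, y, hy.symm⟩
  · intro i j (x : A ⟶ F.obj i) (y : A ⟶ F.obj j) (w : x ≫ t.ι.app i = y ≫ t.ι.app j)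
    refine ⟨max i j, homOfLE (le_max_left _ _), homOfLE (le_max_right _ _), ?_⟩
    have : (x ≫ F.map (homOfLE (le_max_left i j))) ≫ t.ι.app (max i j) =
        (y ≫ F.map (homOfLE (le_max_right i j))) ≫ t.ι.app (max i j) :=
      (Category.assoc _ _ _).trans ((x ≫= t.w _).trans (w.trans
        ((y ≫= t.w (homOfLE (le_max_right i j))).symm.trans (Category.assoc y _ _).symm)))
    exact (cancel_mono (t.ι.app (max i j))).1 this

end CompactSmall


/-! ### Compactness of free objects -/

section Compactness

variable {C : Type u} [Category.{v} C] {S : Type u'} [Category.{v} S]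

/-- `R` takes cells of `K` to cofibrations rather than to cells of `I`. This suffices to extend a
partial section of `r` over each of them, working in the pullback to a piece through which the cell
factors. -/
lemma exists_lift_map_attachCells [HasLimits C] {I : MorphismProperty C} {K : MorphismProperty S}
    {R : S ⥤ C} [PreservesColimitsOfSize.{v, v} R] (hR : K ≤ I.rlp.llp.inverseImage R)
    {X₁ X₂ Z : S} {g : X₁ ⟶ X₂} (c : AttachCells.{v} K.homFamily g) (w : X₂ ⟶ Z) {L : Type*}
    {D : L → S} (d : ∀ l, D l ⟶ Z) (hd : ∀ i : c.ι, ∃ l, ∃ y, y ≫ d l = c.cell i ≫ w)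
    {E : C} (r : E ⟶ R.obj Z) (hr : ∀ l, I.rlp (pullback.snd r (R.map (d l))))
    (f' : R.obj X₁ ⟶ E) (hf' : f' ≫ r = R.map (g ≫ w)) :
    ∃ l : R.obj X₂ ⟶ E, R.map g ≫ l = f' ∧ l ≫ r = R.map w := by
  have key (i : c.ι) : ∃ l : R.obj (c.π i).1.right ⟶ E,
      R.map (K.homFamily (c.π i)) ≫ l = R.map (c.cofan₁.inj i ≫ c.g₁) ≫ f' ∧
        l ≫ r = R.map (c.cell i ≫ w) := by
    obtain ⟨l, y, hy⟩ := hd i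
    have hi : (c.cofan₁.inj i ≫ c.g₁) ≫ g = K.homFamily (c.π i) ≫ c.cell i :=
      (AttachCells.isCellAttachment c).w i
    have hw : (R.map (c.cofan₁.inj i ≫ c.g₁) ≫ f') ≫ r =
        (R.map (K.homFamily (c.π i)) ≫ R.map y) ≫ R.map (d l) := by
      rw [Category.assoc, hf', ← R.map_comp, ← R.map_comp, ← R.map_comp, ← Category.assoc, hi,
        Category.assoc, Category.assoc, hy]
    have : HasLiftingProperty (R.map (K.homFamily (c.π i))) (pullback.snd r (R.map (d l))) :=
      hR _ (c.π i).2 _ (hr l)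
    have sq : CommSq (pullback.lift (R.map (c.cofan₁.inj i ≫ c.g₁) ≫ f')
        (R.map (K.homFamily (c.π i)) ≫ R.map y) hw)
        (R.map (K.homFamily (c.π i))) (pullback.snd r (R.map (d l))) (R.map y) :=
      ⟨by rw [pullback.lift_snd]⟩
    refine ⟨sq.lift ≫ pullback.fst _ _, ?_, ?_⟩
    · rw [← Category.assoc, sq.fac_left, pullback.lift_fst]
    · rw [Category.assoc, pullback.condition, ← Category.assoc, sq.fac_right, ← R.map_comp, hy]
  have hc (i : c.ι) : R.map (c.cell i) = (mapAttachCells R c).cell i :=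
    (R.congr_map (c.cell_def i)).trans
      ((R.map_comp _ _).trans ((mapAttachCells R c).cell_def i).symm)
  refine (AttachCells.isCellAttachment (mapAttachCells R c)).exists_lift r (R.map w) f'
    (hf'.trans (R.map_comp _ _)) fun i ↦ ?_
  obtain ⟨l, h₁, h₂⟩ := key i
  exact ⟨l, h₁.trans (R.map_comp _ _ =≫ f'), h₂.trans ((R.map_comp (c.cell i) w).trans (hc i =≫ R.map w))⟩

variable {I : MorphismProperty C} {K : MorphismProperty S} {F : C ⥤ S} {R : S ⥤ C}
  {J : Type v} [LinearOrder J] [OrderBot J] [SuccOrder J] [WellFoundedLT J] {X Y : S} {f : X ⟶ Y}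
  {c : CellPresentation K J f}

/-- Being a right adjoint, `R` sends the subobject `M` to a subobject, whose pullback along `R w` is
a legitimate test for the support of the transpose of `q`. The pullback is needed because `q` may
land in an intermediate stage while `M` lives in the final object. -/
lemma exists_factorization_of_supportedBy (adj : F ⊣ R) {A : C} {Z Z' X₀ : S} {x₀ : X₀ ⟶ Z}
    {L : Type v} {D : L → S} {d : ∀ l, D l ⟶ Z} {T : Set L} {q : F.obj A ⟶ Z}
    (hq : SupportedBy (R.map x₀) (fun l ↦ R.map (d l)) T (adj.homEquiv _ _ q)) [HasLimits C]
    (w : Z ⟶ Z') (M : Subobject Z') (hM : M.Factors (x₀ ≫ w)) (hM' : ∀ l ∈ T, M.Factors (d l ≫ w)) :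
    M.Factors (q ≫ w) := by
  have := adj.rightAdjoint_preservesLimits
  have : Mono (R.map M.arrow) := inferInstance
  have aux {B : S} (b : B ⟶ Z) (hb : M.Factors (b ≫ w)) :
      ∃ y, y ≫ pullback.snd (R.map M.arrow) (R.map w) = R.map b := by
    obtain ⟨y, hy⟩ := (subobject_factors_iff _ _).1 hb
    exact ⟨pullback.lift (R.map y) (R.map b) (by rw [← R.map_comp, ← R.map_comp, hy]),
      pullback.lift_snd _ _ _⟩
  obtain ⟨y, hy⟩ := hq (pullback.snd (R.map M.arrow) (R.map w)) (aux _ hM)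
    fun l hl ↦ aux _ (hM' l hl)
  refine (subobject_factors_iff _ _).2
    ⟨(adj.homEquiv _ _).symm (y ≫ pullback.fst _ _), (adj.homEquiv _ _).injective ?_⟩
  rw [adj.homEquiv_naturality_right, Equiv.apply_symm_apply, Category.assoc, pullback.condition,
    reassoc_of% hy, adj.homEquiv_naturality_right]

section

variable [HasColimits C] [HasLimits C] [MorphismProperty.IsSmall.{v} I]
    (hI : ∀ ⦃A B : C⦄ (i : A ⟶ B), I i → IsSmallRelativeTo (relativeCellComplexes I) A)
    {κ : Cardinal.{v}} {A : C} (hA : IsCompactRelativeToOfSize κ I A)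
    (adj : F ⊣ R) [PreservesColimitsOfSize.{v, v} R] (hR : K ≤ I.rlp.llp.inverseImage R)

include hI hA adj hR

/-- The support theorem is applied to the transpose of `p`, with the images under `R` of all cells
of `Y` as pieces; sections extend cell by cell along the presentation. -/
lemma exists_cells_of_map_free (p : F.obj A ⟶ Y) :
    ∃ T : Set c.Cells, Cardinal.mk T ≤ κ ∧ SupportedBy f (fun γ : c.Cells ↦ γ.ι) T p := by
  obtain ⟨T, hT, hp⟩ := exists_supportedBy I hI hA (R.map f)
    (fun γ : c.Cells ↦ R.map γ.ι) (fun E r hr y hy ↦ by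
      have hF : (c.F ⋙ R).IsWellOrderContinuous :=
        ⟨fun m hm ↦ ⟨isColimitOfPreserves R (c.F.isColimitOfIsWellOrderContinuous m hm)⟩⟩
      have hn (j k : J) (g : j ⟶ k) : c.F.map g ≫ c.incl.app k = c.incl.app j :=
        (c.incl.naturality g).trans (Category.comp_id _)
      obtain ⟨l, _, hl⟩ := exists_lift_of_steps (isColimitOfPreserves R c.isColimit) r (𝟙 _)
        (R.map c.isoBot.hom ≫ y) (by
          rw [Category.assoc, hy, ← R.map_comp, isoBot_hom_comp]
          exact (Category.comp_id _).symm) fun j hj f' hf' ↦ by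
            obtain ⟨l, h₁, h₂⟩ := exists_lift_map_attachCells hR (c.attachCells j hj)
              (c.incl.app (Order.succ j)) (fun γ : c.Cells ↦ γ.ι)
              (fun i ↦ ⟨⟨j, hj, i⟩, 𝟙 _, Category.id_comp _⟩) r hr f'
              (hf'.trans ((Category.comp_id _).trans (R.congr_map (hn j _ (homOfLE (Order.le_succ j))).symm)))
            exact ⟨l, h₁, h₂.trans (Category.comp_id _).symm⟩
      exact ⟨l, hl⟩) (adj.homEquiv _ _ p)
  refine ⟨T, hT, fun M m _ h₁ h₂ ↦ ?_⟩
  have := exists_factorization_of_supportedBy adj hp (𝟙 Y) (Subobject.mk m)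
  simp only [Category.comp_id, subobject_mk_factors_iff] at this
  exact this h₁ h₂

/-- This is meant for attaching maps. Working in the initial segment up to `j` keeps the supporting
cells strictly below level `j`, which makes the closure process well-founded. -/
lemma exists_cells_of_map_free_stage (j : J) (p : F.obj A ⟶ c.F.obj j) :
    ∃ T : Set c.Cells, Cardinal.mk T ≤ κ ∧ (∀ γ ∈ T, γ.j < j) ∧
      ∀ M, ContainsCells c T j M → M.Factors (p ≫ c.incl.app j) := by
  let L := {γ : c.Cells // γ.j < j}
  let d (γ : L) : γ.1.i.1.right ⟶ c.F.obj j :=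
    cellMap c γ.1 ≫ c.F.map (homOfLE (Order.succ_le_of_lt γ.2))
  obtain ⟨T, hT, hp⟩ := exists_supportedBy I hI hA (R.map (c.F.map (homOfLE (bot_le : ⊥ ≤ j))))
    (fun γ : L ↦ R.map (d γ)) (fun E r hr y hy ↦ by
      let h := c.toTransfiniteCompositionOfShape.iic j
      have hF : (h.F ⋙ R).IsWellOrderContinuous :=
        ⟨fun m hm ↦ ⟨isColimitOfPreserves R (h.F.isColimitOfIsWellOrderContinuous m hm)⟩⟩
      obtain ⟨l, _, hl⟩ := exists_lift_of_steps (isColimitOfPreserves R h.isColimit) r (𝟙 _) y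
        (hy.trans (Category.comp_id _).symm) fun i hi f' hf' ↦ by
          have hij : i.1 < j := lt_of_le_of_ne i.2 fun h ↦ hi fun k _ ↦ by
            rw [← Subtype.coe_le_coe, h]
            exact k.2
          have hi' : ¬ IsMax i.1 := not_isMax_of_lt hij
          -- The successor in `Set.Iic j` agrees with the one in `J` only up to a propositional
          -- equality.
          have aux : ∀ (k : J) (hk : k = Order.succ i.1) (hkj : k ≤ j) (g : i.1 ⟶ k),
            ∃ l : R.obj (c.F.obj k) ⟶ E, R.map (c.F.map g) ≫ l = f' ∧
              l ≫ r = R.map (c.F.map (homOfLE hkj)) := by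
            rintro k rfl hkj g
            obtain ⟨l, h₁, h₂⟩ := exists_lift_map_attachCells hR (c.attachCells i.1 hi')
              (c.F.map (homOfLE hkj)) d
              (fun k ↦ ⟨⟨⟨i.1, hi', k⟩, hij⟩, 𝟙 _, Category.id_comp _⟩) r hr f'
              (hf'.trans ((Category.comp_id _).trans (R.congr_map (c.F.map_comp _ _))))
            exact ⟨l, h₁, h₂⟩
          obtain ⟨l, h₁, h₂⟩ := aux _ (Set.Iic.coe_succ_of_not_isMax hi) (Order.succ i).2
            (homOfLE (Order.le_succ i))
          exact ⟨l, h₁, h₂.trans (Category.comp_id _).symm⟩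
      exact ⟨l, hl⟩) (adj.homEquiv _ _ p)
  refine ⟨Subtype.val '' T, Cardinal.mk_image_le.trans hT, ?_, fun M hM ↦ ?_⟩
  · rintro _ ⟨γ, _, rfl⟩
    exact γ.2
  · have hn (j k : J) (g : j ⟶ k) : c.F.map g ≫ c.incl.app k = c.incl.app j :=
      (c.incl.naturality g).trans (Category.comp_id _)
    refine exists_factorization_of_supportedBy adj hp (c.incl.app j) M ?_ fun γ hγ ↦ ?_
    · rw [hn, ← isoBot_hom_comp]
      exact M.factors_of_factors_right _ hM.1
    · have : d γ ≫ c.incl.app j = γ.1.ι := (Category.assoc _ _ _).trans (_ ≫= hn _ _ _)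
      rw [this]
      exact hM.2 γ.1 (Set.mem_image_of_mem _ hγ) γ.2

end

/-- The union of closed sets of cells is closed. -/
lemma IsClosedCells.iUnion {ι : Sort*} {T : ι → Set c.Cells} (hT : ∀ i, IsClosedCells c (T i)) :
    IsClosedCells c (⋃ i, T i) := fun γ hγ M hM ↦ by
  obtain ⟨i, hi⟩ := Set.mem_iUnion.1 hγ
  exact hT i γ hi M ⟨hM.1, fun δ hδ ↦ hM.2 δ (Set.mem_iUnion_of_mem i hδ)⟩

section

variable {ev : ℕ → S ⥤ C} {F : ℕ → C ⥤ S}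

lemma freeMaps_iff {A B : S} (i : A ⟶ B) :
    freeMaps F I i ↔ ∃ n, I.strictMap (F n) i := by
  simp [freeMaps]

lemma exists_of_freeMaps {A B : S} {i : A ⟶ B} (hi : freeMaps F I i) :
    ∃ (n : ℕ) (A' B' : C) (i' : A' ⟶ B'), I i' ∧ A = (F n).obj A' ∧ B = (F n).obj B' := by
  obtain ⟨n, ⟨hi'⟩⟩ := (freeMaps_iff i).1 hi
  exact ⟨n, _, _, _, hi', rfl, rfl⟩

lemma freeMaps_map (n : ℕ) {A B : C} {i : A ⟶ B} (hi : I i) : freeMaps F I ((F n).map i) :=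
  (freeMaps_iff _).2 ⟨n, ⟨hi⟩⟩

variable [HasColimits C] [HasLimits C] [HasColimits S] [MorphismProperty.IsSmall.{v} I]
  (hI : ∀ ⦃A B : C⦄ (i : A ⟶ B), I i → IsSmallRelativeTo (relativeCellComplexes I) A)
  {κ : Cardinal.{v}} (hκ : Cardinal.aleph0 ≤ κ)
  (hI' : ∀ ⦃A B : C⦄ (i : A ⟶ B), I i → IsCompactRelativeToOfSize κ I A)
  (adj : ∀ n, F n ⊣ ev n) [∀ n, PreservesColimitsOfSize.{v, v} (ev n)]
  (hF : ∀ n, freeMaps F I ≤ I.rlp.llp.inverseImage (ev n))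

include hI hκ hI' adj hF

-- By induction on the level, the attaching map of a cell is supported by at most `κ` lower cells,
-- each contained in a small closed set. Their union together with the cell is closed, and its size
-- is bounded by `κ * κ + 1 ≤ κ` as `κ` is infinite.
omit [HasColimits S] in
lemma exists_isClosedCells_singleton (c : CellPresentation (freeMaps F I) J f) (γ : c.Cells) :
    ∃ T, IsClosedCells c T ∧ γ ∈ T ∧ Cardinal.mk T ≤ κ := by
  suffices ∀ j, ∀ γ : c.Cells, γ.j = j → ∃ T, IsClosedCells c T ∧ γ ∈ T ∧ Cardinal.mk T ≤ κ from
    this _ γ rfl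
  intro j
  induction j using WellFoundedLT.induction with
  | ind j ih =>
    rintro γ rfl
    obtain ⟨T₀, hT₀, h₁, h₂⟩ : ∃ T₀ : Set c.Cells, Cardinal.mk T₀ ≤ κ ∧ (∀ δ ∈ T₀, δ.j < γ.j) ∧
        ∀ M, ContainsCells c T₀ γ.j M → M.Factors (cellAttachingMap c γ ≫ c.incl.app γ.j) := by
      -- The domain of the cell is only propositionally equal to a free object, so the map is
      -- generalized before substituting.
      generalize cellAttachingMap c γ = a
      obtain ⟨n, A, _, i, hi, h, _⟩ := exists_of_freeMaps γ.i.2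
      change γ.i.1.left = _ at h
      generalize γ.i.1.left = A' at a h
      subst h
      exact exists_cells_of_map_free_stage hI (hI' i hi) (adj n) (hF n) γ.j a
    choose T hT hT' hT'' using fun δ : T₀ ↦ ih δ.1.j (h₁ _ δ.2) δ.1 rfl
    refine ⟨insert γ (⋃ δ, T δ), ?_, Set.mem_insert _ _, ?_⟩
    · intro δ hδ M hM
      obtain rfl | hδ := hδ
      · exact h₂ M ⟨hM.1, fun δ' hδ' ↦ hM.2 δ'
          (Set.mem_insert_of_mem _ (Set.mem_iUnion_of_mem ⟨δ', hδ'⟩ (hT' _)))⟩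
      · exact IsClosedCells.iUnion hT δ hδ M
          ⟨hM.1, fun δ' hδ' ↦ hM.2 δ' (Set.mem_insert_of_mem _ hδ')⟩
    · refine (Cardinal.mk_insert_le).trans (Cardinal.add_le_of_le hκ ?_ ?_)
      · exact (Cardinal.mk_iUnion_le _).trans (Cardinal.mul_le_of_le hκ hT₀
          (ciSup_le' hT''))
      · exact Cardinal.one_le_aleph0.trans hκ

/-- Free objects on compact objects are compact. -/
theorem isCompactRelativeToOfSize_free
    (hmono : ∀ ⦃A B : S⦄ (i : A ⟶ B), (freeMaps F I).rlp.llp i → Mono i) {n : ℕ} {A : C}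
    (hA : IsCompactRelativeToOfSize κ I A) :
    IsCompactRelativeToOfSize κ (freeMaps F I) ((F n).obj A) := by
  intro J _ _ _ _ X Y f c p
  -- Enlarge each of the at most `κ` supporting cells to a closed set of size at most `κ`; the union
  -- is the set of cells of the required subcomplex.
  obtain ⟨T₀, hT₀, hp⟩ := exists_cells_of_map_free (c := c) hI hA (adj n) (hF n) p
  choose T hT hT' hT'' using fun δ : T₀ ↦
    exists_isClosedCells_singleton hI hκ hI' adj hF c δ.1
  obtain ⟨S, hS, hS'⟩ := (IsClosedCells.iUnion hT).exists_subcomplex hmono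
  refine ⟨S, ?_, hS' p fun M m _ h₀ h₁ ↦
    hp m h₀ fun γ hγ ↦ h₁ γ (Set.mem_iUnion_of_mem ⟨γ, hγ⟩ (hT' _))⟩
  rw [hS]
  exact (Cardinal.mk_iUnion_le _).trans (Cardinal.mul_le_of_le hκ hT₀ (ciSup_le' hT''))

end

end Compactness


/-! ### Classes of maps determined by lifting in a model category -/

section ModelCategoryLemmas

variable {C : Type u} [Category.{v} C] [hF : CategoryWithFibrations C]
  [hC : CategoryWithCofibrations C] [hW : CategoryWithWeakEquivalences C]

section

variable [h : IsModelCategory C]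

include h

lemma isWeakFactorizationSystem_trivialCofibrations :
    MorphismProperty.IsWeakFactorizationSystem (trivialCofibrations C) (fibrations C) := by
  obtain ⟨M, rfl, rfl, rfl⟩ := h.exists_modelCategory
  infer_instance

lemma isWeakFactorizationSystem_cofibrations :
    MorphismProperty.IsWeakFactorizationSystem (cofibrations C) (trivialFibrations C) := by
  obtain ⟨M, rfl, rfl, rfl⟩ := h.exists_modelCategory
  infer_instance

lemma hasTwoOutOfThreeProperty_weakEquivalences :
    (weakEquivalences C).HasTwoOutOfThreeProperty := by
  obtain ⟨M, rfl, rfl, rfl⟩ := h.exists_modelCategory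
  infer_instance

lemma trivialFibrations_llp : (trivialFibrations C).llp = cofibrations C :=
  have := isWeakFactorizationSystem_cofibrations (C := C)
  MorphismProperty.llp_eq_of_wfs _ _

lemma fibrations_llp : (fibrations C).llp = trivialCofibrations C :=
  have := isWeakFactorizationSystem_trivialCofibrations (C := C)
  MorphismProperty.llp_eq_of_wfs _ _

lemma IsCofibrantlyGeneratedBy.cofibrations_eq {I J : MorphismProperty C}
    (H : IsCofibrantlyGeneratedBy I J) : cofibrations C = I.rlp.llp := by
  rw [← H.trivialFibrations_eq, trivialFibrations_llp]

lemma IsCofibrantlyGeneratedBy.trivialCofibrations_eq {I J : MorphismProperty C}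
    (H : IsCofibrantlyGeneratedBy I J) : trivialCofibrations C = J.rlp.llp := by
  rw [← H.fibrations_eq, fibrations_llp]

end

end ModelCategoryLemmas

/-! ### Effective monomorphisms -/

section EffectiveMono

variable {C : Type u} [Category.{v} C]

lemma IsEffectiveMono.exists_lift {X Y : C} {f : X ⟶ Y} (hf : IsEffectiveMono f) {P : C}
    {inl inr : Y ⟶ P} (h : IsPushout f f inl inr) {Z : C} (g : Z ⟶ Y) (hg : g ≫ inl = g ≫ inr) :
    ∃ l : Z ⟶ X, l ≫ f = g := by
  obtain ⟨P', inl', inr', h', ⟨H⟩⟩ := hf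
  refine ⟨Fork.IsLimit.lift H g ?_, Fork.IsLimit.lift_ι' _ _ _⟩
  rw [← h.inl_desc inl' inr' h'.w, ← Category.assoc, hg, Category.assoc, h.inr_desc]

lemma IsEffectiveMono.mono {X Y : C} {f : X ⟶ Y} (hf : IsEffectiveMono f) : Mono f := by
  obtain ⟨P', inl', inr', h', ⟨H⟩⟩ := hf
  exact mono_of_isLimit_fork H

lemma IsEffectiveMono.isLimit {X Y : C} {f : X ⟶ Y} (hf : IsEffectiveMono f) {P : C}
    {inl inr : Y ⟶ P} (h : IsPushout f f inl inr) : Nonempty (IsLimit (Fork.ofι f h.w)) := by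
  have := hf.mono
  choose l hl using fun (s : Fork inl inr) ↦ hf.exists_lift h s.ι s.condition
  exact ⟨Fork.IsLimit.mk _ l hl fun s m hm ↦ by
    rw [← cancel_mono f]
    exact hm.trans (hl s).symm⟩

/-- Effective monomorphisms are detected by a jointly conservative family of functors. -/
lemma isEffectiveMono_of_levelwise {S : Type u'} [Category.{v} S] [HasLimits S] [HasColimits S]
    {ι : Type*} (ev : ι → S ⥤ C) [∀ n, PreservesColimitsOfSize.{v, v} (ev n)]
    [∀ n, PreservesLimitsOfSize.{v, v} (ev n)]
    (hev : ∀ ⦃X Y : S⦄ (f : X ⟶ Y), (∀ n, IsIso ((ev n).map f)) → IsIso f)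
    {X Y : S} {f : X ⟶ Y} (hf : ∀ n, IsEffectiveMono ((ev n).map f)) : IsEffectiveMono f := by
  have h := IsPushout.of_hasPushout f f
  let inl := pushout.inl f f
  let inr := pushout.inr f f
  let e : X ⟶ equalizer inl inr := equalizer.lift f h.w
  have he : e ≫ equalizer.ι inl inr = f := equalizer.lift_ι _ _
  -- Evaluation preserves the pushout and the equalizer, so `e` becomes the comparison of two
  -- equalizers of the same pair.
  have : IsIso e := hev _ fun n ↦ by
    obtain ⟨H⟩ := (hf n).isLimit (h.map (ev n))
    have H' := isLimitForkMapOfIsLimit (ev n) _ (equalizerIsEqualizer inl inr)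
    have : (ev n).map e = (H.conePointUniqueUpToIso H').hom := by
      refine Fork.IsLimit.hom_ext H' ?_
      refine Eq.trans ?_ (H.conePointUniqueUpToIso_hom_comp H' WalkingParallelPair.zero).symm
      exact ((ev n).map_comp _ _).symm.trans ((ev n).congr_map he)
    rw [this]
    infer_instance
  exact ⟨_, inl, inr, h, ⟨(equalizerIsEqualizer inl inr).ofIsoLimit
    (Fork.ext (asIso e) he).symm⟩⟩

end EffectiveMono

/-! ### Functors that respect generated cofibrations -/

section SmallObject

variable {C : Type u} [Category.{v} C] {S : Type u'} [Category.{v} S]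

/-- By the small object argument, the maps on the left are retracts of cell complexes on `K`. `R`
preserves the colimits and retracts involved, and `P.rlp.llp` is closed under these operations. -/
lemma rlp_llp_le_inverseImage [HasColimits S] {K : MorphismProperty S} {P : MorphismProperty C}
    {R : S ⥤ C} [PreservesColimitsOfSize.{v, v} R]
    [MorphismProperty.HasSmallObjectArgument.{v} K] (h : K ≤ P.rlp.llp.inverseImage R) :
    K.rlp.llp ≤ P.rlp.llp.inverseImage R := by
  rw [MorphismProperty.llp_rlp_of_hasSmallObjectArgument.{v}]
  have h₀ : (MorphismProperty.coproducts.{v} P.rlp.llp).pushouts ≤ P.rlp.llp := by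
    rw [MorphismProperty.le_llp_iff_le_rlp, MorphismProperty.rlp_pushouts,
      MorphismProperty.rlp_coproducts, MorphismProperty.rlp_llp_rlp]
  have h₁ : (MorphismProperty.coproducts.{v} K).pushouts ≤ P.rlp.llp.inverseImage R :=
    (pushouts_coproducts_le_inverseImage R h).trans (MorphismProperty.monotone_inverseImage R h₀)
  have h₂ : MorphismProperty.transfiniteCompositions.{v}
      (MorphismProperty.coproducts.{v} K).pushouts ≤ P.rlp.llp.inverseImage R := by
    intro X Y f hf
    rw [MorphismProperty.transfiniteCompositions_iff] at hf
    obtain ⟨J, _, _, _, _, ⟨hf⟩⟩ := hf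
    have := preservesWellOrderContinuousOfShape R J
    exact P.rlp.llp.transfiniteCompositionsOfShape_le J _ ((hf.ofLE h₁).map).mem
  rw [MorphismProperty.retracts_le_iff]
  exact h₂

end SmallObject


/-! ### The projective model structure from evaluation functors -/

lemma relativeCellComplexes_le {C : Type u} [Category.{v} C] (I : MorphismProperty C) :
    relativeCellComplexes I ≤ I.rlp.llp := by
  intro X Y f hf
  rw [relativeCellComplexes, MorphismProperty.transfiniteCompositions_iff] at hf
  obtain ⟨J, _, _, _, _, hf⟩ := hf
  exact MorphismProperty.transfiniteCompositionsOfShape_pushouts_coproducts_le_llp_rlp I J _ hf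

/-- A bicomplete category with a family of evaluation functors which preserve limits and colimits,
are jointly conservative and have left adjoints, whose composites with the evaluation functors
preserve cofibrations and trivial cofibrations, and with the projective classes of maps. -/
structure IsProjective {C : Type u} [Category.{v} C] [CategoryWithFibrations C]
    [CategoryWithCofibrations C] [CategoryWithWeakEquivalences C] {S : Type u'} [Category.{v} S]
    [CategoryWithFibrations S] [CategoryWithCofibrations S] [CategoryWithWeakEquivalences S]
    (ev : ℕ → S ⥤ C) : Prop where
  hasLimits : HasLimits S
  hasColimits : HasColimits S
  preservesColimits (n : ℕ) : PreservesColimitsOfSize.{v, v} (ev n)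
  isIso ⦃X Y : S⦄ (f : X ⟶ Y) : (∀ n, IsIso ((ev n).map f)) → IsIso f
  fibrations_eq : fibrations S = levelwise ev (fibrations C)
  weakEquivalences_eq : weakEquivalences S = levelwise ev (weakEquivalences C)
  cofibrations_eq : cofibrations S = (levelwise ev (trivialFibrations C)).llp
  exists_leftAdjoint (n : ℕ) : ∃ F : C ⥤ S, Nonempty (F ⊣ ev n) ∧ ∀ m, ∀ ⦃A B : C⦄ (i : A ⟶ B),
    (cofibrations C i → cofibrations C ((ev m).map (F.map i))) ∧
    (trivialCofibrations C i → trivialCofibrations C ((ev m).map (F.map i)))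

namespace IsProjective

variable {C : Type u} [Category.{v} C] [CategoryWithFibrations C]
    [CategoryWithCofibrations C] [CategoryWithWeakEquivalences C] {S : Type u'} [Category.{v} S]
    [CategoryWithFibrations S] [CategoryWithCofibrations S] [CategoryWithWeakEquivalences S]
    {ev : ℕ → S ⥤ C} (H : IsProjective ev)

include H

lemma isRightAdjoint (n : ℕ) : (ev n).IsRightAdjoint := by
  obtain ⟨F, ⟨adj⟩, _⟩ := H.exists_leftAdjoint n
  exact adj.isRightAdjoint

lemma trivialFibrations_eq : trivialFibrations S = levelwise ev (trivialFibrations C) := by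
  ext X Y f
  change fibrations S f ∧ weakEquivalences S f ↔
    ∀ n, fibrations C ((ev n).map f) ∧ weakEquivalences C ((ev n).map f)
  rw [H.fibrations_eq, H.weakEquivalences_eq, forall_and]
  rfl

variable {F : ℕ → C ⥤ S} (adj : ∀ n, F n ⊣ ev n)

include adj

-- Left adjoints are unique up to isomorphism, so what is known for one choice of free functor holds
-- for every choice.
omit [CategoryWithFibrations C] [CategoryWithCofibrations C] [CategoryWithWeakEquivalences C]
  [CategoryWithFibrations S] [CategoryWithCofibrations S] [CategoryWithWeakEquivalences S] H in
lemma map_free_iff (P : MorphismProperty C) [P.RespectsIso] (n m : ℕ) {F' : C ⥤ S}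
    (adj' : F' ⊣ ev n) {A B : C} (i : A ⟶ B) :
    P ((ev m).map ((F n).map i)) ↔ P ((ev m).map (F'.map i)) := by
  let e := Functor.isoWhiskerRight ((adj n).leftAdjointUniq adj') (ev m)
  exact P.arrow_mk_iso_iff (Arrow.isoMk (e.app A) (e.app B) (e.hom.naturality i).symm)

omit [CategoryWithFibrations C] [CategoryWithCofibrations C] [CategoryWithWeakEquivalences C]
  [CategoryWithFibrations S] [CategoryWithCofibrations S] [CategoryWithWeakEquivalences S] H in
lemma rlp_freeMaps (P : MorphismProperty C) : (freeMaps F P).rlp = levelwise ev P.rlp := by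
  ext X Y p
  constructor
  · intro hp n A B i hi
    exact ((adj n).hasLiftingProperty_iff i p).1 (hp _ (freeMaps_map n hi))
  · intro hp A B i hi
    rw [freeMaps_iff] at hi
    obtain ⟨n, ⟨hi⟩⟩ := hi
    exact ((adj n).hasLiftingProperty_iff _ p).2 (hp n _ hi)

variable [IsModelCategory C]

lemma map_free_cofibrations (n m : ℕ) {A B : C} (i : A ⟶ B) (hi : cofibrations C i) :
    cofibrations C ((ev m).map ((F n).map i)) := by
  obtain ⟨F', ⟨adj'⟩, h⟩ := H.exists_leftAdjoint n
  have : (cofibrations C).RespectsIso := by rw [← trivialFibrations_llp]; infer_instance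
  exact (map_free_iff adj _ n m adj' i).2 ((h m i).1 hi)

lemma map_free_trivialCofibrations (n m : ℕ) {A B : C} (i : A ⟶ B)
    (hi : trivialCofibrations C i) : trivialCofibrations C ((ev m).map ((F n).map i)) := by
  obtain ⟨F', ⟨adj'⟩, h⟩ := H.exists_leftAdjoint n
  have : (trivialCofibrations C).RespectsIso := by rw [← fibrations_llp]; infer_instance
  exact (map_free_iff adj _ n m adj' i).2 ((h m i).2 hi)

variable {I J : MorphismProperty C}

section

variable (hIJ : IsCofibrantlyGeneratedBy I J)

include hIJ

omit [IsModelCategory C] in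
lemma fibrations_eq_rlp : fibrations S = (freeMaps F J).rlp := by
  rw [H.fibrations_eq, rlp_freeMaps adj, hIJ.fibrations_eq]

omit [IsModelCategory C] in
lemma trivialFibrations_eq_rlp : trivialFibrations S = (freeMaps F I).rlp := by
  rw [H.trivialFibrations_eq, rlp_freeMaps adj, hIJ.trivialFibrations_eq]

omit [IsModelCategory C] in
lemma cofibrations_eq_llp : cofibrations S = (freeMaps F I).rlp.llp := by
  rw [H.cofibrations_eq, rlp_freeMaps adj, hIJ.trivialFibrations_eq]

lemma freeMaps_le_cofibrations (m : ℕ) : freeMaps F I ≤ I.rlp.llp.inverseImage (ev m) := by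
  intro A B i hi
  rw [freeMaps_iff] at hi
  obtain ⟨n, ⟨hi⟩⟩ := hi
  rw [← hIJ.cofibrations_eq]
  refine H.map_free_cofibrations adj n m _ ?_
  rw [hIJ.cofibrations_eq]
  exact MorphismProperty.le_llp_rlp _ _ hi

lemma freeMaps_le_trivialCofibrations (m : ℕ) :
    freeMaps F J ≤ J.rlp.llp.inverseImage (ev m) := by
  intro A B i hi
  rw [freeMaps_iff] at hi
  obtain ⟨n, ⟨hi⟩⟩ := hi
  rw [← hIJ.trivialCofibrations_eq]
  refine H.map_free_trivialCofibrations adj n m _ ?_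
  rw [hIJ.trivialCofibrations_eq]
  exact MorphismProperty.le_llp_rlp _ _ hi

end

-- Smallness relative to `I`-cell complexes would not be enough for spectra: evaluating a free cell
-- complex yields only a transfinite composition of cofibrations.
omit H adj in
lemma _root_.StableModel.IsCellularBy.small_cofibrations_domain (hIJ : IsCellularBy I J)
    ⦃A B : C⦄ (i : A ⟶ B) (hi : I i) : IsSmallRelativeTo (cofibrations C) A := by
  have := hIJ.isSmall_I
  have h := hIJ.toIsCofibrantlyGeneratedBy.cofibrations_eq
  rw [h]
  exact (hIJ.compact_domain i hi).isSmallRelativeTo hIJ.small_I fun _ _ i hi ↦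
    (hIJ.effectiveMono i (h ▸ hi)).mono

omit [CategoryWithFibrations C] [CategoryWithWeakEquivalences C] [CategoryWithFibrations S]
  [CategoryWithCofibrations S] [CategoryWithWeakEquivalences S] [IsModelCategory C] H in
lemma isSmallRelativeTo_free {n : ℕ} {A : C} [∀ n, PreservesColimitsOfSize.{v, v} (ev n)]
    (hA : IsSmallRelativeTo (cofibrations C) A) {W : MorphismProperty S}
    (hW : W ≤ (cofibrations C).inverseImage (ev n)) : IsSmallRelativeTo W ((F n).obj A) :=
  (isSmallRelativeTo_of_adjunction (adj n) hA).mono hW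

omit H adj in
instance isSmall_freeMaps (F : ℕ → C ⥤ S) (I : MorphismProperty C)
    [MorphismProperty.IsSmall.{v} I] : MorphismProperty.IsSmall.{v} (freeMaps F I) := by
  have (n : ℕ) : MorphismProperty.IsSmall.{v} (I.strictMap (F n)) := by
    obtain ⟨ι, A, B, f, rfl⟩ := (MorphismProperty.isSmall_iff_eq_ofHoms.{v} I).1 inferInstance
    rw [MorphismProperty.isSmall_iff_eq_ofHoms]
    refine ⟨ι, _, _, fun i ↦ (F n).map (f i), ?_⟩
    ext X Y g
    constructor
    · rintro ⟨⟨i⟩⟩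
      exact ⟨i⟩
    · rintro ⟨i⟩
      exact ⟨⟨i⟩⟩
  exact MorphismProperty.isSmall_iSup _

section

variable (hIJ : IsCellularBy I J)

include hIJ

lemma hasSmallObjectArgument_cofibrations :
    MorphismProperty.HasSmallObjectArgument.{v} (freeMaps F I) := by
  have := H.hasColimits
  have := H.preservesColimits
  have := hIJ.isSmall_I
  refine hasSmallObjectArgument_of_isSmallRelativeTo _ fun A B i hi ↦ ?_
  rw [freeMaps_iff] at hi
  obtain ⟨n, ⟨hi⟩⟩ := hi
  refine isSmallRelativeTo_free adj (hIJ.small_cofibrations_domain _ hi) ?_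
  refine (pushouts_coproducts_le_inverseImage (ev n)
    (H.freeMaps_le_cofibrations adj hIJ.toIsCofibrantlyGeneratedBy n)).trans
    (MorphismProperty.monotone_inverseImage _ ?_)
  rw [hIJ.toIsCofibrantlyGeneratedBy.cofibrations_eq, MorphismProperty.le_llp_iff_le_rlp,
    MorphismProperty.rlp_pushouts, MorphismProperty.rlp_coproducts, MorphismProperty.rlp_llp_rlp]

lemma hasSmallObjectArgument_trivialCofibrations :
    MorphismProperty.HasSmallObjectArgument.{v} (freeMaps F J) := by
  have := H.hasColimits
  have := H.preservesColimits
  have := hIJ.isSmall_J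
  refine hasSmallObjectArgument_of_isSmallRelativeTo _ fun A B i hi ↦ ?_
  rw [freeMaps_iff] at hi
  obtain ⟨n, ⟨hi⟩⟩ := hi
  refine isSmallRelativeTo_free adj (hIJ.small_cofibrations _ hi) ?_
  refine (pushouts_coproducts_le_inverseImage (ev n)
    (H.freeMaps_le_trivialCofibrations adj hIJ.toIsCofibrantlyGeneratedBy n)).trans
    (MorphismProperty.monotone_inverseImage _ ?_)
  have : trivialCofibrations C ≤ cofibrations C := fun _ _ _ h ↦ h.1
  refine le_trans ?_ this
  rw [hIJ.toIsCofibrantlyGeneratedBy.trivialCofibrations_eq, MorphismProperty.le_llp_iff_le_rlp,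
    MorphismProperty.rlp_pushouts, MorphismProperty.rlp_coproducts, MorphismProperty.rlp_llp_rlp]

lemma cofibrations_le (m : ℕ) : cofibrations S ≤ (cofibrations C).inverseImage (ev m) := by
  have := H.hasColimits
  have := H.preservesColimits
  have := H.hasSmallObjectArgument_cofibrations adj hIJ
  rw [H.cofibrations_eq_llp adj hIJ.toIsCofibrantlyGeneratedBy,
    hIJ.toIsCofibrantlyGeneratedBy.cofibrations_eq]
  exact rlp_llp_le_inverseImage (H.freeMaps_le_cofibrations adj hIJ.toIsCofibrantlyGeneratedBy m)

lemma rlp_llp_le_trivialCofibrations (m : ℕ) :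
    (freeMaps F J).rlp.llp ≤ (trivialCofibrations C).inverseImage (ev m) := by
  have := H.hasColimits
  have := H.preservesColimits
  have := H.hasSmallObjectArgument_trivialCofibrations adj hIJ
  rw [hIJ.toIsCofibrantlyGeneratedBy.trivialCofibrations_eq]
  exact rlp_llp_le_inverseImage
    (H.freeMaps_le_trivialCofibrations adj hIJ.toIsCofibrantlyGeneratedBy m)

omit adj hIJ in
lemma hasTwoOutOfThreeProperty : (weakEquivalences S).HasTwoOutOfThreeProperty := by
  have := hasTwoOutOfThreeProperty_weakEquivalences (C := C)
  rw [H.weakEquivalences_eq]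
  exact
    { comp_mem := fun f g hf hg n ↦ by
        rw [Functor.map_comp]
        exact MorphismProperty.comp_mem _ _ _ (hf n) (hg n)
      of_postcomp := fun f g hf hg n ↦ MorphismProperty.of_postcomp _ _ _ (hf n) (by
        rw [← Functor.map_comp]
        exact hg n)
      of_precomp := fun f g hf hg n ↦ MorphismProperty.of_precomp _ _ _ (hf n) (by
        rw [← Functor.map_comp]
        exact hg n) }

/-- Maps generated by `F n J` are level equivalences because evaluation takes them to trivial
cofibrations. Conversely, factor a trivial cofibration through such a map; the second factor is a
trivial fibration by two-out-of-three, and the retract argument applies. -/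
lemma trivialCofibrations_eq_llp : trivialCofibrations S = (freeMaps F J).rlp.llp := by
  have := H.hasColimits
  have := H.hasSmallObjectArgument_trivialCofibrations adj hIJ
  have := H.hasTwoOutOfThreeProperty
  have hle : (freeMaps F J).rlp.llp ≤ trivialCofibrations S := by
    intro A B i hi
    constructor
    · rw [H.cofibrations_eq_llp adj hIJ.toIsCofibrantlyGeneratedBy,
        ← H.trivialFibrations_eq_rlp adj hIJ.toIsCofibrantlyGeneratedBy]
      rw [← H.fibrations_eq_rlp adj hIJ.toIsCofibrantlyGeneratedBy] at hi
      exact fun X Y p hp ↦ hi p hp.1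
    · rw [H.weakEquivalences_eq]
      exact fun n ↦ (H.rlp_llp_le_trivialCofibrations adj hIJ n _ hi).2
  refine le_antisymm (fun A B i hi ↦ ?_) hle
  have h := MorphismProperty.factorizationData (freeMaps F J).rlp.llp (freeMaps F J).rlp i
  have hp : trivialFibrations S h.p := by
    refine ⟨?_, ?_⟩
    · rw [H.fibrations_eq_rlp adj hIJ.toIsCofibrantlyGeneratedBy]
      exact h.hp
    · refine MorphismProperty.of_precomp _ h.i h.p (hle _ h.hi).2 ?_
      rw [h.fac]
      exact hi.2
  rw [H.trivialFibrations_eq] at hp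
  have : HasLiftingProperty i h.p := by
    have := hi.1
    rw [H.cofibrations_eq] at this
    exact this _ hp
  exact MorphismProperty.of_retract (RetractArrow.ofLeftLiftingProperty h.fac) h.hi

lemma isModelCategory : IsModelCategory S := by
  have := H.hasLimits
  have := H.hasColimits
  have := H.hasSmallObjectArgument_cofibrations adj hIJ
  have := H.hasSmallObjectArgument_trivialCofibrations adj hIJ
  have := H.hasTwoOutOfThreeProperty
  have h₁ := H.cofibrations_eq_llp adj hIJ.toIsCofibrantlyGeneratedBy
  have h₂ := H.trivialFibrations_eq_rlp adj hIJ.toIsCofibrantlyGeneratedBy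
  have h₃ := H.trivialCofibrations_eq_llp adj hIJ
  have h₄ := H.fibrations_eq_rlp adj hIJ.toIsCofibrantlyGeneratedBy
  have f₁ : MorphismProperty.HasFunctorialFactorization
      (trivialCofibrations S) (fibrations S) := by
    rw [h₃, h₄]; infer_instance
  have f₂ : MorphismProperty.HasFunctorialFactorization
      (cofibrations S) (trivialFibrations S) := by
    rw [h₁, h₂]; infer_instance
  have w₁ : MorphismProperty.IsWeakFactorizationSystem
      (trivialCofibrations S) (fibrations S) :=
    ⟨by rw [h₃, h₄, MorphismProperty.rlp_llp_rlp], by rw [h₃, h₄], inferInstance⟩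
  have w₂ : MorphismProperty.IsWeakFactorizationSystem
      (cofibrations S) (trivialFibrations S) :=
    ⟨by rw [h₁, h₂, MorphismProperty.rlp_llp_rlp], by rw [h₁, h₂], inferInstance⟩
  exact ⟨inferInstance, inferInstance, ⟨ModelCategory.mk' S, rfl, rfl, rfl⟩, f₁, f₂⟩

lemma isLeftProper (hC : IsLeftProper C) : IsLeftProper S := by
  have := H.preservesColimits
  intro A B X P w i i' w' sq hw hi
  rw [H.weakEquivalences_eq] at hw ⊢
  exact fun n ↦ hC _ _ _ _ (sq.map (ev n)) (hw n) (H.cofibrations_le adj hIJ n _ hi)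

lemma effectiveMono ⦃A B : S⦄ (f : A ⟶ B) (hf : cofibrations S f) : IsEffectiveMono f := by
  have := H.hasLimits
  have := H.hasColimits
  have := H.preservesColimits
  have (n : ℕ) : PreservesLimitsOfSize.{v, v} (ev n) := (adj n).rightAdjoint_preservesLimits
  exact isEffectiveMono_of_levelwise ev H.isIso fun n ↦
    hIJ.effectiveMono _ (H.cofibrations_le adj hIJ n _ hf)

theorem isCellularBy : IsCellularBy (freeMaps F I) (freeMaps F J) := by
  have := H.hasLimits
  have := H.hasColimits
  have := H.preservesColimits
  have hI := hIJ.isSmall_I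
  have hJ := hIJ.isSmall_J
  have hc := H.cofibrations_eq_llp adj hIJ.toIsCofibrantlyGeneratedBy
  have hcell : relativeCellComplexes (freeMaps F I) ≤ cofibrations S := by
    rw [hc]
    exact relativeCellComplexes_le _
  have hcell' : relativeCellComplexes (freeMaps F J) ≤ cofibrations S := by
    have : trivialCofibrations S ≤ cofibrations S := fun _ _ _ h ↦ h.1
    refine le_trans ?_ this
    rw [H.trivialCofibrations_eq_llp adj hIJ]
    exact relativeCellComplexes_le _
  have hmono ⦃A B : S⦄ (i : A ⟶ B) (hi : (freeMaps F I).rlp.llp i) : Mono i :=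
    (H.effectiveMono adj hIJ i (hc ▸ hi)).mono
  have mono (κ κ' : Cardinal.{v}) (h : κ ≤ κ') (A : C) (hA : IsCompactRelativeToOfSize κ I A) :
      IsCompactRelativeToOfSize κ' I A := fun J _ _ _ _ X Y f c p ↦ by
    obtain ⟨S, hS, hS'⟩ := hA J f c p
    exact ⟨S, hS.trans h, hS'⟩
  obtain ⟨κ₀, hκ₀⟩ := exists_cardinal_forall_of_isSmall I
    (fun κ A _ _ ↦ IsCompactRelativeToOfSize κ I A) (fun κ κ' h A _ _ ↦ mono κ κ' h A)
    hIJ.compact_domain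
  have compact {n : ℕ} {A : C} (hA : IsCompactRelativeTo I A) :
      IsCompactRelativeTo (freeMaps F I) ((F n).obj A) := by
    obtain ⟨κ₁, hκ₁⟩ := hA
    -- `κ₁` serves the given object, `κ₀` serves the domains of all cells that enter the closure,
    -- and `ℵ₀` keeps unions of `κ` sets of size `κ` within `κ`.
    let κ := max (max κ₀ κ₁) Cardinal.aleph0
    exact ⟨κ, isCompactRelativeToOfSize_free hIJ.small_I (le_max_right _ _)
      (fun A B i hi ↦ mono _ κ (by simp [κ]) A (hκ₀ i hi)) adj
      (H.freeMaps_le_cofibrations adj hIJ.toIsCofibrantlyGeneratedBy) hmono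
      (mono _ κ (by simp [κ]) A hκ₁)⟩
  exact
    { isSmall_I := inferInstance
      isSmall_J := inferInstance
      small_I := fun A B i hi ↦ by
        rw [freeMaps_iff] at hi
        obtain ⟨n, ⟨hi⟩⟩ := hi
        exact isSmallRelativeTo_free adj (hIJ.small_cofibrations_domain _ hi)
          (hcell.trans (H.cofibrations_le adj hIJ n))
      small_J := fun A B i hi ↦ by
        rw [freeMaps_iff] at hi
        obtain ⟨n, ⟨hi⟩⟩ := hi
        exact isSmallRelativeTo_free adj (hIJ.small_cofibrations _ hi)
          (hcell'.trans (H.cofibrations_le adj hIJ n))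
      fibrations_eq := H.fibrations_eq_rlp adj hIJ.toIsCofibrantlyGeneratedBy
      trivialFibrations_eq := H.trivialFibrations_eq_rlp adj hIJ.toIsCofibrantlyGeneratedBy
      compact_domain := fun A B i hi ↦ by
        rw [freeMaps_iff] at hi
        obtain ⟨n, ⟨hi⟩⟩ := hi
        exact compact (hIJ.compact_domain _ hi)
      compact_codomain := fun A B i hi ↦ by
        rw [freeMaps_iff] at hi
        obtain ⟨n, ⟨hi⟩⟩ := hi
        exact compact (hIJ.compact_codomain _ hi)
      small_cofibrations := fun A B i hi ↦ by
        rw [freeMaps_iff] at hi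
        obtain ⟨n, ⟨hi⟩⟩ := hi
        exact isSmallRelativeTo_free adj (hIJ.small_cofibrations _ hi)
          (H.cofibrations_le adj hIJ n)
      effectiveMono := H.effectiveMono adj hIJ }

end

omit adj in
theorem main (hproper : IsLeftProper C) (hcell : IsCellular C) :
    IsModelCategory S ∧ IsLeftProper S ∧ IsCellular S ∧ (∀ n, (ev n).IsRightAdjoint) ∧
      ∀ F : ℕ → C ⥤ S, (∀ n, Nonempty (F n ⊣ ev n)) →
        ∀ I J : MorphismProperty C, IsCellularBy I J →
          IsCellularBy (freeMaps F I) (freeMaps F J) := by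
  obtain ⟨I, J, hIJ⟩ := hcell
  choose F hF _ using H.exists_leftAdjoint
  exact ⟨H.isModelCategory (fun n ↦ (hF n).some) hIJ,
    H.isLeftProper (fun n ↦ (hF n).some) hIJ hproper,
    ⟨_, _, H.isCellularBy (fun n ↦ (hF n).some) hIJ⟩, H.isRightAdjoint,
    fun F hF I J hIJ ↦ H.isCellularBy (fun n ↦ (hF n).some) hIJ⟩

end IsProjective


/-! ### A common framework for spectra with group actions -/

/-- The data which determine a category of spectra: an endofunctor `T` with an endomorphism `t` of
its square, and a sequence of groups with elements `s n` of `Γ (n + 2)`. -/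
structure SpectrumShape (C : Type u) [Category.{v} C] where
  T : C ⥤ C
  t : T ⋙ T ⟶ T ⋙ T
  Γ : ℕ → Type
  [group (n : ℕ) : Group (Γ n)]
  ι (n : ℕ) : Γ n →* Γ (n + 1)
  s (n : ℕ) : Γ (n + 2)

attribute [instance] SpectrumShape.group

variable {C : Type u} [Category.{v} C]

/-- Spectra with actions of the groups `Γ n`, such that `s n` acts by `t` on double structure
maps. -/
structure ShapedSpectrum (P : SpectrumShape C) where
  X : ℕ → C
  ρ (n : ℕ) : P.Γ n →* End (X n)
  σ (n : ℕ) : P.T.obj (X n) ⟶ X (n + 1)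
  σ_equivariant (n : ℕ) (g : P.Γ n) :
    P.T.map (ρ n g : X n ⟶ X n) ≫ σ n = σ n ≫ ρ (n + 1) (P.ι n g)
  braid (n : ℕ) : P.t.app (X n) ≫ P.T.map (σ n) ≫ σ (n + 1) =
    P.T.map (σ n) ≫ σ (n + 1) ≫ ρ (n + 2) (P.s n)

namespace ShapedSpectrum

variable {P : SpectrumShape C}

/-- Maps of spectra. -/
@[ext]
structure Hom (X Y : ShapedSpectrum P) where
  hom (n : ℕ) : X.X n ⟶ Y.X n
  equivariant (n : ℕ) (g : P.Γ n) : X.ρ n g ≫ hom n = hom n ≫ Y.ρ n g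
  comm (n : ℕ) : X.σ n ≫ hom (n + 1) = P.T.map (hom n) ≫ Y.σ n

instance : Category (ShapedSpectrum P) where
  Hom := Hom
  id X :=
    { hom := fun n ↦ 𝟙 (X.X n)
      equivariant := fun n g ↦ (Category.comp_id _).trans (Category.id_comp _).symm
      comm := by simp }
  comp f g :=
    { hom := fun n ↦ f.hom n ≫ g.hom n
      equivariant := fun n a ↦ by
        rw [← Category.assoc, f.equivariant, Category.assoc, g.equivariant, Category.assoc]
      comm := fun n ↦ by
        rw [← Category.assoc, f.comm, Category.assoc, g.comm, P.T.map_comp, Category.assoc] }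
  id_comp f := Hom.ext (funext fun n ↦ Category.id_comp (f.hom n))
  comp_id f := Hom.ext (funext fun n ↦ Category.comp_id (f.hom n))
  assoc f g h := Hom.ext (funext fun n ↦ Category.assoc (f.hom n) (g.hom n) (h.hom n))

lemma hom_ext {X Y : ShapedSpectrum P} {f g : X ⟶ Y} (h : ∀ n, f.hom n = g.hom n) : f = g :=
  Hom.ext (funext h)

variable (P) in
/-- Evaluation at `n`. -/
def ev (n : ℕ) : ShapedSpectrum P ⥤ C where
  obj X := X.X n
  map f := f.hom n

lemma isIso_of_isIso_hom {X Y : ShapedSpectrum P} (f : X ⟶ Y) (hf : ∀ n, IsIso (f.hom n)) :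
    IsIso f := by
  let g : Y ⟶ X :=
    { hom := fun n ↦ inv (f.hom n)
      equivariant := fun n g ↦ by
        rw [IsIso.eq_inv_comp, ← Category.assoc, IsIso.comp_inv_eq, f.equivariant]
      comm := fun n ↦ by
        rw [Functor.map_inv, IsIso.eq_inv_comp, ← Category.assoc, IsIso.comp_inv_eq, f.comm] }
  exact ⟨g, hom_ext fun n ↦ IsIso.hom_inv_id _, hom_ext fun n ↦ IsIso.inv_hom_id _⟩

/-! ### Levelwise limits and colimits of spectra -/

section Limits

variable {K : Type v} [SmallCategory K] (D : K ⥤ ShapedSpectrum P)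

/-- The diagram in level `n`. -/
abbrev level (n : ℕ) : K ⥤ C where
  obj j := (D.obj j).X n
  map f := (D.map f).hom n

/-- A cone at level `n`. -/
abbrev levelCone (s : Cone D) (n : ℕ) : Cone (level D n) where
  pt := s.pt.X n
  π :=
    { app := fun j ↦ (s.π.app j).hom n
      naturality := fun _ _ f ↦ congrArg (fun x ↦ Hom.hom x n) (s.π.naturality f) }

/-- A cocone at level `n`. -/
abbrev levelCocone (s : Cocone D) (n : ℕ) : Cocone (level D n) where
  pt := s.pt.X n
  ι :=
    { app := fun j ↦ (s.ι.app j).hom n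
      naturality := fun _ _ f ↦ congrArg (fun x ↦ Hom.hom x n) (s.ι.naturality f) }

/-- The action of `g` on the diagram in level `n`. -/
abbrev levelρ (n : ℕ) (g : P.Γ n) : level D n ⟶ level D n where
  app j := (D.obj j).ρ n g
  naturality _ _ f := ((D.map f).equivariant n g).symm

section

variable [HasLimits C]

/-- The action on the levelwise limit. -/
noncomputable def limitρ (n : ℕ) : P.Γ n →* End (limit (level D n)) where
  toFun g := limMap (levelρ D n g)
  map_one' := limit.hom_ext fun j ↦ by
    rw [limMap_π]
    dsimp only
    rw [map_one]
    exact (Category.comp_id _).trans (Category.id_comp _).symm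
  map_mul' g h := limit.hom_ext fun j ↦ by
    rw [End.mul_def, limMap_π, Category.assoc, limMap_π, limMap_π_assoc]
    dsimp only
    rw [map_mul]
    rfl

lemma limitρ_π (n : ℕ) (g : P.Γ n) (j : K) :
    (limitρ D n g : limit (level D n) ⟶ limit (level D n)) ≫ limit.π (level D n) j =
      limit.π (level D n) j ≫ (D.obj j).ρ n g :=
  limMap_π _ _

/-- The structure maps of the levelwise limit. -/
noncomputable def limitσ (n : ℕ) :
    P.T.obj (limit (level D n)) ⟶ limit (level D (n + 1)) :=
  limit.lift (level D (n + 1)) ⟨_,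
    { app := fun j ↦ P.T.map (limit.π (level D n) j) ≫ (D.obj j).σ n
      naturality := fun i j f ↦ by
        have := limit.w (level D n) f
        dsimp at this ⊢
        rw [Category.id_comp, ← this, Functor.map_comp, Category.assoc, Category.assoc,
          (D.map f).comm] }⟩

lemma limitσ_π (n : ℕ) (j : K) : limitσ D n ≫ limit.π (level D (n + 1)) j =
    P.T.map (limit.π (level D n) j) ≫ (D.obj j).σ n :=
  limit.lift_π _ _

/-- The levelwise limit. -/
noncomputable abbrev limitSpectrum : ShapedSpectrum P where
  X n := limit (level D n)
  ρ n := limitρ D n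
  σ n := limitσ D n
  σ_equivariant n g := limit.hom_ext fun j ↦ by
    rw [Category.assoc, Category.assoc, limitσ_π, ← P.T.map_comp_assoc, limitρ_π, limitρ_π,
      reassoc_of% limitσ_π, P.T.map_comp_assoc, (D.obj j).σ_equivariant]
  braid n := limit.hom_ext fun j ↦ by
    have := P.t.naturality (limit.π (level D n) j)
    dsimp at this
    have h := P.T.congr_map (limitσ_π D n j)
    rw [P.T.map_comp, P.T.map_comp] at h
    simp only [Category.assoc]
    rw [limitρ_π, limitσ_π, reassoc_of% limitσ_π, reassoc_of% h, reassoc_of% h, ← reassoc_of% this,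
      (D.obj j).braid]

/-- The levelwise limit cone. -/
noncomputable abbrev limitSpectrumCone : Cone D where
  pt := limitSpectrum D
  π :=
    { app := fun j ↦
        { hom := fun n ↦ limit.π (level D n) j
          equivariant := fun _ _ ↦ limitρ_π _ _ _ _
          comm := fun _ ↦ limitσ_π _ _ _ }
      naturality := fun _ _ f ↦ hom_ext fun n ↦
        (Category.id_comp _).trans (limit.w (level D n) f).symm }

noncomputable def isLimitLimitSpectrumCone : IsLimit (limitSpectrumCone D) where
  lift s :=
    { hom := fun n ↦ limit.lift (level D n) (levelCone D s n)
      equivariant := fun n g ↦ limit.hom_ext fun j ↦ by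
        rw [Category.assoc, Category.assoc, limitρ_π, limit.lift_π, limit.lift_π_assoc]
        exact (s.π.app j).equivariant n g
      comm := fun n ↦ limit.hom_ext fun j ↦ by
        rw [Category.assoc, Category.assoc, limitσ_π, limit.lift_π, ← P.T.map_comp_assoc,
          limit.lift_π]
        exact (s.π.app j).comm n }
  fac s j := hom_ext fun n ↦ limit.lift_π _ _
  uniq s m hm := hom_ext fun n ↦ limit.hom_ext fun j ↦
    (congrArg (fun x ↦ Hom.hom x n) (hm j)).trans (limit.lift_π (levelCone D s n) j).symm

instance : HasLimits (ShapedSpectrum P) :=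
  ⟨fun _ _ ↦ ⟨fun D ↦ ⟨⟨⟨_, isLimitLimitSpectrumCone D⟩⟩⟩⟩⟩

end

variable [HasColimits C] [PreservesColimitsOfSize.{v, v} P.T]

/-- Maps out of the image under `T` of a levelwise colimit. -/
noncomputable abbrev isColimitMapColimit (n : ℕ) :
    IsColimit (P.T.mapCocone (colimit.cocone (level D n))) :=
  isColimitOfPreserves P.T (colimit.isColimit _)

/-- The structure maps of the levelwise colimit. -/
noncomputable def colimitσ (n : ℕ) :
    P.T.obj (colimit (level D n)) ⟶ colimit (level D (n + 1)) :=
  (isColimitMapColimit D n).desc ⟨_,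
    { app := fun j ↦ (D.obj j).σ n ≫ colimit.ι (level D (n + 1)) j
      naturality := fun i j f ↦ by
        have := colimit.w (level D (n + 1)) f
        dsimp at this ⊢
        rw [Category.comp_id, ← this, ← Category.assoc, ← Category.assoc, (D.map f).comm] }⟩

lemma ι_colimitσ (n : ℕ) (j : K) : P.T.map (colimit.ι (level D n) j) ≫ colimitσ D n =
    (D.obj j).σ n ≫ colimit.ι (level D (n + 1)) j :=
  (isColimitMapColimit D n).fac _ j

lemma map_colimit_hom_ext {n : ℕ} {Z : C} {f g : P.T.obj (colimit (level D n)) ⟶ Z}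
    (h : ∀ j, P.T.map (colimit.ι (level D n) j) ≫ f = P.T.map (colimit.ι (level D n) j) ≫ g) :
    f = g :=
  (isColimitMapColimit D n).hom_ext h

/-- The braid relation of the colimit is an equation of maps out of two applications of `T`, so
preservation of colimits is used twice. -/
lemma map_map_colimit_hom_ext {n : ℕ} {Z : C}
    {f g : P.T.obj (P.T.obj (colimit (level D n))) ⟶ Z}
    (h : ∀ j, P.T.map (P.T.map (colimit.ι (level D n) j)) ≫ f =
      P.T.map (P.T.map (colimit.ι (level D n) j)) ≫ g) : f = g :=
  (isColimitOfPreserves P.T (isColimitMapColimit D n)).hom_ext h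

/-- The action on the levelwise colimit. -/
noncomputable def colimitρ (n : ℕ) : P.Γ n →* End (colimit (level D n)) where
  toFun g := colimMap (levelρ D n g)
  map_one' := colimit.hom_ext fun j ↦ by
    rw [ι_colimMap]
    dsimp only
    rw [map_one]
    exact (Category.id_comp _).trans (Category.comp_id _).symm
  map_mul' g h := colimit.hom_ext fun j ↦ by
    rw [End.mul_def, ι_colimMap, ι_colimMap_assoc, ι_colimMap]
    dsimp only
    rw [map_mul]
    exact Category.assoc _ _ _

omit [PreservesColimitsOfSize.{v, v} P.T] in
lemma ι_colimitρ (n : ℕ) (g : P.Γ n) (j : K) :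
    colimit.ι (level D n) j ≫ (colimitρ D n g : colimit (level D n) ⟶ colimit (level D n)) =
      (D.obj j).ρ n g ≫ colimit.ι (level D n) j :=
  ι_colimMap _ _

/-- The levelwise colimit. -/
noncomputable abbrev colimitSpectrum : ShapedSpectrum P where
  X n := colimit (level D n)
  ρ n := colimitρ D n
  σ n := colimitσ D n
  σ_equivariant n g := map_colimit_hom_ext D fun j ↦ by
    rw [← P.T.map_comp_assoc, ι_colimitρ, P.T.map_comp_assoc, ι_colimitσ, reassoc_of% ι_colimitσ,
      ι_colimitρ, reassoc_of% ((D.obj j).σ_equivariant n g)]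
  braid n := map_map_colimit_hom_ext D fun j ↦ by
    have := P.t.naturality (colimit.ι (level D n) j)
    dsimp at this
    rw [reassoc_of% this, ← P.T.map_comp_assoc, ι_colimitσ, P.T.map_comp_assoc, ι_colimitσ,
      ← P.T.map_comp_assoc, ι_colimitσ, P.T.map_comp_assoc, reassoc_of% ι_colimitσ, ι_colimitρ,
      reassoc_of% ((D.obj j).braid n)]

/-- The levelwise colimit cocone. -/
noncomputable abbrev colimitSpectrumCocone : Cocone D where
  pt := colimitSpectrum D
  ι :=
    { app := fun j ↦
        { hom := fun n ↦ colimit.ι (level D n) j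
          equivariant := fun _ _ ↦ (ι_colimitρ _ _ _ _).symm
          comm := fun _ ↦ (ι_colimitσ _ _ _).symm }
      naturality := fun _ _ f ↦ hom_ext fun n ↦
        (colimit.w (level D n) f).trans (Category.comp_id _).symm }

noncomputable def isColimitColimitSpectrumCocone : IsColimit (colimitSpectrumCocone D) where
  desc s :=
    { hom := fun n ↦ colimit.desc (level D n) (levelCocone D s n)
      equivariant := fun n g ↦ colimit.hom_ext fun j ↦ by
        rw [reassoc_of% ι_colimitρ, colimit.ι_desc, colimit.ι_desc_assoc]
        exact (s.ι.app j).equivariant n g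
      comm := fun n ↦ map_colimit_hom_ext D fun j ↦ by
        rw [reassoc_of% ι_colimitσ, colimit.ι_desc, ← P.T.map_comp_assoc, colimit.ι_desc]
        exact (s.ι.app j).comm n }
  fac s j := hom_ext fun n ↦ colimit.ι_desc _ _
  uniq s m hm := hom_ext fun n ↦ colimit.hom_ext fun j ↦
    (congrArg (fun x ↦ Hom.hom x n) (hm j)).trans (colimit.ι_desc (levelCocone D s n) j).symm

instance : HasColimits (ShapedSpectrum P) :=
  ⟨fun _ _ ↦ ⟨fun D ↦ ⟨⟨⟨_, isColimitColimitSpectrumCocone D⟩⟩⟩⟩⟩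

instance (n : ℕ) : PreservesColimitsOfSize.{v, v} (ev P n) :=
  ⟨⟨fun {D} ↦ preservesColimit_of_preserves_colimit_cocone (isColimitColimitSpectrumCocone D)
    (show IsColimit (colimit.cocone (level D n)) from colimit.isColimit _)⟩⟩

end Limits

end ShapedSpectrum


/-! ### Free spectra -/

/-- An object with generators `B i` and relations `φ k` is the coequalizer of two maps between
coproducts. -/
lemma exists_universal_family {C : Type u} [Category.{v} C] [HasColimits C] {ι : Type} {κ : Type v}
    (B : ι → C) (src tgt : κ → ι) (φ : ∀ k, B (src k) ⟶ B (tgt k)) :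
    ∃ (Q : C) (a : ∀ i, B i ⟶ Q), (∀ k, φ k ≫ a (tgt k) = a (src k)) ∧
      (∀ ⦃Z : C⦄ ⦃f g : Q ⟶ Z⦄, (∀ i, a i ≫ f = a i ≫ g) → f = g) ∧
      ∀ ⦃Z : C⦄ (b : ∀ i, B i ⟶ Z), (∀ k, φ k ≫ b (tgt k) = b (src k)) →
        ∃ l : Q ⟶ Z, ∀ i, a i ≫ l = b i := by
  have : HasColimitsOfSize.{0, 0} C := hasColimitsOfSizeShrink.{0, 0, v, v} C
  let f : (∐ fun k ↦ B (src k)) ⟶ ∐ B := Sigma.desc fun k ↦ φ k ≫ Sigma.ι B (tgt k)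
  let g : (∐ fun k ↦ B (src k)) ⟶ ∐ B := Sigma.desc fun k ↦ Sigma.ι B (src k)
  refine ⟨coequalizer f g, fun i ↦ Sigma.ι B i ≫ coequalizer.π f g, fun k ↦ ?_,
    fun Z x y h ↦ ?_, fun Z b h ↦ ?_⟩
  · have := Sigma.ι (fun k ↦ B (src k)) k ≫= coequalizer.condition f g
    simpa [f, g] using this
  · ext i
    simpa using h i
  · have hb : f ≫ Sigma.desc b = g ≫ Sigma.desc b := by
      ext k
      simpa [f, g] using h k
    exact ⟨coequalizer.desc (Sigma.desc b) hb, fun i ↦ by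
      rw [Category.assoc, coequalizer.π_desc, Sigma.ι_desc]⟩

/-- The ways to go from level `n` to level `m`. -/
inductive LevelPath (n : ℕ) : ℕ → Type
  -- A path plays the role of `n ≤ m`. Recursion on it gives the power of exponent `m - n` without
  -- subtraction, and the absence of paths for `m < n` makes the free spectrum initial there.
  | refl : LevelPath n n
  | step {m : ℕ} (p : LevelPath n m) : LevelPath n (m + 1)

namespace SpectrumShape

variable {C : Type u} [Category.{v} C] (P : SpectrumShape C) {n : ℕ}

/-- The power of `T` of exponent the length of a path. -/
def pow : {m : ℕ} → LevelPath n m → C ⥤ C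
  | _, .refl => 𝟭 C
  | _, .step p => pow p ⋙ P.T

/-- The endomorphism `t` of the last two factors of a power of `T`. -/
def twist {m : ℕ} (p : LevelPath n m) : P.pow p.step.step ⟶ P.pow p.step.step where
  app A := P.t.app ((P.pow p).obj A)
  naturality _ _ f := P.t.naturality ((P.pow p).map f)

/-- The relation between elements of `Γ m` and endomorphisms of a power of `T` generated by the
relations of `s m` with `t`. -/
inductive Rel : {m : ℕ} → (p : LevelPath n m) → P.Γ m → (P.pow p ⟶ P.pow p) → Prop
  | one {m : ℕ} (p : LevelPath n m) : Rel p 1 (𝟙 _)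
  | mul {m : ℕ} {p : LevelPath n m} {g h : P.Γ m} {φ ψ : P.pow p ⟶ P.pow p} :
      Rel p g φ → Rel p h ψ → Rel p (g * h) (ψ ≫ φ)
  | twist {m : ℕ} (p : LevelPath n m) : Rel p.step.step (P.s m) (P.twist p)
  | whisker {m : ℕ} {p : LevelPath n m} {g : P.Γ m} {φ : P.pow p ⟶ P.pow p} :
      Rel p g φ → Rel p.step (P.ι m g) (Functor.whiskerRight φ P.T)

/-- The element `s m` commutes with the image of `Γ m`. -/
def Commutes : Prop :=
  ∀ m (g : P.Γ m), P.s m * P.ι _ (P.ι _ g) = P.ι _ (P.ι _ g) * P.s m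

section FreeLevel

variable [HasColimits C] (n) (m : ℕ) (A : C)

/-- This is the induction to `Γ m` of the partial action on a power of `T`: copies of the power
indexed by `Γ m`, where the copies at `x * h` and `x` are glued by each `φ` related to `h`. -/
lemma exists_freeLevel :
    ∃ (Q : C) (a : ∀ (p : LevelPath n m) (_ : P.Γ m), (P.pow p).obj A ⟶ Q),
      (∀ p x h φ, P.Rel p h φ → φ.app A ≫ a p x = a p (x * h)) ∧
      (∀ ⦃Z : C⦄ ⦃f g : Q ⟶ Z⦄, (∀ p x, a p x ≫ f = a p x ≫ g) → f = g) ∧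
      ∀ ⦃Z : C⦄ (b : ∀ (p : LevelPath n m) (_ : P.Γ m), (P.pow p).obj A ⟶ Z),
        (∀ p x h φ, P.Rel p h φ → φ.app A ≫ b p x = b p (x * h)) →
        ∃ l : Q ⟶ Z, ∀ p x, a p x ≫ l = b p x := by
  -- Relations are indexed by the components at `A`, because natural transformations need not form a
  -- type in universe `v`.
  let κ : Type v := {k : Σ p : LevelPath n m, P.Γ m × P.Γ m × ((P.pow p).obj A ⟶ (P.pow p).obj A) //
    ∃ φ, P.Rel k.1 k.2.2.1 φ ∧ φ.app A = k.2.2.2}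
  obtain ⟨Q, a, h₁, h₂, h₃⟩ := exists_universal_family (κ := κ)
    (fun i : LevelPath n m × P.Γ m ↦ (P.pow i.1).obj A)
    (fun k ↦ (k.1.1, k.1.2.1 * k.1.2.2.1)) (fun k ↦ (k.1.1, k.1.2.1)) (fun k ↦ k.1.2.2.2)
  refine ⟨Q, fun p x ↦ a (p, x), fun p x h φ hφ ↦ h₁ ⟨⟨p, x, h, φ.app A⟩, φ, hφ, rfl⟩,
    fun Z f g h ↦ h₂ fun i ↦ h i.1 i.2, fun Z b hb ↦ ?_⟩
  obtain ⟨l, hl⟩ := h₃ (fun i ↦ b i.1 i.2) (fun k ↦ by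
    obtain ⟨φ, hφ, h⟩ := k.2
    exact (congrArg (· ≫ b k.1.1 k.1.2.1) h).symm.trans (hb _ _ _ φ hφ))
  exact ⟨l, fun p x ↦ hl (p, x)⟩

/-- The `m`th level of the free spectrum on `A` at level `n`. -/
noncomputable def freeLevel : C := (P.exists_freeLevel n m A).choose

variable {n m}

/-- The structure maps of the free spectrum. -/
noncomputable def freeIn (p : LevelPath n m) (x : P.Γ m) : (P.pow p).obj A ⟶ P.freeLevel n m A :=
  (P.exists_freeLevel n m A).choose_spec.choose p x

variable {A}

lemma app_freeIn {p : LevelPath n m} {h : P.Γ m} {φ : P.pow p ⟶ P.pow p} (hφ : P.Rel p h φ)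
    (x : P.Γ m) : φ.app A ≫ P.freeIn A p x = P.freeIn A p (x * h) :=
  (P.exists_freeLevel n m A).choose_spec.choose_spec.1 p x h φ hφ

lemma freeLevel_hom_ext {Z : C} {f g : P.freeLevel n m A ⟶ Z}
    (h : ∀ p x, P.freeIn A p x ≫ f = P.freeIn A p x ≫ g) : f = g :=
  (P.exists_freeLevel n m A).choose_spec.choose_spec.2.1 h

lemma exists_freeLevel_desc {Z : C} (b : ∀ (p : LevelPath n m) (_ : P.Γ m), (P.pow p).obj A ⟶ Z)
    (hb : ∀ p x h φ, P.Rel p h φ → φ.app A ≫ b p x = b p (x * h)) :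
    ∃ l : P.freeLevel n m A ⟶ Z, ∀ p x, P.freeIn A p x ≫ l = b p x :=
  (P.exists_freeLevel n m A).choose_spec.choose_spec.2.2 b hb

/-- The map out of a level of a free spectrum given by a compatible family. -/
noncomputable def freeDesc {Z : C} (b : ∀ (p : LevelPath n m) (_ : P.Γ m), (P.pow p).obj A ⟶ Z)
    (hb : ∀ p x h φ, P.Rel p h φ → φ.app A ≫ b p x = b p (x * h)) : P.freeLevel n m A ⟶ Z :=
  (P.exists_freeLevel_desc b hb).choose

lemma freeIn_freeDesc {Z : C} (b : ∀ (p : LevelPath n m) (_ : P.Γ m), (P.pow p).obj A ⟶ Z)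
    (hb : ∀ p x h φ, P.Rel p h φ → φ.app A ≫ b p x = b p (x * h)) (p : LevelPath n m) (x : P.Γ m) :
    P.freeIn A p x ≫ P.freeDesc b hb = b p x :=
  (P.exists_freeLevel_desc b hb).choose_spec p x

variable (A) in
/-- The action on a level of a free spectrum. -/
noncomputable def freeρ : P.Γ m →* End (P.freeLevel n m A) where
  toFun g := P.freeDesc (fun p x ↦ P.freeIn A p (g * x)) fun p x h φ hφ ↦ by
    rw [P.app_freeIn hφ, mul_assoc]
  map_one' := P.freeLevel_hom_ext fun p x ↦ by
    rw [P.freeIn_freeDesc, one_mul]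
    exact (Category.comp_id _).symm
  map_mul' g h := P.freeLevel_hom_ext fun p x ↦ by
    rw [End.mul_def, P.freeIn_freeDesc, reassoc_of% P.freeIn_freeDesc, P.freeIn_freeDesc, mul_assoc]

lemma freeIn_freeρ (p : LevelPath n m) (x g : P.Γ m) :
    P.freeIn A p x ≫ (P.freeρ A g : P.freeLevel n m A ⟶ _) = P.freeIn A p (g * x) :=
  P.freeIn_freeDesc _ (fun p x h φ hφ ↦ by rw [P.app_freeIn hφ, mul_assoc]) _ _

variable (A) in
/-- The structure maps of the free spectrum on a power of `T` of positive exponent. -/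
noncomputable def freeInStep (p : LevelPath n m) (x : P.Γ (m + 1)) :
    P.T.obj ((P.pow p).obj A) ⟶ P.freeLevel n (m + 1) A :=
  P.freeIn A p.step x

variable (A) in
/-- The structure maps of the free spectrum on a power of `T` of exponent at least two. -/
noncomputable def freeInStepStep (p : LevelPath n m) (x : P.Γ (m + 2)) :
    P.T.obj (P.T.obj ((P.pow p).obj A)) ⟶ P.freeLevel n (m + 2) A :=
  P.freeIn A p.step.step x

lemma freeInStep_freeρ (p : LevelPath n m) (x g : P.Γ (m + 1)) :
    P.freeInStep A p x ≫ (P.freeρ A g : P.freeLevel n (m + 1) A ⟶ _) = P.freeInStep A p (g * x) :=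
  P.freeIn_freeρ _ _ _

lemma freeInStepStep_freeρ (p : LevelPath n m) (x g : P.Γ (m + 2)) :
    P.freeInStepStep A p x ≫ (P.freeρ A g : P.freeLevel n (m + 2) A ⟶ _) =
      P.freeInStepStep A p (g * x) :=
  P.freeIn_freeρ _ _ _

lemma t_freeInStepStep (p : LevelPath n m) (x : P.Γ (m + 2)) :
    P.t.app ((P.pow p).obj A) ≫ P.freeInStepStep A p x = P.freeInStepStep A p (x * P.s m) :=
  P.app_freeIn (.twist p) x

lemma map_app_freeInStep {p : LevelPath n m} {h : P.Γ m} {φ : P.pow p ⟶ P.pow p}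
    (hφ : P.Rel p h φ) (x : P.Γ m) :
    P.T.map (φ.app A) ≫ P.freeInStep A p (P.ι m x) = P.freeInStep A p (P.ι m (x * h)) := by
  rw [map_mul]
  exact P.app_freeIn hφ.whisker _

section

variable [P.T.IsLeftAdjoint]

lemma map_freeLevel_hom_ext {Z : C} {f g : P.T.obj (P.freeLevel n m A) ⟶ Z}
    (h : ∀ p x, P.T.map (P.freeIn A p x) ≫ f = P.T.map (P.freeIn A p x) ≫ g) : f = g := by
  let adj := Adjunction.ofIsLeftAdjoint P.T
  refine (adj.homEquiv _ _).injective (P.freeLevel_hom_ext fun p x ↦ ?_)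
  rw [← adj.homEquiv_naturality_left, ← adj.homEquiv_naturality_left, h]

lemma map_map_freeLevel_hom_ext {Z : C} {f g : P.T.obj (P.T.obj (P.freeLevel n m A)) ⟶ Z}
    (h : ∀ p x, P.T.map (P.T.map (P.freeIn A p x)) ≫ f = P.T.map (P.T.map (P.freeIn A p x)) ≫ g) :
    f = g := by
  let adj := Adjunction.ofIsLeftAdjoint P.T
  refine (adj.homEquiv _ _).injective (P.map_freeLevel_hom_ext fun p x ↦ ?_)
  rw [← adj.homEquiv_naturality_left, ← adj.homEquiv_naturality_left, h]

/-- As `T` is a left adjoint, the map is defined by its transpose on generators; it respects the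
relations since they are stable under whiskering. -/
lemma exists_freeσ : ∃ σ : P.T.obj (P.freeLevel n m A) ⟶ P.freeLevel n (m + 1) A,
    ∀ p x, P.T.map (P.freeIn A p x) ≫ σ = P.freeInStep A p (P.ι m x) := by
  let adj := Adjunction.ofIsLeftAdjoint P.T
  obtain ⟨l, hl⟩ := P.exists_freeLevel_desc (A := A) (n := n)
    (fun p (x : P.Γ m) ↦ adj.homEquiv _ _ (P.freeInStep A p (P.ι m x))) fun p x h φ hφ ↦ by
      rw [← adj.homEquiv_naturality_left, P.map_app_freeInStep hφ]
  refine ⟨(adj.homEquiv _ _).symm l, fun p x ↦ (adj.homEquiv _ _).injective ?_⟩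
  rw [adj.homEquiv_naturality_left, Equiv.apply_symm_apply, hl]

variable (n m A) in
/-- The structure maps of a free spectrum. -/
noncomputable def freeσ : P.T.obj (P.freeLevel n m A) ⟶ P.freeLevel n (m + 1) A :=
  P.exists_freeσ.choose

lemma map_freeIn_freeσ (p : LevelPath n m) (x : P.Γ m) :
    P.T.map (P.freeIn A p x) ≫ P.freeσ n m A = P.freeInStep A p (P.ι m x) :=
  P.exists_freeσ.choose_spec p x

lemma map_freeInStep_freeσ (p : LevelPath n m) (x : P.Γ (m + 1)) :
    P.T.map (P.freeInStep A p x) ≫ P.freeσ n (m + 1) A = P.freeInStepStep A p (P.ι _ x) :=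
  P.map_freeIn_freeσ p.step x

end

end FreeLevel

end SpectrumShape

open SpectrumShape

namespace ShapedSpectrum

variable {C : Type u} [Category.{v} C] {P : SpectrumShape C}

lemma map_comp_σ {Y : ShapedSpectrum P} {m : ℕ} {B : C} {b : B ⟶ Y.X m} {φ : B ⟶ B} {g : P.Γ m}
    (h : φ ≫ b = b ≫ Y.ρ m g) :
    P.T.map φ ≫ P.T.map b ≫ Y.σ m = (P.T.map b ≫ Y.σ m) ≫ Y.ρ (m + 1) (P.ι m g) := by
  rw [← P.T.map_comp_assoc, h, P.T.map_comp_assoc, Y.σ_equivariant, Category.assoc]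

lemma t_comp_σ_σ (Y : ShapedSpectrum P) {m : ℕ} {B : C} (b : B ⟶ Y.X m) :
    P.t.app B ≫ P.T.map (P.T.map b ≫ Y.σ m) ≫ Y.σ (m + 1) =
      (P.T.map (P.T.map b ≫ Y.σ m) ≫ Y.σ (m + 1)) ≫ Y.ρ (m + 2) (P.s m) := by
  have := P.t.naturality b
  dsimp at this
  rw [P.T.map_comp, Category.assoc, ← reassoc_of% this, Y.braid]
  simp only [Category.assoc]

lemma map_comp_σ_hom {Y Y' : ShapedSpectrum P} (g : Y ⟶ Y') {m : ℕ} {B : C} (b : B ⟶ Y.X m)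
    {b' : B ⟶ Y'.X m} (h : b ≫ g.hom m = b') :
    (P.T.map b ≫ Y.σ m) ≫ g.hom (m + 1) = P.T.map b' ≫ Y'.σ m := by
  rw [Category.assoc, g.comm, ← P.T.map_comp_assoc, h]

/-- The iterated structure maps. -/
def iterate (Y : ShapedSpectrum P) {n : ℕ} {A : C} (f : A ⟶ Y.X n) :
    {m : ℕ} → (p : LevelPath n m) → ((P.pow p).obj A ⟶ Y.X m)
  | _, .refl => f
  | _, .step p => P.T.map (Y.iterate f p) ≫ Y.σ _

/-- It is enough to check the generators of the relation: the twist is the braid condition on `Y`,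
and whiskering is equivariance of the structure maps. -/
lemma app_iterate (Y : ShapedSpectrum P) {n : ℕ} {A : C} (f : A ⟶ Y.X n) {m : ℕ}
    {p : LevelPath n m} {h : P.Γ m} {φ : P.pow p ⟶ P.pow p} (hφ : P.Rel p h φ) :
    φ.app A ≫ Y.iterate f p = Y.iterate f p ≫ Y.ρ m h := by
  induction hφ with
  | one p =>
    rw [map_one]
    exact (Category.id_comp _).trans (Category.comp_id _).symm
  | mul _ _ h₁ h₂ =>
    rw [map_mul, NatTrans.comp_app, Category.assoc, h₁, reassoc_of% h₂]
    rfl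
  | twist p => exact Y.t_comp_σ_σ (Y.iterate f p)
  | whisker _ h => exact map_comp_σ h

lemma iterate_comp {Y Y' : ShapedSpectrum P} {n : ℕ} {A : C} (f : A ⟶ Y.X n) (g : Y ⟶ Y') {m : ℕ}
    (p : LevelPath n m) : Y.iterate f p ≫ g.hom m = Y'.iterate (f ≫ g.hom n) p := by
  induction p with
  | refl => rfl
  | step p h => exact map_comp_σ_hom g _ h

lemma iterate_compat (Y : ShapedSpectrum P) {n : ℕ} {A : C} (f : A ⟶ Y.X n) {m : ℕ}
    (p : LevelPath n m) (x h : P.Γ m) (φ : P.pow p ⟶ P.pow p) (hφ : P.Rel p h φ) :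
    φ.app A ≫ Y.iterate f p ≫ Y.ρ m x = Y.iterate f p ≫ Y.ρ m (x * h) := by
  rw [← Category.assoc, Y.app_iterate f hφ, map_mul, Category.assoc]
  rfl

lemma iterate_precomp (Y : ShapedSpectrum P) {n : ℕ} {A B : C} (i : A ⟶ B) (f : B ⟶ Y.X n) {m : ℕ}
    (p : LevelPath n m) : Y.iterate (i ≫ f) p = (P.pow p).map i ≫ Y.iterate f p := by
  induction p with
  | refl => rfl
  | step p h =>
    exact ((congrArg (P.T.map · ≫ Y.σ _) h).trans
      (congrArg (· ≫ Y.σ _) (P.T.map_comp _ _))).trans (Category.assoc _ _ _)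

variable [HasColimits C] [P.T.IsLeftAdjoint]

/-- The free spectrum on `A` at level `n`. -/
noncomputable abbrev free (hs : P.Commutes) (n : ℕ) (A : C) : ShapedSpectrum P where
  X m := P.freeLevel n m A
  ρ m := P.freeρ A
  σ m := P.freeσ n m A
  σ_equivariant m g := P.map_freeLevel_hom_ext fun p x ↦ by
    rw [← P.T.map_comp_assoc, P.freeIn_freeρ, P.map_freeIn_freeσ, reassoc_of% P.map_freeIn_freeσ,
      P.freeInStep_freeρ, map_mul]
  braid m := P.map_map_freeLevel_hom_ext fun p x ↦ by
    have := P.t.naturality (P.freeIn A p x)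
    dsimp at this
    have h := P.T.congr_map (P.map_freeIn_freeσ (A := A) p x)
    rw [P.T.map_comp] at h
    -- The twist multiplies the index by `s m` on the right and the action multiplies it on the
    -- left; the two agree because the index comes from `Γ m`, with which `s m` commutes.
    rw [reassoc_of% this, reassoc_of% h, reassoc_of% h, P.map_freeInStep_freeσ,
      reassoc_of% P.map_freeInStep_freeσ, P.t_freeInStepStep, P.freeInStepStep_freeρ, hs]

/-- The map out of a free spectrum given by a map to the level at which it is free. -/
noncomputable def freeHom (hs : P.Commutes) {n : ℕ} {A : C} (Y : ShapedSpectrum P)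
    (f : A ⟶ Y.X n) : free hs n A ⟶ Y where
  hom m := P.freeDesc (fun p x ↦ Y.iterate f p ≫ Y.ρ m x) (Y.iterate_compat f)
  equivariant m g := P.freeLevel_hom_ext fun p x ↦ by
    rw [reassoc_of% P.freeIn_freeρ, P.freeIn_freeDesc, reassoc_of% P.freeIn_freeDesc, map_mul, Category.assoc]
    rfl
  comm m := P.map_freeLevel_hom_ext fun p x ↦ by
    rw [reassoc_of% P.map_freeIn_freeσ, ← P.T.map_comp_assoc, P.freeIn_freeDesc]
    refine (P.freeIn_freeDesc _ _ p.step _).trans ?_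
    rw [P.T.map_comp, Category.assoc, Y.σ_equivariant]
    exact Category.assoc _ _ _

/-- The unit of the adjunction of free spectra and evaluation. -/
noncomputable def freeUnit (P : SpectrumShape C) (n : ℕ) (A : C) : A ⟶ P.freeLevel n n A :=
  P.freeIn A (.refl : LevelPath n n) 1

variable (hs : P.Commutes)

lemma freeIn_freeHom {n : ℕ} {A : C} (Y : ShapedSpectrum P) (f : A ⟶ Y.X n) {m : ℕ}
    (p : LevelPath n m) (x : P.Γ m) :
    P.freeIn A p x ≫ (freeHom hs Y f).hom m = Y.iterate f p ≫ Y.ρ m x :=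
  P.freeIn_freeDesc _ (Y.iterate_compat f) _ _

lemma freeUnit_freeHom {n : ℕ} {A : C} (Y : ShapedSpectrum P) (f : A ⟶ Y.X n) :
    freeUnit P n A ≫ (freeHom hs Y f).hom n = f :=
  (freeIn_freeHom hs Y f (.refl : LevelPath n n) 1).trans <| by
    rw [map_one]
    exact Category.comp_id _

lemma freeIn_one_eq (n : ℕ) (A : C) {m : ℕ} (p : LevelPath n m) :
    P.freeIn A p 1 = (free hs n A).iterate (freeUnit P n A) p := by
  induction p with
  | refl => rfl
  | @step m p h =>
    have := P.map_freeIn_freeσ (A := A) p 1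
    rw [map_one, h] at this
    exact this.symm

lemma freeIn_eq (n : ℕ) (A : C) {m : ℕ} (p : LevelPath n m) (x : P.Γ m) :
    P.freeIn A p x =
      (free hs n A).iterate (freeUnit P n A) p ≫ (P.freeρ A x : P.freeLevel n m A ⟶ _) := by
  rw [← freeIn_one_eq, P.freeIn_freeρ, mul_one]

/-- Every generator is obtained from the unit by iterated structure maps and the action, so a map
out of a free spectrum is determined by its restriction along the unit. -/
lemma freeIn_hom {n : ℕ} {A : C} {Y : ShapedSpectrum P} (g : free hs n A ⟶ Y) {m : ℕ}
    (p : LevelPath n m) (x : P.Γ m) :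
    P.freeIn A p x ≫ g.hom m = Y.iterate (freeUnit P n A ≫ g.hom n) p ≫ Y.ρ m x := by
  rw [freeIn_eq hs, ← iterate_comp (Y := free hs n A), Category.assoc, Category.assoc]
  exact _ ≫= g.equivariant m x

/-- The universal property of free spectra. -/
noncomputable def freeHomEquiv (n : ℕ) (A : C) (Y : ShapedSpectrum P) :
    (free hs n A ⟶ Y) ≃ (A ⟶ (ev P n).obj Y) where
  toFun g := freeUnit P n A ≫ g.hom n
  invFun f := freeHom hs Y f
  left_inv g := hom_ext fun _ ↦ P.freeLevel_hom_ext fun p x ↦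
    (freeIn_freeHom hs Y _ p x).trans (freeIn_hom hs g p x).symm
  right_inv f := freeUnit_freeHom hs Y f

/-- The free spectrum functor. -/
noncomputable def freeFunctor (n : ℕ) : C ⥤ ShapedSpectrum P :=
  Adjunction.leftAdjointOfEquiv (G := ev P n) (freeHomEquiv hs n)
    fun _ _ _ _ _ ↦ (Category.assoc _ _ _).symm

/-- Free spectra are left adjoint to evaluation. -/
noncomputable def freeAdjunction (n : ℕ) : freeFunctor hs n ⊣ ev P n :=
  Adjunction.adjunctionOfEquivLeft _ _

/-- The functoriality of a level of the free spectra. -/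
noncomputable abbrev freeMap (n : ℕ) {A B : C} (i : A ⟶ B) (m : ℕ) :
    P.freeLevel n m A ⟶ P.freeLevel n m B :=
  ((freeFunctor hs n).map i).hom m

lemma freeIn_freeMap (n : ℕ) {A B : C} (i : A ⟶ B) {m : ℕ} (p : LevelPath n m) (x : P.Γ m) :
    P.freeIn A p x ≫ freeMap hs n i m = (P.pow p).map i ≫ P.freeIn B p x := by
  have h : freeUnit P n A ≫ freeMap hs n i n = i ≫ freeUnit P n B :=
    (freeUnit_freeHom hs (free hs n B) _).trans (i ≫= Category.comp_id _)
  have := freeIn_hom hs (Y := free hs n B) ((freeFunctor hs n).map i) p x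
  refine this.trans ?_
  change (free hs n B).iterate (freeUnit P n A ≫ freeMap hs n i n) p ≫ _ = _
  rw [h, iterate_precomp, Category.assoc, freeIn_eq hs n B]

end ShapedSpectrum


/-! ### Evaluations of free spectra preserve cofibrations -/

namespace SpectrumShape

variable {C : Type u} [Category.{v} C] (P : SpectrumShape C)

/-- Each element of `Γ m` is related to at most one endomorphism of a power of `T`. -/
def IsFaithful : Prop :=
  ∀ ⦃n m : ℕ⦄ (p : LevelPath n m) (h : P.Γ m) (φ ψ : P.pow p ⟶ P.pow p),
    P.Rel p h φ → P.Rel p h ψ → φ = ψ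

variable {P}

/-- The relation is generated as a monoid; inverses come for free because the generators `s m` are
involutions. -/
lemma Rel.exists_inv (hs : ∀ m, P.s m * P.s m = 1) {n m : ℕ} {p : LevelPath n m} {h : P.Γ m}
    {φ : P.pow p ⟶ P.pow p} (hφ : P.Rel p h φ) : ∃ ψ, P.Rel p h⁻¹ ψ := by
  induction hφ with
  | one p => exact ⟨_, by simpa using Rel.one p⟩
  | mul _ _ h₁ h₂ =>
    obtain ⟨φ', h₁⟩ := h₁
    obtain ⟨ψ', h₂⟩ := h₂
    exact ⟨_, by simpa using h₂.mul h₁⟩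
  | twist p => exact ⟨_, by simpa [inv_eq_of_mul_eq_one_right (hs _)] using Rel.twist p⟩
  | whisker _ h =>
    obtain ⟨φ', h⟩ := h
    exact ⟨_, by simpa using h.whisker⟩

/-- The subgroup of all elements which act on a power of `T`. -/
def relSubgroup (hs : ∀ m, P.s m * P.s m = 1) {n m : ℕ} (p : LevelPath n m) :
    Subgroup (P.Γ m) where
  carrier := {h | ∃ φ, P.Rel p h φ}
  one_mem' := ⟨_, .one p⟩
  mul_mem' := fun ⟨_, h₁⟩ ⟨_, h₂⟩ ↦ ⟨_, h₁.mul h₂⟩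
  inv_mem' := fun ⟨_, h⟩ ↦ h.exists_inv hs

end SpectrumShape

open SpectrumShape

namespace ShapedSpectrum

variable {C : Type u} [Category.{v} C] {P : SpectrumShape C}

section

variable [CategoryWithCofibrations C] [CategoryWithWeakEquivalences C]

lemma pow_cofibrations (hT : IsLeftQuillen P.T) {n m : ℕ} (p : LevelPath n m) {A B : C} {i : A ⟶ B}
    (hi : cofibrations C i) : cofibrations C ((P.pow p).map i) := by
  induction p with
  | refl => exact hi
  | step p h => exact hT.map_cofibration _ h

lemma pow_trivialCofibrations (hT : IsLeftQuillen P.T) {n m : ℕ} (p : LevelPath n m) {A B : C}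
    {i : A ⟶ B} (hi : trivialCofibrations C i) : trivialCofibrations C ((P.pow p).map i) := by
  induction p with
  | refl => exact hi
  | step p h => exact hT.map_trivialCofibration _ h

end

variable [HasColimits C] [P.T.IsLeftAdjoint]

/-- Let `H p` be the subgroup acting on the power of `T`. Lifting problems are solved independently
on one representative of each coset in `Γ m` and transported along the coset by the action, so the
lifts themselves need no equivariance. -/
lemma llp_freeMap (hs : P.Commutes) (hs' : ∀ m, P.s m * P.s m = 1) (hP : P.IsFaithful)
    (W : MorphismProperty C) {n : ℕ} {A B : C} (i : A ⟶ B) {m : ℕ}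
    (hi : ∀ p : LevelPath n m, W.llp ((P.pow p).map i)) : W.llp (freeMap hs n i m) := by
  intro X Y q hq
  refine ⟨fun {f g} sq ↦ ?_⟩
  let H (p : LevelPath n m) : Subgroup (P.Γ m) := relSubgroup hs' p
  let r (p : LevelPath n m) (x : P.Γ m) : P.Γ m := (x : P.Γ m ⧸ H p).out
  have hr (p x h) (hh : h ∈ H p) : r p (x * h) = r p x := by
    simp only [r]
    rw [QuotientGroup.mk_mul_of_mem x hh]
  have hmem (p x) : (r p x)⁻¹ * x ∈ H p :=
    QuotientGroup.eq.1 (QuotientGroup.out_eq' (x : P.Γ m ⧸ H p))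
  choose φ hφ using hmem
  have hL (p x) : ∃ l : (P.pow p).obj B ⟶ X, (P.pow p).map i ≫ l = P.freeIn A p x ≫ f ∧
      l ≫ q = P.freeIn B p x ≫ g := by
    have := hi p q hq
    have sq' : CommSq (P.freeIn A p x ≫ f) ((P.pow p).map i) q (P.freeIn B p x ≫ g) := ⟨by
      rw [Category.assoc, sq.w, reassoc_of% freeIn_freeMap]⟩
    exact ⟨sq'.lift, sq'.fac_left, sq'.fac_right⟩
  choose L hL₁ hL₂ using hL
  obtain ⟨l, hl⟩ := P.exists_freeLevel_desc (A := B) (n := n)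
    (fun p x ↦ (φ p x).app B ≫ L p (r p x)) fun p x h ψ hψ ↦ by
      have h₁ := hr p x h ⟨ψ, hψ⟩
      -- Here faithfulness enters: both sides are related to the same group element, so transport
      -- from the representative does not depend on choices.
      have h₂ : φ p (x * h) = ψ ≫ φ p x := hP p ((r p (x * h))⁻¹ * (x * h)) _ _ (hφ p (x * h)) (by
        rw [h₁, ← mul_assoc]
        exact (hφ p x).mul hψ)
      rw [h₁, h₂, NatTrans.comp_app, Category.assoc]
  refine ⟨⟨⟨l, P.freeLevel_hom_ext fun p x ↦ ?_, P.freeLevel_hom_ext fun p x ↦ ?_⟩⟩⟩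
  · have := (φ p x).naturality i
    rw [reassoc_of% freeIn_freeMap, hl, reassoc_of% this, hL₁, ← Category.assoc,
      P.app_freeIn (hφ p x), mul_inv_cancel_left]
  · rw [reassoc_of% (hl p x), hL₂, ← Category.assoc, P.app_freeIn (hφ p x), mul_inv_cancel_left]

variable [CategoryWithFibrations C] [CategoryWithCofibrations C] [CategoryWithWeakEquivalences C]
  [IsModelCategory C]

/-- A category of spectra with the projective classes of maps is projective. -/
theorem isProjective_of_isEquivalence (hT : IsLeftQuillen P.T) (hs : P.Commutes)
    (hs' : ∀ m, P.s m * P.s m = 1) (hP : P.IsFaithful) {S : Type*} [Category.{v} S]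
    [CategoryWithFibrations S] [CategoryWithCofibrations S] [CategoryWithWeakEquivalences S]
    (Φ : S ⥤ ShapedSpectrum P) [Φ.IsEquivalence]
    (hfib : fibrations S = levelwise (fun n ↦ Φ ⋙ ev P n) (fibrations C))
    (hwe : weakEquivalences S = levelwise (fun n ↦ Φ ⋙ ev P n) (weakEquivalences C))
    (hcof : cofibrations S = (levelwise (fun n ↦ Φ ⋙ ev P n) (trivialFibrations C)).llp) :
    IsProjective (fun n ↦ Φ ⋙ ev P n) where
  hasLimits := Adjunction.has_limits_of_equivalence Φ
  hasColimits := Adjunction.has_colimits_of_equivalence Φ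
  preservesColimits n := inferInstance
  isIso X Y f hf :=
    have : IsIso (Φ.map f) := isIso_of_isIso_hom _ hf
    isIso_of_reflects_iso f Φ
  fibrations_eq := hfib
  weakEquivalences_eq := hwe
  cofibrations_eq := hcof
  exists_leftAdjoint n := by
    refine ⟨freeFunctor hs n ⋙ Φ.inv, ⟨(freeAdjunction hs n).comp Φ.asEquivalence.symm.toAdjunction⟩,
      fun m A B i ↦ ?_⟩
    have key (W : MorphismProperty C)
        (hi : ∀ p : LevelPath n m, W.llp ((P.pow p).map i)) :
        W.llp ((Φ ⋙ ev P m).map ((freeFunctor hs n ⋙ Φ.inv).map i)) := by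
      refine (W.llp.arrow_mk_iso_iff (Arrow.isoMk
        ((ev P m).mapIso (Φ.asEquivalence.counitIso.app _))
        ((ev P m).mapIso (Φ.asEquivalence.counitIso.app _)) ?_)).2 (llp_freeMap hs hs' hP W i hi)
      exact ((Functor.isoWhiskerRight Φ.asEquivalence.counitIso (ev P m)).hom.naturality
        ((freeFunctor hs n).map i)).symm
    constructor
    · intro hi
      rw [← trivialFibrations_llp]
      exact key _ fun p ↦ by rw [trivialFibrations_llp]; exact pow_cofibrations hT p hi
    · intro hi
      rw [← fibrations_llp]
      exact key _ fun p ↦ by rw [fibrations_llp]; exact pow_trivialCofibrations hT p hi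

end ShapedSpectrum


/-! ### Spectra for an endofunctor -/

/-- The shape of spectra without group actions. -/
def SpectrumShape.ofFunctor {C : Type u} [Category.{v} C] (G : C ⥤ C) : SpectrumShape C where
  T := G
  t := 𝟙 _
  Γ _ := Unit
  ι _ := 1
  s _ := 1

namespace Spectrum

open SpectrumShape

variable {C : Type u} [Category.{v} C] (G : C ⥤ C)

/-- Spectra without group actions are spectra with actions of trivial groups. -/
def toShapedSpectrum : Spectrum G ⥤ ShapedSpectrum (ofFunctor G) where
  obj X :=
    { X := X.X
      ρ _ := 1
      σ := X.σ
      σ_equivariant _ _ := by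
        simp only [MonoidHom.one_apply]
        refine (congrArg (· ≫ X.σ _) (G.map_id _)).trans ?_
        exact (Category.id_comp _).trans (Category.comp_id _).symm
      braid _ := by
        refine (Category.id_comp _).trans ?_
        simp only [MonoidHom.one_apply]
        exact _ ≫= (Category.comp_id _).symm }
  map f :=
    { hom := f.hom
      equivariant _ _ := (Category.id_comp _).trans (Category.comp_id _).symm
      comm := f.comm }

instance : (toShapedSpectrum G).IsEquivalence where
  faithful := ⟨fun h ↦ Hom.ext (congrArg ShapedSpectrum.Hom.hom h)⟩
  full := ⟨fun f ↦ ⟨⟨f.hom, f.comm⟩, rfl⟩⟩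
  essSurj := ⟨fun Y ↦ ⟨⟨Y.X, Y.σ⟩, ⟨eqToIso (by
    obtain ⟨X, ρ, σ, _, _⟩ := Y
    obtain rfl : ρ = fun _ ↦ 1 := by
      funext n
      ext g
      exact (congrArg _ (Subsingleton.elim (α := Unit) g 1)).trans (map_one (ρ n))
    rfl)⟩⟩⟩

lemma isFaithful_ofFunctor : (ofFunctor G).IsFaithful := by
  have h {n m : ℕ} {p : LevelPath n m} {g} {φ : (ofFunctor G).pow p ⟶ (ofFunctor G).pow p}
      (hφ : (ofFunctor G).Rel p g φ) : φ = 𝟙 _ := by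
    induction hφ with
    | one p => rfl
    | mul _ _ h₁ h₂ => rw [h₁, h₂, Category.comp_id]
    | twist p => rfl
    | whisker _ h =>
      rw [h]
      exact Functor.whiskerRight_id _
  intro n m p g φ ψ hφ hψ
  rw [h hφ, h hψ]

/-- Spectra for a left Quillen endofunctor. -/
theorem isProjective [CategoryWithFibrations C] [CategoryWithCofibrations C]
    [CategoryWithWeakEquivalences C] [IsModelCategory C] (hG : IsLeftQuillen G) :
    IsProjective (ev G) :=
  have : (ofFunctor G).T.IsLeftAdjoint := hG.isLeftAdjoint
  ShapedSpectrum.isProjective_of_isEquivalence (P := ofFunctor G) hG (fun _ _ ↦ rfl) (fun _ ↦ rfl)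
    (isFaithful_ofFunctor G) (toShapedSpectrum G) rfl rfl rfl

end Spectrum


/-! ### Coxeter relations and normal forms -/

section Coxeter

variable {M : Type*} [Monoid M]

/-- The product `t k * t (k + 1) * ⋯ * t (m - 1)`. -/
def ascendingProd (t : ℕ → M) (k : ℕ) : ℕ → M
  | 0 => 1
  | m + 1 => if k ≤ m then ascendingProd t k m * t m else 1

lemma ascendingProd_self (t : ℕ → M) (k : ℕ) : ascendingProd t k k = 1 := by
  cases k <;> simp [ascendingProd]

lemma ascendingProd_succ (t : ℕ → M) {k m : ℕ} (h : k ≤ m) :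
    ascendingProd t k (m + 1) = ascendingProd t k m * t m := by
  simp [ascendingProd, h]

lemma mul_ascendingProd (t : ℕ → M) {k m : ℕ} (h : k < m) :
    t k * ascendingProd t (k + 1) m = ascendingProd t k m := by
  induction m, h using Nat.le_induction with
  | base =>
    rw [ascendingProd_succ t le_rfl, Nat.succ_eq_add_one, ascendingProd_self, ascendingProd_self,
      mul_one, one_mul]
  | succ m h ih =>
    rw [ascendingProd_succ t h, ascendingProd_succ t (by omega), ← ih, mul_assoc]

/-- The Coxeter relations of adjacent transpositions of the numbers from `n` to `m - 1`. -/
structure CoxeterRelations (t : ℕ → M) (n m : ℕ) : Prop where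
  mul_self (a : ℕ) : n ≤ a → a + 1 < m → t a * t a = 1
  braid (a : ℕ) : n ≤ a → a + 2 < m → t a * t (a + 1) * t a = t (a + 1) * t a * t (a + 1)
  commute (a b : ℕ) : n ≤ a → a + 2 ≤ b → b + 1 < m → Commute (t a) (t b)

/-- The submonoid generated by `t a` for `n ≤ a < m - 1`. -/
def transpositionClosure (t : ℕ → M) (n m : ℕ) : Submonoid M :=
  Submonoid.closure {x | ∃ a, n ≤ a ∧ a + 1 < m ∧ t a = x}

lemma mem_transpositionClosure (t : ℕ → M) {n m a : ℕ} (h : n ≤ a) (h' : a + 1 < m) :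
    t a ∈ transpositionClosure t n m :=
  Submonoid.subset_closure ⟨a, h, h', rfl⟩

namespace CoxeterRelations

variable {t : ℕ → M} {n m : ℕ}

lemma of_succ (H : CoxeterRelations t n (m + 1)) : CoxeterRelations t n m where
  mul_self a h h' := H.mul_self a h (by omega)
  braid a h h' := H.braid a h (by omega)
  commute a b h h' h'' := H.commute a b h h' (by omega)

lemma commute_ascendingProd (H : CoxeterRelations t n (m + 1)) {a k : ℕ} (ha : n ≤ a)
    (hak : a + 2 ≤ k) (hkm : k ≤ m) : Commute (t a) (ascendingProd t k m) := by
  induction m, hkm using Nat.le_induction with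
  | base => rw [ascendingProd_self]; exact Commute.one_right _
  | succ m h ih =>
    rw [ascendingProd_succ t h]
    exact (ih H.of_succ).mul_right (H.commute _ _ ha (by omega) (by omega))

lemma commute_ascendingProd' (H : CoxeterRelations t n (m + 2)) {k : ℕ} (hk : n ≤ k)
    {r : ℕ} (hrm : r + 1 ≤ m) (hkr : k ≤ r) : Commute (t m) (ascendingProd t k r) := by
  induction r, hkr using Nat.le_induction with
  | base => rw [ascendingProd_self]; exact Commute.one_right _
  | succ r h ih =>
    rw [ascendingProd_succ t h]
    exact (ih (by omega)).mul_right (H.commute _ _ (by omega) (by omega) (by omega)).symm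

/-- The braid relation at `a`, `a + 1` changes the index by one, and all other factors commute past.
-/
lemma mul_ascendingProd_of_lt (H : CoxeterRelations t n (m + 1)) {a k : ℕ} (hk : n ≤ k)
    (hka : k ≤ a) (ham : a + 1 < m) :
    t (a + 1) * ascendingProd t k m = ascendingProd t k m * t a := by
  obtain ⟨d, rfl⟩ := Nat.exists_eq_add_of_le ham
  clear ham
  induction d with
  | zero =>
    have h₁ := (H.commute_ascendingProd' hk le_rfl hka).eq
    have h₂ := H.braid a (by omega) (by omega)
    simp only [Nat.succ_eq_add_one, add_zero]
    rw [ascendingProd_succ t (by omega), ascendingProd_succ t hka, ← mul_assoc, ← mul_assoc, h₁,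
      mul_assoc, mul_assoc, ← mul_assoc (t (a + 1)), ← h₂]
    simp only [mul_assoc]
  | succ d ih =>
    have h₁ := (H.commute a (a + 1 + 1 + d) (by omega) (by omega) (by omega)).eq
    change t (a + 1) * ascendingProd t k (a + 1 + 1 + d + 1) =
      ascendingProd t k (a + 1 + 1 + d + 1) * t a
    rw [ascendingProd_succ t (by omega), ← mul_assoc]
    have := ih H.of_succ
    simp only [Nat.succ_eq_add_one] at this
    rw [this, mul_assoc, h₁, mul_assoc]

/-- Left multiplication by `t a` preserves this normal form: depending on whether `a + 2 ≤ k`, `a +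
1 = k`, `a = k` or `a > k`, it passes through, lengthens or shortens the product, or passes through
with its index lowered by one. -/
lemma exists_eq_ascendingProd_mul (H : CoxeterRelations t n (m + 1)) (hnm : n ≤ m) {x : M}
    (hx : x ∈ transpositionClosure t n (m + 1)) :
    ∃ k y, n ≤ k ∧ k ≤ m ∧ y ∈ transpositionClosure t n m ∧ x = ascendingProd t k m * y := by
  induction hx using Submonoid.closure_induction_left with
  | one => exact ⟨m, 1, hnm, le_rfl, one_mem _, by rw [ascendingProd_self, one_mul]⟩
  | mul_left z hz w hw h =>
    obtain ⟨a, ha, ham, rfl⟩ := hz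
    obtain ⟨k, y, hk, hkm, hy, rfl⟩ := h
    by_cases h₁ : a + 2 ≤ k
    · exact ⟨k, t a * y, hk, hkm, mul_mem (mem_transpositionClosure t ha (by omega)) hy, by
        rw [← mul_assoc, (H.commute_ascendingProd ha h₁ hkm).eq, mul_assoc]⟩
    by_cases h₂ : a + 1 = k
    · subst h₂
      exact ⟨a, y, ha, by omega, hy, by rw [← mul_assoc, mul_ascendingProd t (by omega)]⟩
    by_cases h₃ : a = k
    · subst h₃
      exact ⟨a + 1, y, by omega, by omega, hy, by
        rw [← mul_ascendingProd t (by omega), ← mul_assoc, ← mul_assoc, H.mul_self a ha ham,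
          one_mul]⟩
    · obtain ⟨a, rfl⟩ := Nat.exists_eq_succ_of_ne_zero (show a ≠ 0 by omega)
      exact ⟨k, t a * y, hk, hkm, mul_mem (mem_transpositionClosure t (by omega) (by omega)) hy, by
        rw [← mul_assoc, ← mul_assoc, ← H.mul_ascendingProd_of_lt hk (by omega) (by omega)]⟩

variable (π : M →* Equiv.Perm ℕ)

lemma map_ascendingProd_apply (hπ : ∀ a, n ≤ a → a + 1 < m + 1 → π (t a) = Equiv.swap a (a + 1))
    {k : ℕ} (hk : n ≤ k) (hkm : k ≤ m) : π (ascendingProd t k m) m = k := by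
  induction m, hkm using Nat.le_induction with
  | base => simp [ascendingProd_self]
  | succ m h ih =>
    rw [ascendingProd_succ t h, map_mul, Equiv.Perm.mul_apply, hπ m (by omega) (by omega),
      Equiv.swap_apply_right, ih fun a ha ha' ↦ hπ a ha (by omega)]

lemma map_apply_of_mem (hπ : ∀ a, n ≤ a → a + 1 < m → π (t a) = Equiv.swap a (a + 1)) {x : M}
    (hx : x ∈ transpositionClosure t n m) : π x m = m := by
  induction hx using Submonoid.closure_induction with
  | mem x h =>
    obtain ⟨a, ha, ham, rfl⟩ := h
    rw [hπ a ha ham, Equiv.swap_apply_of_ne_of_ne (by omega) (by omega)]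
  | one => simp
  | mul x y _ _ hx hy => rw [map_mul, Equiv.Perm.mul_apply, hy, hx]

/-- A monoid generated by elements which satisfy the Coxeter relations and act by the adjacent
transpositions acts faithfully. -/
theorem eq_of_map_eq (H : CoxeterRelations t n m) (hnm : n ≤ m)
    (hπ : ∀ a, n ≤ a → a + 1 < m → π (t a) = Equiv.swap a (a + 1)) {x y : M}
    (hx : x ∈ transpositionClosure t n m) (hy : y ∈ transpositionClosure t n m)
    (h : π x = π y) : x = y := by
  induction m, hnm using Nat.le_induction generalizing x y with
  | base =>
    have : transpositionClosure t n n = ⊥ := by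
      refine le_bot_iff.1 (Submonoid.closure_le.2 ?_)
      rintro _ ⟨a, h, h', _⟩
      omega
    rw [this, Submonoid.mem_bot] at hx hy
    rw [hx, hy]
  | succ m hnm ih =>
    have hπ' : ∀ a, n ≤ a → a + 1 < m → π (t a) = Equiv.swap a (a + 1) :=
      fun a ha ha' ↦ hπ a ha (by omega)
    obtain ⟨k, x', hk, hkm, hx', rfl⟩ := H.exists_eq_ascendingProd_mul hnm hx
    obtain ⟨l, y', hl, hlm, hy', rfl⟩ := H.exists_eq_ascendingProd_mul hnm hy
    -- The second factor fixes `m` and the ascending product sends `m` to `k`, so `k` can be read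
    -- off from the permutation.
    obtain rfl : k = l := by
      have := congrArg (fun g ↦ g m) h
      simpa [map_apply_of_mem π hπ' hx', map_apply_of_mem π hπ' hy',
        map_ascendingProd_apply π hπ hk hkm, map_ascendingProd_apply π hπ hl hlm] using this
    rw [map_mul, map_mul, mul_right_inj] at h
    rw [ih H.of_succ hπ' hx' hy' h]

end CoxeterRelations

end Coxeter

/-! ### Coherence of the actions on powers of `T` -/

lemma LevelPath.le {n m : ℕ} (p : LevelPath n m) : n ≤ m := by
  induction p with
  | refl => rfl
  | step p h => omega

namespace SpectrumShape

variable {C : Type u} [Category.{v} C] (P : SpectrumShape C) {n : ℕ}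

/-- The action of the transposition of `a` and `a + 1` on a power of `T`. -/
def twistAt : {m : ℕ} → (p : LevelPath n m) → ℕ → End (P.pow p)
  -- With fewer than two factors there is nothing to transpose, and the value is irrelevant. Factors
  -- are numbered by absolute levels, so that whiskering does not shift the index.
  | _, .refl, _ => 1
  | _, .step .refl, _ => 1
  | _, .step (.step (m := k) q), a =>
      if a = k then P.twist q else Functor.whiskerRight (twistAt q.step a) P.T

/-- Whiskering with `T` as a homomorphism. -/
def whisker {m : ℕ} (p : LevelPath n m) : End (P.pow p) →* End (P.pow p.step) where
  toFun φ := Functor.whiskerRight φ P.T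
  map_one' := Functor.whiskerRight_id _
  map_mul' φ ψ := Functor.whiskerRight_comp ψ φ P.T

lemma twistAt_step {m : ℕ} (p : LevelPath n m) {a : ℕ} (ha : a + 1 < m) :
    P.twistAt p.step a = P.whisker p (P.twistAt p a) := by
  cases p with
  | refl => exact (map_one (P.whisker _)).symm
  | step p => exact if_neg (by omega)

lemma twistAt_step_step {m : ℕ} (p : LevelPath n m) : P.twistAt p.step.step m = P.twist p :=
  if_pos rfl

variable {P}

/-- Only relations involving the last transposition are new at each step: its square is `ht`, its
braid relation is the Yang-Baxter equation, and its commutation with distant ones is naturality of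
`t`. -/
lemma coxeterRelations_twistAt (ht : P.t ≫ P.t = 𝟙 _)
    (hP : ∀ A, P.t.app (P.T.obj A) ≫ P.T.map (P.t.app A) ≫ P.t.app (P.T.obj A) =
      P.T.map (P.t.app A) ≫ P.t.app (P.T.obj A) ≫ P.T.map (P.t.app A))
    {m : ℕ} (p : LevelPath n m) : CoxeterRelations (P.twistAt p) n m := by
  induction p with
  | refl =>
    exact ⟨fun a _ _ ↦ by omega, fun a _ _ ↦ by omega, fun a b _ _ _ ↦ by omega⟩
  | @step m p H =>
    constructor
    · intro a ha ham
      by_cases h : a + 1 < m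
      · rw [P.twistAt_step p h, ← map_mul, H.mul_self a ha h, map_one]
      · cases p with
        | refl => omega
        | @step m q =>
          obtain rfl : a = m := by omega
          rw [P.twistAt_step_step]
          refine NatTrans.ext (funext fun A ↦ ?_)
          exact NatTrans.congr_app ht _
    · intro a ha ham
      by_cases h : a + 2 < m
      · rw [P.twistAt_step p h, P.twistAt_step p (by omega), ← map_mul, ← map_mul, H.braid a ha h,
          map_mul, map_mul]
      · cases p with
        | refl => omega
        | @step m q =>
          cases q with
          | refl => omega
          | @step m r =>
            obtain rfl : a = m := by omega
            rw [P.twistAt_step_step, P.twistAt_step _ (by omega), P.twistAt_step_step]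
            refine NatTrans.ext (funext fun A ↦ ?_)
            exact (hP ((P.pow r).obj A)).symm
    · intro a b ha hab hb
      by_cases h : b + 1 < m
      · rw [P.twistAt_step p h, P.twistAt_step p (by omega)]
        exact (H.commute a b ha hab h).map (P.whisker p)
      · cases p with
        | refl => omega
        | @step m q =>
          obtain rfl : b = m := by omega
          rw [P.twistAt_step_step, P.twistAt_step _ (by omega), P.twistAt_step _ (by omega)]
          refine NatTrans.ext (funext fun A ↦ ?_)
          exact (P.t.naturality ((P.twistAt q a).app A)).symm

/-- If `Γ m` acts on the natural numbers, with `s m` acting as the transposition of `m` and `m + 1`,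
and `t` is an involution which satisfies the Yang-Baxter equation, then the actions on the powers
of `T` are well defined. -/
theorem isFaithful_of_yangBaxter (e : ∀ m, P.Γ m →* Equiv.Perm ℕ)
    (he : ∀ m g, e (m + 1) (P.ι m g) = e m g)
    (he' : ∀ m, e (m + 2) (P.s m) = Equiv.swap m (m + 1)) (ht : P.t ≫ P.t = 𝟙 _)
    (hP : ∀ A, P.t.app (P.T.obj A) ≫ P.T.map (P.t.app A) ≫ P.t.app (P.T.obj A) =
      P.T.map (P.t.app A) ≫ P.t.app (P.T.obj A) ≫ P.T.map (P.t.app A)) : P.IsFaithful := by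
  -- In the product monoid, the pairs of a permutation and an endomorphism satisfy the Coxeter
  -- relations. A pair generated by them is determined by its first component, which is the
  -- uniqueness sought.
  let t {n m : ℕ} (p : LevelPath n m) (a : ℕ) : Equiv.Perm ℕ × End (P.pow p) :=
    (Equiv.swap a (a + 1), P.twistAt p a)
  have H {n m : ℕ} (p : LevelPath n m) : CoxeterRelations (t p) n m := by
    have H := coxeterRelations_twistAt ht hP p
    refine ⟨fun a h h' ↦ Prod.ext (Equiv.swap_mul_self _ _) (H.mul_self a h h'),
      fun a h h' ↦ Prod.ext ?_ (H.braid a h h'),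
      fun a b h h' h'' ↦ Prod.ext ?_ (H.commute a b h h' h'').eq⟩
    · change Equiv.swap a (a + 1) * Equiv.swap (a + 1) (a + 2) * Equiv.swap a (a + 1) =
        Equiv.swap (a + 1) (a + 2) * Equiv.swap a (a + 1) * Equiv.swap (a + 1) (a + 2)
      have h₁ := Equiv.swap_mul_swap_mul_swap (show a + 2 ≠ a + 1 by omega)
        (show a + 2 ≠ a by omega)
      rw [Equiv.swap_comm (a + 1) a, Equiv.swap_comm (a + 2) (a + 1),
        Equiv.swap_comm a (a + 2)] at h₁
      exact h₁.trans
        (Equiv.swap_mul_swap_mul_swap (show a ≠ a + 1 by omega) (show a ≠ a + 2 by omega)).symm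
    · exact (Equiv.Perm.Disjoint.commute (Equiv.Perm.disjoint_swap_swap (by
        simp
        omega))).eq
  have mem {n m : ℕ} {p : LevelPath n m} {h : P.Γ m} {φ : P.pow p ⟶ P.pow p}
      (hφ : P.Rel p h φ) : (e m h, φ) ∈ transpositionClosure (t p) n m := by
    induction hφ with
    | one p =>
      rw [map_one]
      exact one_mem _
    | mul _ _ h₁ h₂ =>
      rw [map_mul]
      exact mul_mem h₁ h₂
    | @twist m p =>
      have := mem_transpositionClosure (t p.step.step) p.le (show m + 1 < m + 2 by omega)
      simp only [t] at this
      rwa [P.twistAt_step_step, ← he'] at this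
    | @whisker m p g φ _ h =>
      rw [he]
      have : transpositionClosure (t p) n m ≤ (transpositionClosure (t p.step) n (m + 1)).comap
          ((MonoidHom.id _).prodMap (P.whisker p)) := by
        refine Submonoid.closure_le.2 ?_
        rintro _ ⟨a, ha, ham, rfl⟩
        have := mem_transpositionClosure (t p.step) ha (show a + 1 < m + 1 by omega)
        simp only [t] at this
        rwa [P.twistAt_step p ham] at this
      exact this h
  intro n m p h φ ψ hφ hψ
  exact congrArg Prod.snd ((H p).eq_of_map_eq (MonoidHom.fst _ _) p.le (fun _ _ _ ↦ rfl) (mem hφ)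
    (mem hψ) rfl)

end SpectrumShape


/-! ### Block permutations -/

section BlockPerm

lemma blockPerm_castAdd {m n : ℕ} (g : Equiv.Perm (Fin m)) (h : Equiv.Perm (Fin n)) (i : Fin m) :
    blockPerm g h (Fin.castAdd n i) = Fin.castAdd n (g i) := by
  simp [blockPerm, Equiv.permCongr_apply]

lemma blockPerm_natAdd {m n : ℕ} (g : Equiv.Perm (Fin m)) (h : Equiv.Perm (Fin n)) (i : Fin n) :
    blockPerm g h (Fin.natAdd m i) = Fin.natAdd m (h i) := by
  simp [blockPerm, Equiv.permCongr_apply]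

lemma perm_ext_add {m n : ℕ} {g h : Equiv.Perm (Fin (m + n))}
    (h₁ : ∀ i, g (Fin.castAdd n i) = h (Fin.castAdd n i))
    (h₂ : ∀ i, g (Fin.natAdd m i) = h (Fin.natAdd m i)) : g = h :=
  Equiv.ext fun i ↦ Fin.addCases h₁ h₂ i

@[simp]
lemma blockPerm_one_one (m n : ℕ) :
    blockPerm (1 : Equiv.Perm (Fin m)) (1 : Equiv.Perm (Fin n)) = 1 :=
  perm_ext_add (fun i ↦ by simp [blockPerm_castAdd]) (fun i ↦ by simp [blockPerm_natAdd])

lemma blockPerm_mul_blockPerm {m n : ℕ} (g g' : Equiv.Perm (Fin m)) (h h' : Equiv.Perm (Fin n)) :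
    blockPerm g h * blockPerm g' h' = blockPerm (g * g') (h * h') :=
  perm_ext_add (fun i ↦ by simp [blockPerm_castAdd]) (fun i ↦ by simp [blockPerm_natAdd])

lemma blockPerm_zero {m : ℕ} (g : Equiv.Perm (Fin m)) (h : Equiv.Perm (Fin 0)) :
    blockPerm g h = g :=
  perm_ext_add (fun _ ↦ blockPerm_castAdd _ _ _) (fun i ↦ i.elim0)

/-- The two sides permute types that are not definitionally equal for general `p`, so only values
are compared; for `p` equal to `1` or `2` the types agree and the equality becomes one of
permutations. -/
lemma blockPerm_assoc {m n p : ℕ} (g : Equiv.Perm (Fin m)) (h : Equiv.Perm (Fin n))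
    (k : Equiv.Perm (Fin p)) (i : Fin (m + n + p)) :
    (blockPerm (blockPerm g h) k i : ℕ) =
      blockPerm g (blockPerm h k) (Fin.cast (Nat.add_assoc m n p) i) := by
  induction i using Fin.addCases with
  | left i =>
    induction i using Fin.addCases with
    | left i =>
      have : Fin.cast (Nat.add_assoc m n p) (Fin.castAdd p (Fin.castAdd n i)) =
        Fin.castAdd (n + p) i := rfl
      rw [this, blockPerm_castAdd, blockPerm_castAdd, blockPerm_castAdd]
      rfl
    | right i =>
      have : Fin.cast (Nat.add_assoc m n p) (Fin.castAdd p (Fin.natAdd m i)) =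
        Fin.natAdd m (Fin.castAdd p i) := rfl
      rw [this, blockPerm_castAdd, blockPerm_natAdd, blockPerm_natAdd, blockPerm_castAdd]
      rfl
  | right i =>
    have : Fin.cast (Nat.add_assoc m n p) (Fin.natAdd (m + n) i) =
      Fin.natAdd m (Fin.natAdd n i) := Fin.ext (Nat.add_assoc m n i)
    rw [this, blockPerm_natAdd, blockPerm_natAdd, blockPerm_natAdd]
    exact Nat.add_assoc _ _ _

lemma blockPerm_blockPerm_one {m n : ℕ} (g : Equiv.Perm (Fin m)) (h : Equiv.Perm (Fin n))
    (k : Equiv.Perm (Fin 1)) :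
    blockPerm (m := m + n) (n := 1) (blockPerm g h) k =
      blockPerm (m := m) (n := n + 1) g (blockPerm h k) :=
  Equiv.ext fun i ↦ Fin.ext (blockPerm_assoc g h k i)

lemma blockPerm_blockPerm_two {m n : ℕ} (g : Equiv.Perm (Fin m)) (h : Equiv.Perm (Fin n))
    (k : Equiv.Perm (Fin 2)) :
    blockPerm (m := m + n) (n := 2) (blockPerm g h) k =
      blockPerm (m := m) (n := n + 2) g (blockPerm h k) :=
  Equiv.ext fun i ↦ Fin.ext (blockPerm_assoc g h k i)

lemma blockPerm_blockPerm_one_one {m : ℕ} (g : Equiv.Perm (Fin m)) :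
    blockPerm (m := m + 1) (n := 1) (blockPerm g (1 : Equiv.Perm (Fin 1))) 1 =
      blockPerm (m := m) (n := 2) g 1 := by
  refine (blockPerm_blockPerm_one g 1 1).trans ?_
  rw [blockPerm_one_one]

/-- The permutations of the natural numbers which extend permutations of `Fin n`. -/
def extendPerm (n : ℕ) : Equiv.Perm (Fin n) →* Equiv.Perm ℕ :=
  Equiv.Perm.extendDomainHom Fin.equivSubtype

lemma extendPerm_apply {n : ℕ} (g : Equiv.Perm (Fin n)) (i : Fin n) :
    extendPerm n g i = g i :=
  Equiv.Perm.extendDomain_apply_image g Fin.equivSubtype i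

lemma extendPerm_apply_of_le {n : ℕ} (g : Equiv.Perm (Fin n)) {i : ℕ} (hi : n ≤ i) :
    extendPerm n g i = i :=
  Equiv.Perm.extendDomain_apply_not_subtype g Fin.equivSubtype (by omega)

lemma extendPerm_blockPerm_one {m n : ℕ} (g : Equiv.Perm (Fin m)) :
    extendPerm (m + n) (blockPerm g (1 : Equiv.Perm (Fin n))) = extendPerm m g := by
  ext i
  by_cases h : m + n ≤ i
  · rw [extendPerm_apply_of_le _ h, extendPerm_apply_of_le _ (by omega)]
  · obtain ⟨i, rfl⟩ : ∃ j : Fin (m + n), j = i := ⟨⟨i, by omega⟩, rfl⟩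
    rw [extendPerm_apply]
    refine Fin.addCases (fun i ↦ ?_) (fun i ↦ ?_) i
    · rw [blockPerm_castAdd, Fin.val_castAdd, Fin.val_castAdd, extendPerm_apply]
    · rw [blockPerm_natAdd, extendPerm_apply_of_le _ (by simp), Equiv.Perm.one_apply]

lemma extendPerm_blockPerm_swap (m : ℕ) :
    extendPerm (m + 2) (blockPerm (1 : Equiv.Perm (Fin m)) (Equiv.swap 0 1 : Equiv.Perm (Fin 2))) =
      Equiv.swap m (m + 1) := by
  ext i
  by_cases h : m + 2 ≤ i
  · rw [extendPerm_apply_of_le _ h, Equiv.swap_apply_of_ne_of_ne (by omega) (by omega)]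
  · obtain ⟨i, rfl⟩ : ∃ j : Fin (m + 2), j = i := ⟨⟨i, by omega⟩, rfl⟩
    rw [extendPerm_apply]
    refine Fin.addCases (fun i ↦ ?_) (fun i ↦ ?_) i
    · rw [blockPerm_castAdd, Equiv.Perm.one_apply, Fin.val_castAdd,
        Equiv.swap_apply_of_ne_of_ne (by omega) (by omega)]
    · rw [blockPerm_natAdd]
      fin_cases i <;> simp

end BlockPerm

/-! ### The shape of symmetric spectra -/

section

variable {C : Type u} [Category.{v} C] {D : Type u'} [Category.{v} D] [MonoidalCategory D]
  [MonoidalRightAction D C]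

open MonoidalRightAction

lemma assoc_hom_comp_left {X Y : C} (f : X ⟶ Y) (K L : D) :
    (αᵣ X K L).hom ≫ (f ⊵ᵣ K) ⊵ᵣ L = f ⊵ᵣ (K ⊗ L) ≫ (αᵣ Y K L).hom := by
  simp

variable [SymmetricCategory D]

namespace SymmetricSpectrum

/-- The symmetry of the action of `K ⊗ K`. -/
def symm (K : D) (X : C) : (X ⊙ᵣ K) ⊙ᵣ K ⟶ (X ⊙ᵣ K) ⊙ᵣ K :=
  (αᵣ X K K).inv ≫ X ⊴ᵣ (β_ K K).hom ≫ (αᵣ X K K).hom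

lemma symm_naturality (K : D) {X Y : C} (f : X ⟶ Y) :
    (f ⊵ᵣ K) ⊵ᵣ K ≫ symm K Y = symm K X ≫ (f ⊵ᵣ K) ⊵ᵣ K := by
  rw [← cancel_epi (αᵣ X K K).hom, reassoc_of% assoc_hom_comp_left, symm, Iso.hom_inv_id_assoc, symm,
    Category.assoc, Category.assoc, assoc_hom_comp_left, Iso.hom_inv_id_assoc,
    action_exchange_assoc]

end SymmetricSpectrum

variable (C) in
/-- The shape of symmetric spectra. -/
def SpectrumShape.symmetric (K : D) : SpectrumShape C where
  T := actionRight C K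
  t :=
    { app X := SymmetricSpectrum.symm K X
      naturality _ _ f := SymmetricSpectrum.symm_naturality K f }
  Γ n := Equiv.Perm (Fin n)
  ι n :=
    { toFun g := blockPerm g (1 : Equiv.Perm (Fin 1))
      map_one' := blockPerm_one_one _ _
      map_mul' g h := by rw [blockPerm_mul_blockPerm, mul_one] }
  s n := blockPerm (1 : Equiv.Perm (Fin n)) (Equiv.swap 0 1 : Equiv.Perm (Fin 2))

namespace SymmetricSpectrum

open SpectrumShape

variable (K : D)

/-- The braiding of the last two factors. -/
def braidLast (L : D) : (L ⊗ K) ⊗ K ⟶ (L ⊗ K) ⊗ K :=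
  (α_ L K K).hom ≫ L ◁ (β_ K K).hom ≫ (α_ L K K).inv

/-- The rebracketing of the action of a triple tensor product. -/
def unbracket (X : C) (L M N : D) : X ⊙ᵣ ((L ⊗ M) ⊗ N) ⟶ ((X ⊙ᵣ L) ⊙ᵣ M) ⊙ᵣ N :=
  (αᵣ X (L ⊗ M) N).hom ≫ (αᵣ X L M).hom ⊵ᵣ N

instance (X : C) (L M N : D) : IsIso (unbracket X L M N) := by
  unfold unbracket
  infer_instance

lemma braidLast_unbracket (X : C) (L : D) :
    X ⊴ᵣ braidLast K L ≫ unbracket X L K K = unbracket X L K K ≫ symm K (X ⊙ᵣ L) := by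
  rw [unbracket, ← actionHom_associator]
  simp [braidLast, symm, -actionHom_associator, -actionHom_associator_assoc]

lemma braid_whisker_unbracket (X : C) :
    X ⊴ᵣ ((β_ K K).hom ▷ K) ≫ unbracket X K K K = unbracket X K K K ≫ symm K X ⊵ᵣ K := by
  simp [unbracket, symm]

/-- Rebracketing by `unbracket` turns both sides into the action on `X` of an endomorphism of `(K ⊗
K) ⊗ K`, where the Yang-Baxter equation of the braided category applies. -/
lemma symm_yangBaxter (X : C) :
    symm K (X ⊙ᵣ K) ≫ symm K X ⊵ᵣ K ≫ symm K (X ⊙ᵣ K) =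
      symm K X ⊵ᵣ K ≫ symm K (X ⊙ᵣ K) ≫ symm K X ⊵ᵣ K := by
  have h : braidLast K K ≫ (β_ K K).hom ▷ K ≫ braidLast K K =
      (β_ K K).hom ▷ K ≫ braidLast K K ≫ (β_ K K).hom ▷ K := by
    have := BraidedCategory.yang_baxter K K K
    rw [← cancel_epi (α_ K K K).inv, ← cancel_mono (α_ K K K).hom]
    simpa [braidLast] using this.symm
  rw [← cancel_epi (unbracket X K K K), ← reassoc_of% braidLast_unbracket,
    ← reassoc_of% braid_whisker_unbracket, ← braidLast_unbracket, ← reassoc_of% braid_whisker_unbracket,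
    ← reassoc_of% braidLast_unbracket, ← braid_whisker_unbracket]
  simp only [← actionHomRight_comp_assoc]
  rw [h]

lemma symm_symm (X : C) : symm K X ≫ symm K X = 𝟙 _ := by
  simp [symm, ← actionHomRight_comp_assoc]

lemma isFaithful_symmetric : (SpectrumShape.symmetric C K).IsFaithful :=
  isFaithful_of_yangBaxter (P := SpectrumShape.symmetric C K) extendPerm
    (fun _ g ↦ extendPerm_blockPerm_one g) extendPerm_blockPerm_swap
    (NatTrans.ext (funext fun X ↦ symm_symm K X)) (fun X ↦ symm_yangBaxter K X)

lemma blockPerm_swap_mul {m : ℕ} (g : Equiv.Perm (Fin m)) :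
    blockPerm 1 (Equiv.swap 0 1 : Equiv.Perm (Fin 2)) *
      blockPerm (m := m + 1) (n := 1) (blockPerm g (1 : Equiv.Perm (Fin 1))) 1 =
    blockPerm (m := m + 1) (n := 1) (blockPerm g (1 : Equiv.Perm (Fin 1))) 1 *
      blockPerm 1 (Equiv.swap 0 1 : Equiv.Perm (Fin 2)) := by
  rw [blockPerm_blockPerm_one_one, blockPerm_mul_blockPerm, blockPerm_mul_blockPerm, one_mul,
    mul_one, one_mul, mul_one]

lemma commutes_symmetric : (SpectrumShape.symmetric C K).Commutes :=
  fun _ g ↦ blockPerm_swap_mul g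

lemma blockPerm_swap_mul_self (m : ℕ) :
    blockPerm (1 : Equiv.Perm (Fin m)) (Equiv.swap 0 1 : Equiv.Perm (Fin 2)) *
      blockPerm 1 (Equiv.swap 0 1 : Equiv.Perm (Fin 2)) = 1 := by
  rw [blockPerm_mul_blockPerm, one_mul, Equiv.swap_mul_self, blockPerm_one_one]

end SymmetricSpectrum

end


/-! ### Symmetric spectra as spectra of the symmetric shape -/

open MonoidalRightAction

section

variable {C : Type u} [Category.{v} C] {D : Type u'} [Category.{v} D] [MonoidalCategory D]
  [MonoidalRightAction D C]

section

variable {K : D} {X : ℕ → C} (σ : ∀ n, X n ⊙ᵣ K ⟶ X (n + 1))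

lemma iteratedStructureMap_add_two (n p : ℕ) :
    iteratedStructureMap K X σ n (p + 2) =
      (SymmetricSpectrum.unbracket (X n) (tensorPower K p) K K ≫
        (iteratedStructureMap K X σ n p ⊵ᵣ K) ⊵ᵣ K) ≫ σ (n + p) ⊵ᵣ K ≫ σ (n + p + 1) := by
  change (αᵣ (X n) (tensorPower K p ⊗ K) K).hom ≫ ((αᵣ (X n) (tensorPower K p) K).hom ≫
    iteratedStructureMap K X σ n p ⊵ᵣ K ≫ σ (n + p)) ⊵ᵣ K ≫ σ (n + p + 1) = _
  simp [SymmetricSpectrum.unbracket]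

variable [SymmetricCategory D]

lemma braidLast_iteratedStructureMap (n p : ℕ) :
    X n ⊴ᵣ SymmetricSpectrum.braidLast K (tensorPower K p) ≫
      iteratedStructureMap K X σ n (p + 2) =
    (SymmetricSpectrum.unbracket (X n) (tensorPower K p) K K ≫
      (iteratedStructureMap K X σ n p ⊵ᵣ K) ⊵ᵣ K) ≫
        SymmetricSpectrum.symm K (X (n + p)) ≫ σ (n + p) ⊵ᵣ K ≫ σ (n + p + 1) := by
  have h := SymmetricSpectrum.symm_naturality K (iteratedStructureMap K X σ n p)
  rw [iteratedStructureMap_add_two, Category.assoc, Category.assoc, reassoc_of% h,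
    reassoc_of% SymmetricSpectrum.braidLast_unbracket]

variable (ρ : ∀ n, Equiv.Perm (Fin n) →* End (X n))
  (hσ : ∀ n (g : Equiv.Perm (Fin n)), (ρ n g : X n ⟶ X n) ⊵ᵣ K ≫ σ n =
    σ n ≫ ρ (n + 1) (blockPerm g (1 : Equiv.Perm (Fin 1))))

include hσ

omit [SymmetricCategory D] in
lemma actionHomLeft_iteratedStructureMap (n p : ℕ) (g : Equiv.Perm (Fin n)) :
    (ρ n g : X n ⟶ X n) ⊵ᵣ tensorPower K p ≫ iteratedStructureMap K X σ n p =
      iteratedStructureMap K X σ n p ≫ ρ (n + p) (blockPerm g 1) := by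
  induction p with
  | zero =>
    rw [blockPerm_zero]
    exact (actionUnitIso_hom_naturality _).symm
  | succ p h =>
    have h' := hσ (n + p) (blockPerm g 1)
    rw [blockPerm_blockPerm_one, blockPerm_one_one] at h'
    change _ ⊵ᵣ (tensorPower K p ⊗ K) ≫ (αᵣ (X n) (tensorPower K p) K).hom ≫
      iteratedStructureMap K X σ n p ⊵ᵣ K ≫ σ (n + p) =
        ((αᵣ (X n) (tensorPower K p) K).hom ≫
          iteratedStructureMap K X σ n p ⊵ᵣ K ≫ σ (n + p)) ≫ _
    rw [← reassoc_of% assoc_hom_comp_left, ← comp_actionHomLeft_assoc, h, comp_actionHomLeft_assoc, h',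
      Category.assoc, Category.assoc]
    rfl

/-- Induction on the generation of `TensorPerm`: a braiding of the last factors is the braid
condition at level `n + p`, and whiskering is equivariance of one structure map. -/
lemma actionHomRight_iteratedStructureMap
    (hρ : ∀ n, SymmetricSpectrum.symm K (X n) ≫ σ n ⊵ᵣ K ≫ σ (n + 1) =
      σ n ⊵ᵣ K ≫ σ (n + 1) ≫ ρ (n + 2) (blockPerm 1 (Equiv.swap 0 1 : Equiv.Perm (Fin 2))))
    (n : ℕ) {p : ℕ} {h : Equiv.Perm (Fin p)} {φ : tensorPower K p ⟶ tensorPower K p}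
    (hφ : TensorPerm K p h φ) :
    X n ⊴ᵣ φ ≫ iteratedStructureMap K X σ n p =
      iteratedStructureMap K X σ n p ≫ ρ (n + p) (blockPerm 1 h) := by
  induction hφ with
  | one p =>
    rw [blockPerm_one_one, map_one, actionHomRight_id, Category.id_comp]
    exact (Category.comp_id _).symm
  | @mul p g h φ ψ _ _ h₁ h₂ =>
    have := blockPerm_mul_blockPerm (1 : Equiv.Perm (Fin n)) 1 g h
    rw [one_mul] at this
    rw [← this, map_mul, actionHomRight_comp_assoc, h₁, reassoc_of% h₂]
    rfl
  | braid p =>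
    have h₁ := hρ (n + p)
    have h₂ : blockPerm (m := n + p) (n := 2) 1 (Equiv.swap 0 1) =
        blockPerm (m := n) (n := p + 2) 1 (blockPerm 1 (Equiv.swap 0 1)) := by
      rw [← blockPerm_blockPerm_two, blockPerm_one_one]
    rw [h₂] at h₁
    refine (braidLast_iteratedStructureMap σ n p).trans ?_
    rw [h₁, iteratedStructureMap_add_two]
    exact (_ ≫= (Category.assoc _ _ _).symm).trans (Category.assoc _ _ _).symm
  | @whisker p g φ _ h =>
    have h' := hσ (n + p) (blockPerm 1 g)
    rw [blockPerm_blockPerm_one] at h'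
    change X n ⊴ᵣ φ ▷ K ≫ (αᵣ (X n) (tensorPower K p) K).hom ≫
      iteratedStructureMap K X σ n p ⊵ᵣ K ≫ σ (n + p) =
        ((αᵣ (X n) (tensorPower K p) K).hom ≫
          iteratedStructureMap K X σ n p ⊵ᵣ K ≫ σ (n + p)) ≫ _
    rw [actionHomRight_whiskerRight, Category.assoc, Category.assoc, Iso.inv_hom_id_assoc,
      ← comp_actionHomLeft_assoc, h, comp_actionHomLeft_assoc, h', Category.assoc, Category.assoc]
    rfl

lemma iteratedStructureMap_equivariant
    (hρ : ∀ n, SymmetricSpectrum.symm K (X n) ≫ σ n ⊵ᵣ K ≫ σ (n + 1) =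
      σ n ⊵ᵣ K ≫ σ (n + 1) ≫ ρ (n + 2) (blockPerm 1 (Equiv.swap 0 1 : Equiv.Perm (Fin 2))))
    (n p : ℕ) (g : Equiv.Perm (Fin n)) (h : Equiv.Perm (Fin p))
    (φ : tensorPower K p ⟶ tensorPower K p) (hφ : TensorPerm K p h φ) :
    ((ρ n g : X n ⟶ X n) ⊙ᵣₘ φ) ≫ iteratedStructureMap K X σ n p =
      iteratedStructureMap K X σ n p ≫ ρ (n + p) (blockPerm g h) := by
  have h₁ := actionHomLeft_iteratedStructureMap σ ρ hσ n p g
  have h₂ := actionHomRight_iteratedStructureMap σ ρ hσ hρ n hφ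
  have h₃ := blockPerm_mul_blockPerm g 1 1 h
  rw [one_mul, mul_one] at h₃
  rw [actionHom_def', Category.assoc, h₁, reassoc_of% h₂, ← h₃, map_mul]
  rfl

-- For `p = 2` the iterated structure map is the double one up to the unit and rebracketing
-- isomorphisms, which cancel.
omit hσ in
lemma symm_comp_of_iterated_equivariant (n : ℕ)
    (h : X n ⊴ᵣ SymmetricSpectrum.braidLast K (tensorPower K 0) ≫
      iteratedStructureMap K X σ n (0 + 2) = iteratedStructureMap K X σ n (0 + 2) ≫
        ρ (n + (0 + 2)) (blockPerm (m := n) (n := 0 + 2) 1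
          (blockPerm 1 (Equiv.swap 0 1 : Equiv.Perm (Fin 2))))) :
    SymmetricSpectrum.symm K (X n) ≫ σ n ⊵ᵣ K ≫ σ (n + 1) =
      σ n ⊵ᵣ K ≫ σ (n + 1) ≫ ρ (n + 2) (blockPerm 1 (Equiv.swap 0 1 : Equiv.Perm (Fin 2))) := by
  rw [← blockPerm_blockPerm_two, blockPerm_one_one, braidLast_iteratedStructureMap,
    iteratedStructureMap_add_two] at h
  have : IsIso (iteratedStructureMap K X σ n 0) :=
    (inferInstance : IsIso (ρᵣ[D] (X n)).hom)
  refine (cancel_epi (SymmetricSpectrum.unbracket (X n) (tensorPower K 0) K K ≫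
    (iteratedStructureMap K X σ n 0 ⊵ᵣ K) ⊵ᵣ K)).1 (h.trans ?_)
  exact (Category.assoc _ _ _).trans (_ ≫= Category.assoc _ _ _)

end

namespace SymmetricSpectrum

variable (C) [SymmetricCategory D] (K : D)

/-- Symmetric spectra are spectra of the symmetric shape. -/
def toShapedSpectrum : SymmetricSpectrum C K ⥤ ShapedSpectrum (SpectrumShape.symmetric C K) where
  obj X :=
    { X := X.X
      ρ := X.ρ
      σ := X.σ
      σ_equivariant := X.σ_equivariant
      braid n := symm_comp_of_iterated_equivariant X.σ X.ρ n (by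
        have := X.iterated_equivariant n (0 + 2) 1 _ _ (.braid 0)
        rw [map_one] at this
        exact (congrArg (· ≫ _) (id_actionHom _ _)).symm.trans this) }
  map f :=
    { hom := f.hom
      equivariant := f.equivariant
      comm := f.comm }

/-- Spectra of the symmetric shape are symmetric spectra. -/
def ofShapedSpectrum (Y : ShapedSpectrum (SpectrumShape.symmetric C K)) :
    SymmetricSpectrum C K where
  X := Y.X
  ρ := Y.ρ
  σ := Y.σ
  σ_equivariant := Y.σ_equivariant
  iterated_equivariant := iteratedStructureMap_equivariant Y.σ Y.ρ Y.σ_equivariant Y.braid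

instance : (toShapedSpectrum C K).IsEquivalence where
  faithful := ⟨fun h ↦ Hom.ext (congrArg ShapedSpectrum.Hom.hom h)⟩
  full := ⟨fun f ↦ ⟨⟨f.hom, f.equivariant, f.comm⟩, rfl⟩⟩
  essSurj := ⟨fun Y ↦ ⟨ofShapedSpectrum C K Y, ⟨Iso.refl _⟩⟩⟩

end SymmetricSpectrum

end

/-! ### Tensoring with a cofibrant object -/

section Module

variable {D : Type u'} [Category.{v} D] [MonoidalCategory D] [CategoryWithFibrations D]
  [CategoryWithCofibrations D] [CategoryWithWeakEquivalences D] [IsModelCategory D]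
  {C : Type u} [Category.{v} C] [CategoryWithFibrations C] [CategoryWithCofibrations C]
  [CategoryWithWeakEquivalences C] [IsModelCategory C] [MonoidalRightAction D C]

/-- The action of a cofibrant object is a left Quillen functor. -/
lemma IsModuleModelCategory.isLeftQuillen_actionRight (H : IsModuleModelCategory D C) (K : D)
    [IsCofibrant K] : IsLeftQuillen (actionRight C K) := by
  have key {X Y : C} (f : X ⟶ Y) (hf : cofibrations C f) :
      cofibrations C (f ⊵ᵣ K) ∧ (weakEquivalences C f → weakEquivalences C (f ⊵ᵣ K)) := by
    have hI (Z : C) : IsInitial (Z ⊙ᵣ (⊥_ D)) := by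
      have := H.enriched Z
      exact IsInitial.isInitialObj (actionLeft D Z) _ initialIsInitial
    have : IsIso (((curriedAction D C).obj (⊥_ D)).map f) := isIso_of_isInitial (hI X) (hI Y) _
    -- Acting on a fixed object is a left adjoint, so `X ⊙ᵣ ⊥_ D` is initial. The pushout product of
    -- `f` with the map from the initial object to `K` is therefore `f ⊵ᵣ K`.
    let sq : (curriedAction D C).PushoutObjObj (initial.to K) f :=
      { pt := ((curriedAction D C).obj K).obj X
        inl := 𝟙 _
        inr := (hI Y).to _
        isPushout := IsPushout.of_vert_isIso ⟨(hI X).hom_ext _ _⟩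
        ι := f ⊵ᵣ K
        inl_ι := Category.id_comp _
        inr_ι := (hI Y).hom_ext _ _ }
    have hK : cofibrations D (initial.to K) := (cofibration_iff _).1 inferInstance
    obtain ⟨h₁, h₂⟩ := H.pushoutProduct _ _ sq hK hf
    exact ⟨h₁, fun h ↦ h₂ (.inr h)⟩
  exact ⟨H.cotensored K, fun _ _ f hf ↦ (key f hf).1,
    fun _ _ f hf ↦ ⟨(key f hf.1).1, (key f hf.1).2 hf.2⟩⟩

/-- Symmetric spectra for a cofibrant object. -/
theorem SymmetricSpectrum.isProjective [SymmetricCategory D] (H : IsModuleModelCategory D C) (K : D)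
    [IsCofibrant K] : IsProjective (ev C K) :=
  have : (SpectrumShape.symmetric C K).T.IsLeftAdjoint := H.cotensored K
  ShapedSpectrum.isProjective_of_isEquivalence (P := SpectrumShape.symmetric C K)
    (H.isLeftQuillen_actionRight K) (commutes_symmetric K) blockPerm_swap_mul_self
    (isFaithful_symmetric K) (toShapedSpectrum C K) rfl rfl rfl

end Module

end StableModel

theorem mainTheorem12 {C : Type u} [Category.{v} C] [CategoryWithFibrations C]
    [CategoryWithCofibrations C] [CategoryWithWeakEquivalences C]
    [StableModel.IsModelCategory C] (hproper : StableModel.IsLeftProper C)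
    (hcell : StableModel.IsCellular C) :
    -- spectra for a left Quillen endofunctor `G`
    (∀ G : C ⥤ C, StableModel.IsLeftQuillen G →
      StableModel.IsModelCategory (StableModel.Spectrum G) ∧
      StableModel.IsLeftProper (StableModel.Spectrum G) ∧
      StableModel.IsCellular (StableModel.Spectrum G) ∧
      (∀ n, (StableModel.Spectrum.ev G n).IsRightAdjoint) ∧
      ∀ F : ℕ → C ⥤ StableModel.Spectrum G,
        (∀ n, Nonempty (F n ⊣ StableModel.Spectrum.ev G n)) →
        ∀ I J : MorphismProperty C, StableModel.IsCellularBy I J →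
          StableModel.IsCellularBy (StableModel.freeMaps F I) (StableModel.freeMaps F J)) ∧
    -- symmetric spectra for a cofibrant object `K` of a symmetric monoidal model category `D`
    (∀ {D : Type u'} [Category.{v} D] [MonoidalCategory D] [SymmetricCategory D]
      [MonoidalClosed D] [CategoryWithFibrations D] [CategoryWithCofibrations D]
      [CategoryWithWeakEquivalences D] [StableModel.IsModelCategory D]
      [MonoidalRightAction D C],
      StableModel.IsMonoidalModelCategory D → StableModel.IsModuleModelCategory D C →
      ∀ K : D, IsCofibrant K →
        StableModel.IsModelCategory (StableModel.SymmetricSpectrum C K) ∧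
        StableModel.IsLeftProper (StableModel.SymmetricSpectrum C K) ∧
        StableModel.IsCellular (StableModel.SymmetricSpectrum C K) ∧
        (∀ n, (StableModel.SymmetricSpectrum.ev C K n).IsRightAdjoint) ∧
        ∀ F : ℕ → C ⥤ StableModel.SymmetricSpectrum C K,
          (∀ n, Nonempty (F n ⊣ StableModel.SymmetricSpectrum.ev C K n)) →
          ∀ I J : MorphismProperty C, StableModel.IsCellularBy I J →
            StableModel.IsCellularBy (StableModel.freeMaps F I) (StableModel.freeMaps F J)) := by
  refine ⟨fun G hG ↦ (StableModel.Spectrum.isProjective G hG).main hproper hcell, ?_⟩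
  intro D _ _ _ _ _ _ _ _ _ _ hC K _
  exact (StableModel.SymmetricSpectrum.isProjective hC K).main hproper hcell
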